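/- Let $n\ge 2$. For a finite group $W$ generated by a finite set $S$, let $\ell(w)$ be the least length of an expression of $w\in W$ as a product of elements of $S$, let $\mathrm{Des}(w)=\{s\in S:\ell(ws)<\ell(w)\}$, and for $J\subseteq S$ put $Y_J=\sum_{\mathrm{Des}(w)=J}w$ and $X_J=\sum_{I\subseteq J}Y_I$ in the group algebra $\mathbb{Q}W$. Let $\mathcal{B}_n$ be the group of signed permutations of $\{1,\dots,n\}$, generated by the transpositions $s_i=(i,i+1)$, $1\le i\le n-1$, and (if $n\ge1$) the element $s_0=\bar 1\,2\cdots n$; let $\mathcal{D}_n\subseteq\mathcal{B}_n$ be the subgroup of elements with an even number of bars, generated for $n\ge2$ by $s_1,\dots,s_{n-1}$ and $s_{1'}=\bar 2\,\bar 1\,3\cdots n$. Generators are identified with their labels. Let $\Sigma(B_n)\subseteq\mathbb{Q}\mathcal{B}_n$ and $\Sigma(D_n)\subseteq\mathbb{Q}\mathcal{D}_n$ be the descent algebras, i.e. the spans of the corresponding $Y_J$. Let $\varphi:\mathbb{Q}\mathcal{B}_n\to\mathbb{Q}\mathcal{S}_n$ be the linear extension of the homomorphism that forgets the signs, and $\psi$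 its restriction to $\mathbb{Q}\mathcal{D}_n$. For $w\in\mathcal{S}_n$ let $\mathrm{Peak}(w)=\{i\in\{1,\dots,n-1\}: w_{i-1}<w_i>w_{i+1}\}$, with $w_0=0$, and let the set of interior peaks of $w$ be $\mathrm{Peak}(w)\setminus\{1\}$. Let $\mathcal{F}_n$ be the family of subsets of $\{1,\dots,n-1\}$ without two consecutive elements. For $F\in\mathcal{F}_n$ let $P_F$ be the sum of all $w\in\mathcal{S}_n$ with peak set $F$, and for $F\in\mathcal{F}_n$ with $1\notin F$ let $\mathring{P}_F$ be the sum of all $w\in\mathcal{S}_n$ with set of interior peaks $F$. Let $\mathfrak{P}_n$ be the span of the $P_F$ (the peak algebra) and $\mathring{\mathfrak{P}}_n$ the span of the $\mathring{P}_F$ (the peak ideal). Let $I_n^{1',1}$ be the span of all $X_J\in\Sigma(D_n)$ such that $1'\in J$ or $1\in J$. **Theorem.** $\Sigma(D_n)$, $\Sigma(B_{n-2})$, $\mathfrak{P}_n$, $\mathfrak{P}_{n-2}$ are unital subalgebras of the respective group algebras, $I_n^{1',1}$ is a two-sided ideal of $\Sigma(D_n)$, and $\mathring{\mathfrak{P}}_n$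 is a two-sided ideal of $\mathfrak{P}_n$. There are morphisms of algebras $\gamma:\Sigma(D_n)\to\Sigma(B_{n-2})$ and $\pi:\mathfrak{P}_n\to\mathfrak{P}_{n-2}$ with $$\gamma(X_J)=\begin{cases}X_{J-2}&\text{if }1,1'\notin J,\\0&\text{if }1\in J\text{ or }1'\in J,\end{cases}\qquad \pi(P_F)=\begin{cases}P_{F-2}&\text{if }1,2\notin F,\\-P_{(F\setminus\{1\})-2}&\text{if }1\in F,\\0&\text{if }2\in F,\end{cases}$$ for all sets $J$ of labels of $D_n$ and all $F\in\mathcal{F}_n$, where $J-2=\{j-2: j\in J\}$ for a set $J$ of integers. The maps $\psi$ and $\varphi$ restrict to the vertical maps of a commutative diagram $$\begin{array}{ccccccccc} 0&\to& I_n^{1',1}&\hookrightarrow&\Sigma(D_n)&\xrightarrow{\ \gamma\ }&\Sigma(B_{n-2})&\to&0\\ &&{\scriptstyle\psi}\downarrow&&{\scriptstyle\psi}\downarrow&&{\scriptstyle\varphi}\downarrow&&\\ 0&\to&\mathring{\mathfrak{P}}_n&\hookrightarrow&\mathfrak{P}_n&\xrightarrow{\ \pi\ }&\mathfrak{P}_{n-2}&\to&0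 \end{array}$$ whose vertical maps $\psi$, $\psi$ and $\varphi$ restrict to morphisms of algebras $\Sigma(D_n)\to\mathfrak{P}_n$ and $\Sigma(B_{n-2})\to\mathfrak{P}_{n-2}$ and to a linear map $I_n^{1',1}\to\mathring{\mathfrak{P}}_n$, whose rows are exact, and whose vertical maps are all surjective. -/

import Mathlib

noncomputable section

namespace PeakDescent

/-! ### Descent spaces of a finite group with a family of generators -/

section Descent

variable {W : Type*} [Group W] {ι : Type*}

/-- The length `ℓ(w)`: the least length of an expression of `w` as a product of the
generators `s i`. -/
def wordLength (s : ι → W) (w : W) : ℕ :=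
  sInf {k | ∃ l : List ι, l.length = k ∧ (l.map s).prod = w}

variable [Fintype ι]

/-- The descent set `Des(w) = {i | ℓ(w s_i) < ℓ(w)}`. -/
def descentSet (s : ι → W) (w : W) : Finset ι :=
  Finset.univ.filter fun i => wordLength s (w * s i) < wordLength s w

variable [Fintype W] [DecidableEq ι]

/-- `Y_J`, the sum in the group algebra of all `w` with `Des(w) = J`. -/
def elemY (s : ι → W) (J : Finset ι) : MonoidAlgebra ℚ W :=
  ∑ w ∈ Finset.univ.filter (fun w : W => descentSet s w = J), MonoidAlgebra.of ℚ W w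

/-- `X_J = ∑_{I ⊆ J} Y_I`. -/
def elemX (s : ι → W) (J : Finset ι) : MonoidAlgebra ℚ W :=
  ∑ I ∈ J.powerset, elemY s I

/-- The subspace of the group algebra spanned by the elements `Y_J`; it underlies
Solomon's descent algebra. -/
def descentSpace (s : ι → W) : Submodule ℚ (MonoidAlgebra ℚ W) :=
  Submodule.span ℚ (Set.range (elemY s))

end Descent

/-! ### Signed permutations: types B and D -/

/-- The group `S_n ⋉ Z_2^n` of signed permutations. The element `⟨ε, σ⟩` is the signed
permutation `i ↦ ε (σ i) · σ i`; that is, its `i`-th entry is the symbol `σ i`, which is barred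
if and only if `ε (σ i) = -1`. The symbols `1, …, n` are represented by `Fin n`. -/
abbrev SignedPerm (n : ℕ) : Type :=
  (Fin n → ℤˣ) ⋊[mulAutArrow] Equiv.Perm (Fin n)

instance (n : ℕ) : Fintype (SignedPerm n) :=
  Fintype.ofEquiv ((Fin n → ℤˣ) × Equiv.Perm (Fin n))
    (SemidirectProduct.equivProd (N := Fin n → ℤˣ) (G := Equiv.Perm (Fin n))
      (φ := mulAutArrow)).symm

/-- Forgetting the signs. -/
def forgetSigns (n : ℕ) : SignedPerm n →* Equiv.Perm (Fin n) :=
  SemidirectProduct.rightHom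

/-- The generators `s_0, …, s_{n-1}` of type `B_n`: `s_0` changes the sign of the first symbol,
and `s_i` for `i ≥ 1` is the transposition `(i, i+1)` of symbols (the symbols `i` and `i+1` are
the elements `i-1` and `i` of `Fin n`). -/
def genB (n : ℕ) (i : Fin n) : SignedPerm n :=
  if i.val = 0 then SemidirectProduct.inl (Pi.mulSingle i (-1))
  else SemidirectProduct.inr (Equiv.swap ⟨i.val - 1, by omega⟩ i)

theorem prod_sign_eq_one_iff {n : ℕ} (e : Fin n → ℤˣ) :
    Even (Finset.univ.filter fun j => e j = -1).card ↔ ∏ j, e j = 1 := by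
  have h : ∏ j, e j = (-1 : ℤˣ) ^ (Finset.univ.filter fun j => e j = -1).card := by
    rw [← Finset.prod_const, Finset.prod_filter]
    refine Finset.prod_congr rfl fun j _ => ?_
    rcases Int.units_eq_one_or (e j) with h | h <;> simp [h]
  rw [h]
  constructor
  · exact Even.neg_one_pow
  · intro h1
    by_contra h2
    rw [Nat.not_even_iff_odd] at h2
    rw [h2.neg_one_pow] at h1
    exact absurd h1 (by decide)

/-- The group `D_n` of signed permutations with an even number of barred entries. -/
def evenSigned (n : ℕ) : Subgroup (SignedPerm n) where
  carrier := {w | Even (Finset.univ.filter fun j => w.left j = -1).card}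
  one_mem' := by simp [prod_sign_eq_one_iff]
  mul_mem' := by
    intro a b ha hb
    simp only [Set.mem_ofPred_eq, prod_sign_eq_one_iff] at ha hb ⊢
    have h : ∏ j, (mulAutArrow a.right b.left) j = ∏ j, b.left j :=
      Equiv.prod_comp (a.right⁻¹ : Equiv.Perm (Fin n)) b.left
    simp only [SemidirectProduct.mul_left, Pi.mul_apply, Finset.prod_mul_distrib, ha, h, hb,
      mul_one]
  inv_mem' := by
    intro a ha
    simp only [Set.mem_ofPred_eq, prod_sign_eq_one_iff] at ha ⊢
    have h : ∏ j, (mulAutArrow a.right⁻¹ a.left⁻¹) j = ∏ j, (a.left⁻¹) j :=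
      Equiv.prod_comp ((a.right⁻¹)⁻¹ : Equiv.Perm (Fin n)) a.left⁻¹
    rw [SemidirectProduct.inv_left, h]
    simp [ha]

instance (n : ℕ) : Fintype (evenSigned n) :=
  Fintype.ofFinite _

/-- The generator `s_{1'}` of type `D_{m+2}`: the signed permutation with entries
`-2, -1, 3, …, m+2`. -/
def genPrime (m : ℕ) : evenSigned (m + 2) :=
  ⟨⟨fun j => if j.val < 2 then -1 else 1, Equiv.swap 0 1⟩, by
    change Even (Finset.univ.filter fun j : Fin (m + 2) =>
      (if j.val < 2 then (-1 : ℤˣ) else 1) = -1).card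
    rw [prod_sign_eq_one_iff]
    simp [Fin.prod_univ_succ]⟩

/-- The generators of type `D_{m+2}`: `none` stands for the label `1'`, and `some i` for the
label `i + 1 ∈ {1, …, m+1}`, whose generator is the transposition `(i+1, i+2)` of symbols. -/
def genD (m : ℕ) : Option (Fin (m + 1)) → evenSigned (m + 2)
  | none => genPrime m
  | some i => ⟨SemidirectProduct.inr (Equiv.swap i.castSucc i.succ), by
      change Even (Finset.univ.filter fun j : Fin (m + 2) => (1 : Fin (m + 2) → ℤˣ) j = -1).card
      simp⟩

/-- For a set `J` of labels of type `D_{m+2}`, the set `J - 2` of labels of type `B_m`, obtained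
from the elements `≥ 2` of `J`. The label `k ∈ {0, …, m-1}` is in it if and only if `k + 2 ∈ J`;
the label `k + 2` of type `D_{m+2}` is `some k.succ`. -/
def shiftD {m : ℕ} (J : Finset (Option (Fin (m + 1)))) : Finset (Fin m) :=
  Finset.univ.filter fun k => some k.succ ∈ J

/-- The ideal `I^{1',1}_{m+2}`, spanned by the `X_J` with `1' ∈ J` or `1 ∈ J`. -/
def canonicalIdealD (m : ℕ) : Submodule ℚ (MonoidAlgebra ℚ (evenSigned (m + 2))) :=
  Submodule.span ℚ
    {x | ∃ J : Finset (Option (Fin (m + 1))), (none ∈ J ∨ some 0 ∈ J) ∧ x = elemX (genD m) J}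

/-- The linear extension of the map `B_n → S_n` that forgets the signs. -/
def phiHom (n : ℕ) :
    MonoidAlgebra ℚ (SignedPerm n) →ₐ[ℚ] MonoidAlgebra ℚ (Equiv.Perm (Fin n)) :=
  MonoidAlgebra.mapDomainAlgHom ℚ ℚ (forgetSigns n)

/-- The linear extension of the map `D_n → S_n` that forgets the signs. -/
def psiHom (n : ℕ) :
    MonoidAlgebra ℚ (evenSigned n) →ₐ[ℚ] MonoidAlgebra ℚ (Equiv.Perm (Fin n)) :=
  MonoidAlgebra.mapDomainAlgHom ℚ ℚ ((forgetSigns n).comp (evenSigned n).subtype)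

/-! ### Peaks of permutations -/

/-- The entry `w_i ∈ {1, …, n}` for `i ∈ {1, …, n}`, with the convention `w_0 = 0`. -/
def entry {n : ℕ} (w : Equiv.Perm (Fin n)) (i : ℕ) : ℕ :=
  if h : 1 ≤ i ∧ i ≤ n then (w ⟨i - 1, by omega⟩).val + 1 else 0

/-- `Peak(w) = {i ∈ {1, …, n-1} | w_{i-1} < w_i > w_{i+1}}`. -/
def peakSet {n : ℕ} (w : Equiv.Perm (Fin n)) : Finset ℕ :=
  (Finset.Icc 1 (n - 1)).filter fun i =>
    entry w (i - 1) < entry w i ∧ entry w (i + 1) < entry w i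

/-- The interior peaks: `{i ∈ {2, …, n-1} | w_{i-1} < w_i > w_{i+1}}`. -/
def interiorPeakSet {n : ℕ} (w : Equiv.Perm (Fin n)) : Finset ℕ :=
  (Finset.Icc 2 (n - 1)).filter fun i =>
    entry w (i - 1) < entry w i ∧ entry w (i + 1) < entry w i

/-- The family `F_n` of subsets of `{1, …, n-1}` without two consecutive elements. -/
def IsPeakIndex (n : ℕ) (F : Finset ℕ) : Prop :=
  F ⊆ Finset.Icc 1 (n - 1) ∧ ∀ i ∈ F, i + 1 ∉ F

/-- `P_F`, the sum of all permutations with peak set `F`. -/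
def elemP (n : ℕ) (F : Finset ℕ) : MonoidAlgebra ℚ (Equiv.Perm (Fin n)) :=
  ∑ w ∈ Finset.univ.filter (fun w : Equiv.Perm (Fin n) => peakSet w = F),
    MonoidAlgebra.of ℚ (Equiv.Perm (Fin n)) w

/-- The sum of all permutations whose set of interior peaks is `F`. -/
def elemPInt (n : ℕ) (F : Finset ℕ) : MonoidAlgebra ℚ (Equiv.Perm (Fin n)) :=
  ∑ w ∈ Finset.univ.filter (fun w : Equiv.Perm (Fin n) => interiorPeakSet w = F),
    MonoidAlgebra.of ℚ (Equiv.Perm (Fin n)) w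

/-- The subspace spanned by the `P_F`, `F ∈ F_n`; it underlies the peak algebra. -/
def peakSpace (n : ℕ) : Submodule ℚ (MonoidAlgebra ℚ (Equiv.Perm (Fin n))) :=
  Submodule.span ℚ {x | ∃ F, IsPeakIndex n F ∧ x = elemP n F}

/-- The peak ideal, spanned by the sums of permutations with interior peak set `F`, over all
`F ∈ F_n` with `1 ∉ F`. -/
def peakIdeal (n : ℕ) : Submodule ℚ (MonoidAlgebra ℚ (Equiv.Perm (Fin n))) :=
  Submodule.span ℚ {x | ∃ F, IsPeakIndex n F ∧ 1 ∉ F ∧ x = elemPInt n F}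

/-- The value at `P_F` of the map from the peak algebra of `S_{m+2}` to that of `S_m`. -/
def piValue (m : ℕ) (F : Finset ℕ) : MonoidAlgebra ℚ (Equiv.Perm (Fin m)) :=
  if 1 ∈ F then -elemP m ((F.erase 1).image (· - 2))
  else if 2 ∈ F then 0
  else elemP m (F.image (· - 2))

/-- The value at `X_J` of the map from the descent algebra of type `D_{m+2}` to that of
type `B_m`. -/
def gammaValue (m : ℕ) (J : Finset (Option (Fin (m + 1)))) : MonoidAlgebra ℚ (SignedPerm m) :=
  if none ∈ J ∨ some 0 ∈ J then 0 else elemX (genB m) (shiftD J)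

end PeakDescent

end

/-! Both descent algebras are studied through root systems with an isometric action on `ℤ^n`. The
length counts the positive roots made negative, so `i` is a descent of `w` exactly when `w` makes
the `i`-th simple root negative. A set of labels is encoded as the support of a dominant vector `d`,
the set of simple roots not orthogonal to `d`. Then `X_{supp d}` is the sum of the minimal coset
representatives of the stabilizer of `d`, and Solomon's formula `elemX_mul_elemX` reads `X_{supp d}
X_{supp e} = ∑ X_{supp e ∪ supp x}`, over the `x` in the orbit of `d` that are nonnegative on the
simple roots orthogonal to `e`. Closure under products follows.

The map `γ` is multiplicative (`map_elemX_mul_elemX`) because `1, 1' ∉ supp x` means that `x` starts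
with two zeros. Deleting these zeros turns orbits of type `D_n` into orbits of type `B_{n-2}`, since
the parity of the signs does not matter once a coordinate vanishes, and all other terms of Solomon's
formula are killed by `γ`.

Forgetting signs is a count of signings. Each type B descent condition fixes the sign of the larger
of two neighbouring entries, so a peak gets two conditions, a valley none, and every other position
one. There are as many valleys as peaks, whence `φ(Y_J) = ∑_{F ⊆ D} 2^|F| P_F`, where `D` is the set
of positions at which membership in `J` changes (`phiHom_elemY`). Type D reduces to this count,
because changing the sign of the smallest symbol preserves the type D descents: `ψ(Y_J)` is a sum of
the same kind over `F ⊆ D ∩ {2, 3, …}`, with `P_F` replaced by `P_{F ∪ {1}}` when exactly one of `1,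
1'` is in `J`. By triangularity the images are the peak spaces, which are therefore subalgebras.

On the other basis, `γ(Y_J) = (-1)^{|J ∩ {1,1'}|} Y_{J-2}`, and comparing values on the `Y_J` gives
`φ γ = π ψ` (`phiHom_gamma_eq`). As `ψ` is onto, `π` inherits multiplicativity from `γ`. The kernels
are computed with explicit linear sections of `γ` and `π`; being kernels, they are ideals. -/

namespace PeakDescent

open Finset

/-! ### Root frames -/

/-- A linear action of a group on `ℤ^n` by isometries, together with a finite root system whose
simple reflections are the given generators. Positivity of roots is measured against `rho`. -/
structure RootFrame {W ι : Type*} [Group W] (s : ι → W) (n : ℕ) where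
  act : W →* AddMonoid.End (Fin n → ℤ)
  act_dot : ∀ w x y, act w x ⬝ᵥ act w y = x ⬝ᵥ y
  roots : Set (Fin n → ℤ)
  finite : roots.Finite
  simple : ι → Fin n → ℤ
  rho : Fin n → ℤ
  simple_mem : ∀ i, simple i ∈ roots
  neg_mem : ∀ r ∈ roots, -r ∈ roots
  act_mem : ∀ w, ∀ r ∈ roots, act w r ∈ roots
  rho_ne : ∀ r ∈ roots, r ⬝ᵥ rho ≠ 0
  simple_pos : ∀ i, 0 < simple i ⬝ᵥ rho
  mem_closure : ∀ r ∈ roots, 0 < r ⬝ᵥ rho → r ∈ AddSubmonoid.closure (Set.range simple)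
  reduced : ∀ i (k : ℕ), k • simple i ∈ roots → k = 1
  gen_sq : ∀ i, s i * s i = 1
  act_simple : ∀ i, act (s i) (simple i) = -simple i
  act_fix : ∀ i d, simple i ⬝ᵥ d = 0 → act (s i) d = d
  eq_one : ∀ w, (∀ i, 0 < act w (simple i) ⬝ᵥ rho) → w = 1
  weight : ∀ J : Set ι, ∃ d, ∀ i, (i ∈ J → 0 < simple i ⬝ᵥ d) ∧ (i ∉ J → simple i ⬝ᵥ d = 0)

/-! ### Length as the number of inversions, and descents as signs of roots. -/

namespace RootFrame

variable {W ι : Type*} [Group W] {s : ι → W} {n : ℕ} (R : RootFrame s n)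

theorem act_mul (v w : W) (x : Fin n → ℤ) : R.act (v * w) x = R.act v (R.act w x) := by
  rw [map_mul]; rfl

theorem act_one (x : Fin n → ℤ) : R.act 1 x = x := by
  rw [map_one]; rfl

theorem act_inv_act (w : W) (x : Fin n → ℤ) : R.act w⁻¹ (R.act w x) = x := by
  rw [← act_mul, inv_mul_cancel, act_one]

theorem act_act_inv (w : W) (x : Fin n → ℤ) : R.act w (R.act w⁻¹ x) = x := by
  rw [← act_mul, mul_inv_cancel, act_one]

theorem act_dot_right (w : W) (x y : Fin n → ℤ) : R.act w x ⬝ᵥ y = x ⬝ᵥ R.act w⁻¹ y := by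
  rw [← R.act_dot w x, act_act_inv]

/-- Simple roots are nonnegative on `d`. -/
def Dominant (d : Fin n → ℤ) : Prop := ∀ i, 0 ≤ R.simple i ⬝ᵥ d

theorem dot_nonneg {d : Fin n → ℤ} (hd : R.Dominant d) {r : Fin n → ℤ}
    (hr : r ∈ AddSubmonoid.closure (Set.range R.simple)) : 0 ≤ r ⬝ᵥ d := by
  induction hr using AddSubmonoid.closure_induction with
  | mem x hx => obtain ⟨i, rfl⟩ := hx; exact hd i
  | zero => simp
  | add x y _ _ hx hy => rw [add_dotProduct]; exact add_nonneg hx hy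

/-- A negative root is minus a sum of simple roots, hence nonpositive on a dominant vector. -/
theorem pos_of_dot_pos {d : Fin n → ℤ} (hd : R.Dominant d) {r : Fin n → ℤ} (hr : r ∈ R.roots)
    (h : 0 < r ⬝ᵥ d) : 0 < r ⬝ᵥ R.rho := by
  by_contra hn
  have h1 : 0 < (-r) ⬝ᵥ R.rho := by
    rw [neg_dotProduct]; have := R.rho_ne r hr; omega
  have h2 := R.dot_nonneg hd (R.mem_closure _ (R.neg_mem _ hr) h1)
  rw [neg_dotProduct] at h2; omega

/-- The simple reflection permutes the other positive roots. -/
theorem act_gen_pos {i : ι} {r : Fin n → ℤ} (hr : r ∈ R.roots) (hp : 0 < r ⬝ᵥ R.rho)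
    (hne : r ≠ R.simple i) : 0 < R.act (s i) r ⬝ᵥ R.rho := by
  -- This `d` is orthogonal to `simple i` alone among the simple roots and is fixed by `s i`. A
  -- positive root is either positive on `d`, and stays so under `s i`, or is a multiple of `simple
  -- i`.
  obtain ⟨d, hd⟩ := R.weight {i}ᶜ
  have hdom : R.Dominant d := fun j => by
    by_cases hj : j = i
    · exact ((hd j).2 (by simpa using hj)).ge
    · exact ((hd j).1 (by simpa using hj)).le
  have key : ∀ x ∈ AddSubmonoid.closure (Set.range R.simple), x ⬝ᵥ d = 0 →
      ∃ k : ℕ, x = k • R.simple i := by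
    intro x hx
    induction hx using AddSubmonoid.closure_induction with
    | mem x hx =>
      obtain ⟨j, rfl⟩ := hx
      intro h0
      by_cases hj : j = i
      · exact ⟨1, by rw [hj, one_smul]⟩
      · exact absurd h0 ((hd j).1 (by simpa using hj)).ne'
    | zero => exact fun _ => ⟨0, by simp⟩
    | add x y hx hy ihx ihy =>
      intro h0
      rw [add_dotProduct] at h0
      have h1 := R.dot_nonneg hdom hx
      have h2 := R.dot_nonneg hdom hy
      obtain ⟨k, rfl⟩ := ihx (by omega)
      obtain ⟨l, rfl⟩ := ihy (by omega)
      exact ⟨k + l, by rw [add_smul]⟩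
  have hc := R.mem_closure r hr hp
  rcases (R.dot_nonneg hdom hc).lt_or_eq with h | h
  · refine R.pos_of_dot_pos hdom (R.act_mem _ _ hr) ?_
    rwa [← R.act_fix i d ((hd i).2 (by simp)), R.act_dot]
  · obtain ⟨k, rfl⟩ := key r hc h.symm
    rw [R.reduced i k hr, one_smul] at hne
    exact absurd rfl hne

theorem act_mul_gen_simple (w : W) (i : ι) :
    R.act (w * s i) (R.simple i) = -R.act w (R.simple i) := by
  rw [act_mul, R.act_simple, map_neg]

/-- The positive roots sent to negative roots. -/
def inversions (w : W) : Set (Fin n → ℤ) :=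
  {r | r ∈ R.roots ∧ 0 < r ⬝ᵥ R.rho ∧ R.act w r ⬝ᵥ R.rho < 0}

theorem inversions_finite (w : W) : (R.inversions w).Finite :=
  R.finite.subset fun _ h => h.1

/-- The reflection `s i` permutes the positive roots other than `simple i`, which itself becomes a
new inversion. -/
theorem inversions_mul_gen {w : W} {i : ι} (h : 0 < R.act w (R.simple i) ⬝ᵥ R.rho) :
    R.inversions (w * s i) = insert (R.simple i) (R.act (s i) '' R.inversions w) := by
  have hs : ∀ x, R.act (s i) (R.act (s i) x) = x := fun x => by
    rw [← act_mul, R.gen_sq, act_one]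
  ext r
  simp only [Set.mem_insert_iff, Set.mem_image]
  constructor
  · rintro ⟨h1, h2, h3⟩
    by_cases hr : r = R.simple i
    · exact Or.inl hr
    · refine Or.inr ⟨R.act (s i) r, ⟨R.act_mem _ _ h1, R.act_gen_pos h1 h2 hr, ?_⟩, hs r⟩
      rwa [← act_mul]
  · rintro (rfl | ⟨x, ⟨h1, h2, h3⟩, rfl⟩)
    · refine ⟨R.simple_mem i, R.simple_pos i, ?_⟩
      rw [act_mul_gen_simple, neg_dotProduct]; omega
    · have hx : x ≠ R.simple i := by rintro rfl; omega
      refine ⟨R.act_mem _ _ h1, R.act_gen_pos h1 h2 hx, ?_⟩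
      rwa [act_mul, hs]

theorem ncard_inversions_mul_gen {w : W} {i : ι} (h : 0 < R.act w (R.simple i) ⬝ᵥ R.rho) :
    (R.inversions (w * s i)).ncard = (R.inversions w).ncard + 1 := by
  have hinj : Function.Injective (R.act (s i)) := fun x y hxy => by
    rw [← R.act_inv_act (s i) x, hxy, act_inv_act]
  rw [R.inversions_mul_gen h, Set.ncard_insert_of_notMem _ ((R.inversions_finite w).image _),
    Set.ncard_image_of_injective _ hinj]
  rintro ⟨x, ⟨h1, h2, h3⟩, hx⟩
  have : x = -R.simple i := by
    apply hinj
    rw [hx, map_neg, R.act_simple, neg_neg]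
  rw [this, neg_dotProduct] at h2
  have := R.simple_pos i
  omega

theorem ncard_inversions_mul_gen_of_neg {w : W} {i : ι}
    (h : R.act w (R.simple i) ⬝ᵥ R.rho < 0) :
    (R.inversions w).ncard = (R.inversions (w * s i)).ncard + 1 := by
  have h1 : 0 < R.act (w * s i) (R.simple i) ⬝ᵥ R.rho := by
    rw [act_mul_gen_simple, neg_dotProduct]; omega
  have h2 := R.ncard_inversions_mul_gen h1
  rwa [mul_assoc, R.gen_sq, mul_one] at h2

theorem act_simple_ne (w : W) (i : ι) : R.act w (R.simple i) ⬝ᵥ R.rho ≠ 0 :=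
  R.rho_ne _ (R.act_mem _ _ (R.simple_mem i))

/-- Multiplying by a generator whose simple root is made negative removes exactly one inversion; if
there is no such generator, then `w = 1` by `eq_one`. -/
theorem exists_word (w : W) :
    ∃ l : List ι, l.length = (R.inversions w).ncard ∧ (l.map s).prod = w := by
  induction hk : (R.inversions w).ncard generalizing w with
  | zero =>
    refine ⟨[], rfl, ?_⟩
    simp only [List.map_nil, List.prod_nil]
    refine (R.eq_one w fun i => ?_).symm
    by_contra hn
    have := R.ncard_inversions_mul_gen_of_neg
      (lt_of_le_of_ne (not_lt.1 hn) (R.act_simple_ne w i))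
    omega
  | succ k ih =>
    have : ∃ i, R.act w (R.simple i) ⬝ᵥ R.rho < 0 := by
      by_contra! hn
      have hw := R.eq_one w fun i => lt_of_le_of_ne (hn i) (R.act_simple_ne w i).symm
      have h0 : R.inversions w = ∅ := by
        ext r
        simp only [inversions, hw, act_one, Set.mem_ofPred_eq, Set.mem_empty_iff_false, iff_false]
        omega
      rw [h0] at hk
      simp at hk
    obtain ⟨i, hi⟩ := this
    have h1 := R.ncard_inversions_mul_gen_of_neg hi
    obtain ⟨l, hl, hp⟩ := ih (w * s i) (by omega)
    refine ⟨l ++ [i], by simp [hl], ?_⟩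
    simp [hp, mul_assoc, R.gen_sq]

theorem ncard_inversions_prod_le (l : List ι) :
    (R.inversions (l.map s).prod).ncard ≤ l.length := by
  induction l using List.reverseRecOn with
  | nil =>
    have h0 : R.inversions (1 : W) = ∅ := by
      ext r
      simp only [inversions, act_one, Set.mem_ofPred_eq, Set.mem_empty_iff_false, iff_false]
      omega
    simp [h0]
  | append_singleton l i ih =>
    simp only [List.map_append, List.map_cons, List.map_nil, List.prod_append, List.prod_singleton,
      List.length_append, List.length_singleton]
    rcases lt_or_gt_of_ne (R.act_simple_ne (l.map s).prod i) with h | h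
    · have := R.ncard_inversions_mul_gen_of_neg h; omega
    · have := R.ncard_inversions_mul_gen h; omega

theorem wordLength_eq (w : W) : wordLength s w = (R.inversions w).ncard := by
  apply le_antisymm
  · exact Nat.sInf_le (R.exists_word w)
  · refine le_csInf ⟨_, R.exists_word w⟩ ?_
    rintro k ⟨l, rfl, rfl⟩
    exact R.ncard_inversions_prod_le l

theorem mem_descentSet [Fintype ι] {w : W} {i : ι} :
    i ∈ descentSet s w ↔ R.act w (R.simple i) ⬝ᵥ R.rho < 0 := by
  simp only [descentSet, mem_filter, mem_univ, true_and, R.wordLength_eq]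
  rcases lt_or_gt_of_ne (R.act_simple_ne w i) with h | h
  · have := R.ncard_inversions_mul_gen_of_neg h; constructor <;> intro <;> omega
  · have := R.ncard_inversions_mul_gen h; constructor <;> intro <;> omega

theorem notMem_descentSet [Fintype ι] {w : W} {i : ι} :
    i ∉ descentSet s w ↔ 0 < R.act w (R.simple i) ⬝ᵥ R.rho := by
  rw [R.mem_descentSet]
  have := R.act_simple_ne w i
  omega

theorem descentSet_eq_empty [Fintype ι] (R : RootFrame s n) {w : W} (h : descentSet s w = ∅) : w = 1 :=
  R.eq_one w fun i => R.notMem_descentSet.1 (by simp [h])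

theorem descentSet_one [Fintype ι] (R : RootFrame s n) : descentSet s (1 : W) = ∅ := by
  ext i
  have := R.simple_pos i
  simp only [R.mem_descentSet, act_one, notMem_empty, iff_false]
  omega

end RootFrame

/-! ### Class sums in group algebras and linear maps prescribed on them. -/

section ClassSums

variable {W : Type*} [Group W] [Fintype W] {ι : Type*} [Fintype ι] [DecidableEq ι]

theorem elemX_eq_sum (s : ι → W) (J : Finset ι) :
    elemX s J = ∑ w ∈ univ.filter (fun w : W => descentSet s w ⊆ J), MonoidAlgebra.of ℚ W w := by
  classical
  unfold elemX elemY
  rw [← Finset.sum_biUnion]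
  · refine Finset.sum_congr ?_ fun _ _ => rfl
    ext w
    simp
  · intro I _ K _ hIK
    rw [Function.onFun, Finset.disjoint_left]
    intro w hI hK
    simp only [mem_filter, mem_univ, true_and] at hI hK
    exact hIK (hI.symm.trans hK)

theorem elemY_mem_span_elemX (s : ι → W) (J : Finset ι) :
    elemY s J ∈ Submodule.span ℚ (Set.range (elemX s)) := by
  induction J using Finset.strongInduction with
  | H J ih =>
    have : elemY s J = elemX s J - ∑ I ∈ J.ssubsets, elemY s I := by
      rw [elemX, ← Finset.insert_erase (Finset.mem_powerset_self J),
        Finset.sum_insert (Finset.notMem_erase _ _)]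
      exact (add_sub_cancel_right _ _).symm
    rw [this]
    exact Submodule.sub_mem _ (Submodule.subset_span ⟨J, rfl⟩)
      (Submodule.sum_mem _ fun I hI => ih I (Finset.mem_ssubsets.1 hI))

theorem elemX_mem_descentSpace (s : ι → W) (J : Finset ι) : elemX s J ∈ descentSpace s :=
  Submodule.sum_mem _ fun I _ => Submodule.subset_span ⟨I, rfl⟩

theorem descentSpace_eq_span_elemX (s : ι → W) :
    descentSpace s = Submodule.span ℚ (Set.range (elemX s)) := by
  apply le_antisymm <;> rw [descentSpace, Submodule.span_le]
  · rintro _ ⟨J, rfl⟩; exact elemY_mem_span_elemX s J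
  · rintro _ ⟨J, rfl⟩; exact elemX_mem_descentSpace s J

/-- A linear map with prescribed values on the sums of the nonempty classes of a function on the
group. -/
theorem exists_linearMap_classSum {G T M : Type*} [Monoid G] [Fintype G] [DecidableEq T]
    [AddCommGroup M] [Module ℚ M] (κ : G → T) (v : T → M) :
    ∃ f : MonoidAlgebra ℚ G →ₗ[ℚ] M, ∀ t, (∃ w, κ w = t) →
      f (∑ w ∈ univ.filter (fun w => κ w = t), MonoidAlgebra.of ℚ G w) = v t := by
  classical
  -- Each group element is sent to the value of its class divided by the size of the class. The map
  -- lives on the whole group algebra, so no basis of the span of the class sums is needed.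
  refine ⟨Finsupp.linearCombination ℚ (fun w =>
    ((univ.filter fun u => κ u = κ w).card : ℚ)⁻¹ • v (κ w)) ∘ₗ
      (MonoidAlgebra.coeffLinearEquiv ℚ).toLinearMap, ?_⟩
  rintro t ⟨w₀, rfl⟩
  rw [map_sum, Finset.sum_congr rfl (g := fun _ =>
    ((univ.filter fun u => κ u = κ w₀).card : ℚ)⁻¹ • v (κ w₀))]
  · rw [Finset.sum_const, ← Nat.cast_smul_eq_nsmul ℚ, smul_smul, mul_inv_cancel₀, one_smul]
    rw [Nat.cast_ne_zero, Finset.card_ne_zero]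
    exact ⟨w₀, by simp⟩
  · intro w hw
    simp only [mem_filter, mem_univ, true_and] at hw
    simp [MonoidAlgebra.of_apply, hw]

/-- Möbius inversion on the subsets, by recursion. It converts prescribed values on the `X_J` into
values on the `Y_J`. -/
theorem exists_sum_powerset_eq {ι M : Type*} [DecidableEq ι] [AddCommGroup M] (v : Finset ι → M) :
    ∃ u : Finset ι → M, ∀ J, ∑ I ∈ J.powerset, u I = v J := by
  let u : Finset ι → M := Finset.strongInduction (p := fun _ => M)
    fun J ih => v J - ∑ I ∈ J.ssubsets.attach, ih I.1 (Finset.mem_ssubsets.1 I.2)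
  have hu : ∀ J, u J = v J - ∑ I ∈ J.ssubsets, u I := fun J => by
    simp only [u]
    rw [Finset.strongInduction_eq, ← Finset.sum_attach J.ssubsets]
  refine ⟨u, fun J => ?_⟩
  rw [← Finset.insert_erase (Finset.mem_powerset_self J),
    Finset.sum_insert (Finset.notMem_erase _ _), hu]
  exact sub_add_cancel _ _

end ClassSums

/-! ### Dominant vectors, minimal coset representatives and Solomon's formula. -/

namespace RootFrame

variable {W ι : Type*} [Group W] {s : ι → W} {n : ℕ} (R : RootFrame s n) [Fintype ι]

/-- The simple roots that do not vanish on `d`. -/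
def supp (d : Fin n → ℤ) : Finset ι := univ.filter fun i => R.simple i ⬝ᵥ d ≠ 0

theorem mem_supp {d : Fin n → ℤ} {i : ι} : i ∈ R.supp d ↔ R.simple i ⬝ᵥ d ≠ 0 := by
  simp [supp]

/-- Minimal coset representatives of the stabilizer of `d` preserve positivity of the roots
vanishing on `d`. -/
theorem act_pos_of_descentSet_subset {d : Fin n → ℤ} (hd : R.Dominant d) {u : W}
    (hu : descentSet s u ⊆ R.supp d) {r : Fin n → ℤ} (hr : r ∈ R.roots)
    (hp : 0 < r ⬝ᵥ R.rho) (h0 : r ⬝ᵥ d = 0) : 0 < R.act u r ⬝ᵥ R.rho := by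
  have key : ∀ x ∈ AddSubmonoid.closure (Set.range R.simple), x ⬝ᵥ d = 0 →
      0 ≤ R.act u x ⬝ᵥ R.rho := by
    intro x hx
    induction hx using AddSubmonoid.closure_induction with
    | mem x hx =>
      obtain ⟨i, rfl⟩ := hx
      intro h
      have : i ∉ descentSet s u := fun hi => R.mem_supp.1 (hu hi) h
      exact (R.notMem_descentSet.1 this).le
    | zero => simp
    | add x y hx hy ihx ihy =>
      intro h
      rw [add_dotProduct] at h
      have h1 := R.dot_nonneg hd hx
      have h2 := R.dot_nonneg hd hy
      rw [map_add, add_dotProduct]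
      exact add_nonneg (ihx (by omega)) (ihy (by omega))
  exact lt_of_le_of_ne (key r (R.mem_closure r hr hp) h0) (R.rho_ne _ (R.act_mem _ _ hr)).symm

/-- The element `t = u⁻¹ v` fixes `d`, so it keeps positive the simple roots that are positive on
`d`. If `t` made negative a simple root `r` orthogonal to `d`, then `u` would keep `-t r` positive,
whereas `u (-t r) = -v r` is negative. Hence `t = 1` by `eq_one`. -/
theorem eq_of_act_eq {d : Fin n → ℤ} (hd : R.Dominant d) {u v : W}
    (hu : descentSet s u ⊆ R.supp d) (hv : descentSet s v ⊆ R.supp d)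
    (h : R.act u d = R.act v d) : u = v := by
  have ht : R.act (u⁻¹ * v) d = d := by rw [act_mul, ← h, act_inv_act]
  have h1 : u⁻¹ * v = 1 := R.eq_one _ fun i => by
    have hm := R.act_mem (u⁻¹ * v) _ (R.simple_mem i)
    have hval : R.act (u⁻¹ * v) (R.simple i) ⬝ᵥ d = R.simple i ⬝ᵥ d := by
      conv_lhs => rw [← ht]
      rw [R.act_dot]
    rcases (hd i).lt_or_eq with hi | hi
    · exact R.pos_of_dot_pos hd hm (by rwa [hval])
    · by_contra hn
      have hneg : 0 < (-R.act (u⁻¹ * v) (R.simple i)) ⬝ᵥ R.rho := by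
        rw [neg_dotProduct]
        have := R.rho_ne _ hm
        omega
      have h2 := R.act_pos_of_descentSet_subset hd hu (R.neg_mem _ hm) hneg
        (by rw [neg_dotProduct, hval, ← hi, neg_zero])
      have h3 := R.act_pos_of_descentSet_subset hd hv (R.simple_mem i) (R.simple_pos i) hi.symm
      rw [map_neg, ← act_mul, mul_inv_cancel_left, neg_dotProduct] at h2
      omega
  rw [inv_mul_eq_one] at h1
  exact h1

/-- A descent of `w` outside the support of `d` comes from a generator fixing `d`. Multiplying by it
shortens `w` without changing the image of `d`. -/
theorem exists_min_rep (w : W) (d : Fin n → ℤ) :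
    ∃ u, R.act u d = R.act w d ∧ descentSet s u ⊆ R.supp d := by
  induction hk : (R.inversions w).ncard using Nat.strong_induction_on generalizing w with
  | _ k ih =>
    by_cases h : descentSet s w ⊆ R.supp d
    · exact ⟨w, rfl, h⟩
    · obtain ⟨i, hi, hid⟩ := Finset.not_subset.1 h
      rw [R.mem_descentSet] at hi
      rw [R.mem_supp, not_not] at hid
      have h1 := R.ncard_inversions_mul_gen_of_neg hi
      obtain ⟨u, hu, hs⟩ := ih _ (by omega) (w * s i) rfl
      exact ⟨u, by rw [hu, act_mul, R.act_fix i d hid], hs⟩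

theorem exists_dominant_supp_eq (J : Finset ι) : ∃ d, R.Dominant d ∧ R.supp d = J := by
  obtain ⟨d, hd⟩ := R.weight J
  refine ⟨d, fun i => ?_, ?_⟩
  · by_cases hi : i ∈ J
    · exact ((hd i).1 hi).le
    · exact ((hd i).2 hi).ge
  · ext i
    rw [mem_supp]
    by_cases hi : i ∈ J
    · simpa [hi] using ((hd i).1 hi).ne'
    · simpa [hi] using (hd i).2 hi

variable [Fintype W]

/-- The witness is a longest element of the stabilizer of a vector `d` supported on the complement
of `J`: labels of `J` are descents by maximality, and simple roots positive on `d` stay positive.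
This makes all classes nonempty, as prescribing values on them requires. -/
theorem exists_descentSet_eq (R : RootFrame s n) (J : Finset ι) : ∃ w : W, descentSet s w = J := by
  classical
  obtain ⟨d, hd⟩ := R.weight ((J : Set ι)ᶜ)
  have hdom : R.Dominant d := fun j => by
    by_cases hj : j ∈ J
    · exact ((hd j).2 (by simpa using hj)).ge
    · exact ((hd j).1 (by simpa using hj)).le
  obtain ⟨w, hw, hmax⟩ := Finset.exists_max_image (univ.filter fun w : W => R.act w d = d)
    (fun w => (R.inversions w).ncard) ⟨1, by simp⟩
  simp only [mem_filter, mem_univ, true_and] at hw hmax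
  refine ⟨w, ?_⟩
  ext i
  constructor
  · contrapose
    intro hi
    rw [R.notMem_descentSet]
    refine R.pos_of_dot_pos hdom (R.act_mem _ _ (R.simple_mem i)) ?_
    rw [← hw, R.act_dot]
    exact (hd i).1 (by simpa using hi)
  · intro hi
    by_contra hn
    rw [R.notMem_descentSet] at hn
    have h1 := R.ncard_inversions_mul_gen hn
    have h2 := hmax (w * s i) (by rw [act_mul, R.act_fix i d ((hd i).2 (by simpa using hi)), hw])
    omega

/-- The vectors of the orbit of `d` that are dominant for the stabilizer of `e`. -/
def relDominant (d e : Fin n → ℤ) : Finset (Fin n → ℤ) :=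
  (univ.image fun w : W => R.act w d).filter fun x => ∀ i, R.simple i ⬝ᵥ e = 0 → 0 ≤ R.simple i ⬝ᵥ x

theorem mem_relDominant {d e x : Fin n → ℤ} : x ∈ R.relDominant d e ↔
    (∃ w : W, R.act w d = x) ∧ ∀ i, R.simple i ⬝ᵥ e = 0 → 0 ≤ R.simple i ⬝ᵥ x := by
  simp [relDominant]

variable [DecidableEq ι]

theorem exists_linearMap_elemX (R : RootFrame s n) {M : Type*} [AddCommGroup M] [Module ℚ M]
    (v : Finset ι → M) : ∃ f : MonoidAlgebra ℚ W →ₗ[ℚ] M, ∀ J, f (elemX s J) = v J := by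
  obtain ⟨u, hu⟩ := exists_sum_powerset_eq v
  obtain ⟨f, hf⟩ := exists_linearMap_classSum (descentSet s) u
  refine ⟨f, fun J => ?_⟩
  rw [elemX, map_sum, ← hu J]
  exact Finset.sum_congr rfl fun I _ => hf I (R.exists_descentSet_eq I)

theorem elemX_empty (R : RootFrame s n) : elemX s (∅ : Finset ι) = 1 := by
  classical
  have : (univ.filter fun w : W => descentSet s w ⊆ ∅) = {1} := by
    ext w
    simp only [subset_empty, mem_filter, mem_univ, true_and, mem_singleton]
    exact ⟨R.descentSet_eq_empty, fun h => h ▸ R.descentSet_one⟩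
  rw [elemX_eq_sum, this, Finset.sum_singleton, map_one]

/-- Solomon's product formula. -/
theorem elemX_mul_elemX {d : Fin n → ℤ} (hd : R.Dominant d) (e : Fin n → ℤ) :
    elemX s (R.supp d) * elemX s (R.supp e) =
      ∑ x ∈ R.relDominant d e, elemX s (R.supp e ∪ R.supp x) := by
  simp only [elemX_eq_sum]
  rw [Finset.sum_mul_sum, Finset.sum_sigma', Finset.sum_sigma']
  simp only [← map_mul]
  -- The bijection sends `(u, v)` to `(v⁻¹ d, u v)`. It is injective since `u v` applied to `v⁻¹ d`
  -- is `u d`, which determines `u`.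
  refine Finset.sum_bij (fun p _ => ⟨R.act p.2⁻¹ d, p.1 * p.2⟩) ?_ ?_ ?_ fun _ _ => rfl
  · rintro ⟨u, v⟩ h
    simp only [mem_sigma, mem_filter, mem_univ, true_and] at h
    obtain ⟨hu, hv⟩ := h
    have hv' : ∀ i, R.simple i ⬝ᵥ e = 0 → 0 < R.act v (R.simple i) ⬝ᵥ R.rho := fun i hi =>
      R.notMem_descentSet.1 fun h => R.mem_supp.1 (hv h) hi
    have hx : ∀ i, R.simple i ⬝ᵥ R.act v⁻¹ d = R.act v (R.simple i) ⬝ᵥ d := fun i =>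
      (R.act_dot_right _ _ _).symm
    simp only [mem_sigma, mem_relDominant, mem_filter, mem_univ, true_and]
    refine ⟨⟨⟨v⁻¹, rfl⟩, fun i hi => ?_⟩, fun i hi => ?_⟩
    · rw [hx]
      exact R.dot_nonneg hd (R.mem_closure _ (R.act_mem _ _ (R.simple_mem i)) (hv' i hi))
    · by_contra hn
      simp only [mem_union, mem_supp, not_or, not_not] at hn
      refine R.notMem_descentSet.2 ?_ hi
      rw [act_mul]
      exact R.act_pos_of_descentSet_subset hd hu (R.act_mem _ _ (R.simple_mem i)) (hv' i hn.1)
        (by rw [← hx, hn.2])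
  · rintro ⟨u, v⟩ h ⟨u', v'⟩ h' heq
    simp only [mem_sigma, mem_filter, mem_univ, true_and] at h h'
    simp only [Sigma.mk.injEq, heq_eq_eq] at heq
    obtain ⟨h1, h2⟩ := heq
    have h3 : R.act u d = R.act u' d := by
      have := congrArg (R.act (u * v)) h1
      conv_rhs at this => rw [h2]
      rwa [act_mul, act_mul, act_act_inv, act_act_inv] at this
    obtain rfl := R.eq_of_act_eq hd h.1 h'.1 h3
    rw [mul_right_inj] at h2
    rw [h2]
  · rintro ⟨x, w⟩ h
    simp only [mem_sigma, mem_relDominant, mem_filter, mem_univ, true_and] at h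
    obtain ⟨⟨⟨t, rfl⟩, hx⟩, hw⟩ := h
    -- For `x = t d`, the factor `u` must satisfy `u d = w x`, and then `v = u⁻¹ w`.
    obtain ⟨u, hu, hus⟩ := R.exists_min_rep (w * t) d
    have hx' : R.act (u⁻¹ * w)⁻¹ d = R.act t d := by
      rw [mul_inv_rev, inv_inv, act_mul, hu, act_mul, act_inv_act]
    refine ⟨⟨u, u⁻¹ * w⟩, ?_, ?_⟩
    · simp only [mem_sigma, mem_filter, mem_univ, true_and]
      refine ⟨hus, fun i hi => ?_⟩
      -- Let `r` be the simple root of a descent of `v` with `r` orthogonal to `e`. The positive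
      -- root `-v r` is nonnegative on `d`, while relative dominance makes `r ⬝ᵥ x = v r ⬝ᵥ d`
      -- nonnegative, so both vanish. Then `u` keeps `-v r` positive, so `i` is a descent of `w`
      -- outside both supports.
      by_contra hn
      rw [mem_supp, not_not] at hn
      rw [R.mem_descentSet] at hi
      have hm := R.neg_mem _ (R.act_mem (u⁻¹ * w) _ (R.simple_mem i))
      have hp : 0 < (-R.act (u⁻¹ * w) (R.simple i)) ⬝ᵥ R.rho := by
        rw [neg_dotProduct]; omega
      have h1 := R.dot_nonneg hd (R.mem_closure _ hm hp)
      have h2 : R.act (u⁻¹ * w) (R.simple i) ⬝ᵥ d = R.simple i ⬝ᵥ R.act t d := by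
        rw [R.act_dot_right, hx']
      have h3 := hx i hn
      rw [neg_dotProduct, h2] at h1
      have h4 := R.act_pos_of_descentSet_subset hd hus hm hp (by rw [neg_dotProduct, h2]; omega)
      rw [map_neg, ← act_mul, mul_inv_cancel_left, neg_dotProduct] at h4
      have h5 : i ∈ descentSet s w := R.mem_descentSet.2 (by omega)
      have h6 := hw h5
      simp only [mem_union, mem_supp] at h6
      omega
    · simp only [Sigma.mk.injEq, heq_eq_eq, mul_inv_cancel_left, and_true]
      exact hx'

/-- The descent algebra. -/
noncomputable def descentAlgebra (R : RootFrame s n) : Subalgebra ℚ (MonoidAlgebra ℚ W) :=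
  (descentSpace s).toSubalgebra
    (by rw [← R.elemX_empty]; exact elemX_mem_descentSpace s ∅) (by
      intro x y hx hy
      rw [descentSpace_eq_span_elemX] at hx hy
      induction hx, hy using Submodule.span_induction₂ with
      | mem_mem x y hx hy =>
        obtain ⟨I, rfl⟩ := hx
        obtain ⟨J, rfl⟩ := hy
        obtain ⟨d, hd, rfl⟩ := R.exists_dominant_supp_eq I
        obtain ⟨e, -, rfl⟩ := R.exists_dominant_supp_eq J
        rw [R.elemX_mul_elemX hd e]
        exact Submodule.sum_mem _ fun x _ => elemX_mem_descentSpace s _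
      | zero_left => rw [zero_mul]; exact zero_mem _
      | zero_right => rw [mul_zero]; exact zero_mem _
      | add_left x y z _ _ _ h1 h2 => rw [add_mul]; exact add_mem h1 h2
      | add_right x y z _ _ _ h1 h2 => rw [mul_add]; exact add_mem h1 h2
      | smul_left r x y _ _ h => rw [smul_mul_assoc]; exact Submodule.smul_mem _ _ h
      | smul_right r x y _ _ h => rw [mul_smul_comm]; exact Submodule.smul_mem _ _ h)

theorem toSubmodule_descentAlgebra :
    Subalgebra.toSubmodule R.descentAlgebra = descentSpace s :=
  Submodule.toSubalgebra_toSubmodule _ _ _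

end RootFrame

/-! ### The root frames of types B and D -/

/-- The action of signed permutations on `ℤ^n`. -/
def signedAct (n : ℕ) : SignedPerm n →* AddMonoid.End (Fin n → ℤ) where
  toFun w :=
    { toFun := fun x j => (w.left j : ℤ) * x (w.right⁻¹ j)
      map_zero' := by ext; simp
      map_add' := fun x y => by ext; simp [mul_add] }
  map_one' := by
    ext x j
    exact one_mul (x j)
  map_mul' v w := by
    ext x j
    exact mul_assoc (v.left j : ℤ) (w.left (v.right⁻¹ j)) (x (w.right⁻¹ (v.right⁻¹ j)))

theorem signedAct_apply {n : ℕ} (w : SignedPerm n) (x : Fin n → ℤ) (j : Fin n) :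
    signedAct n w x j = (w.left j : ℤ) * x (w.right⁻¹ j) := rfl

theorem signedAct_inv_apply {n : ℕ} (w : SignedPerm n) (x : Fin n → ℤ) (p : Fin n) :
    signedAct n w⁻¹ x p = (w.left (w.right p) : ℤ) * x (w.right p) := by
  rw [signedAct_apply, SemidirectProduct.inv_right, inv_inv]
  have : (w⁻¹).left p = (w.left (w.right p))⁻¹ := by
    rw [SemidirectProduct.inv_left]
    change (w.left ((w.right⁻¹)⁻¹ p))⁻¹ = _
    rw [inv_inv]
  rw [this, Int.units_inv_eq_self]

theorem signedAct_act_inv {n : ℕ} (w : SignedPerm n) (x : Fin n → ℤ) :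
    signedAct n w (signedAct n w⁻¹ x) = x := by
  have : signedAct n (w * w⁻¹) x = x := by rw [mul_inv_cancel, map_one]; rfl
  rwa [map_mul] at this

theorem units_coe_mul_self (u : ℤˣ) : (u : ℤ) * u = 1 := by
  rcases Int.units_eq_one_or u with rfl | rfl <;> rfl

theorem signedAct_dot {n : ℕ} (w : SignedPerm n) (x y : Fin n → ℤ) :
    signedAct n w x ⬝ᵥ signedAct n w y = x ⬝ᵥ y := by
  simp only [dotProduct, signedAct_apply]
  rw [← Equiv.sum_comp w.right]
  refine Finset.sum_congr rfl fun i _ => ?_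
  rw [mul_mul_mul_comm, units_coe_mul_self, one_mul, Equiv.Perm.inv_def, Equiv.symm_apply_apply]

theorem signedAct_single {n : ℕ} (w : SignedPerm n) (i : Fin n) (a : ℤ) :
    signedAct n w (Pi.single i a) = Pi.single (w.right i) ((w.left (w.right i) : ℤ) * a) := by
  ext j
  have hj : w.right⁻¹ j = i ↔ j = w.right i := Equiv.Perm.inv_eq_iff_eq
  rw [signedAct_apply, Pi.single_apply, Pi.single_apply]
  by_cases h : j = w.right i
  · rw [if_pos (hj.2 h), if_pos h, h]
  · rw [if_neg (fun h' => h (hj.1 h')), if_neg h, mul_zero]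

/-- The roots `± e_i ± e_j`. -/
def longRoots (n : ℕ) : Set (Fin n → ℤ) :=
  {r | ∃ i j : Fin n, i < j ∧ ∃ a b : ℤˣ, r = Pi.single i (a : ℤ) + Pi.single j (b : ℤ)}

/-- The roots `± e_i`. -/
def shortRoots (n : ℕ) : Set (Fin n → ℤ) :=
  {r | ∃ (i : Fin n) (a : ℤˣ), r = Pi.single i (a : ℤ)}

theorem longRoots_finite (n : ℕ) : (longRoots n).Finite := by
  refine (Set.finite_range fun p : Fin n × Fin n × ℤˣ × ℤˣ =>
    Pi.single p.1 (p.2.2.1 : ℤ) + Pi.single p.2.1 (p.2.2.2 : ℤ)).subset ?_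
  rintro _ ⟨i, j, _, a, b, rfl⟩
  exact ⟨⟨i, j, a, b⟩, rfl⟩

theorem shortRoots_finite (n : ℕ) : (shortRoots n).Finite := by
  refine (Set.finite_range fun p : Fin n × ℤˣ => Pi.single p.1 (p.2 : ℤ)).subset ?_
  rintro _ ⟨i, a, rfl⟩
  exact ⟨⟨i, a⟩, rfl⟩

theorem single_add_single_mem_longRoots {n : ℕ} {i j : Fin n} (h : i ≠ j) (a b : ℤˣ) :
    Pi.single i (a : ℤ) + Pi.single j (b : ℤ) ∈ longRoots n := by
  rcases lt_or_gt_of_ne h with h | h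
  · exact ⟨i, j, h, a, b, rfl⟩
  · exact ⟨j, i, h, b, a, add_comm _ _⟩

theorem neg_mem_longRoots {n : ℕ} {r : Fin n → ℤ} (h : r ∈ longRoots n) : -r ∈ longRoots n := by
  obtain ⟨i, j, hij, a, b, rfl⟩ := h
  refine ⟨i, j, hij, -a, -b, ?_⟩
  simp [Pi.single_neg, add_comm]

theorem neg_mem_shortRoots {n : ℕ} {r : Fin n → ℤ} (h : r ∈ shortRoots n) :
    -r ∈ shortRoots n := by
  obtain ⟨i, a, rfl⟩ := h
  exact ⟨i, -a, by simp [Pi.single_neg]⟩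

theorem act_mem_longRoots {n : ℕ} (w : SignedPerm n) {r : Fin n → ℤ} (h : r ∈ longRoots n) :
    signedAct n w r ∈ longRoots n := by
  obtain ⟨i, j, hij, a, b, rfl⟩ := h
  rw [map_add, signedAct_single, signedAct_single, ← Units.val_mul, ← Units.val_mul]
  exact single_add_single_mem_longRoots (w.right.injective.ne hij.ne) _ _

theorem act_mem_shortRoots {n : ℕ} (w : SignedPerm n) {r : Fin n → ℤ} (h : r ∈ shortRoots n) :
    signedAct n w r ∈ shortRoots n := by
  obtain ⟨i, a, rfl⟩ := h
  rw [signedAct_single, ← Units.val_mul]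
  exact ⟨_, _, rfl⟩

theorem longRoots_apply_le {n : ℕ} {r : Fin n → ℤ} (h : r ∈ longRoots n) (p : Fin n) :
    r p ≤ 1 := by
  obtain ⟨i, j, hij, a, b, rfl⟩ := h
  rw [Pi.add_apply, Pi.single_apply, Pi.single_apply]
  rcases Int.units_eq_one_or a with rfl | rfl <;> rcases Int.units_eq_one_or b with rfl | rfl <;>
    split_ifs with h1 h2 <;> first | (subst h1; subst h2; exact absurd hij (lt_irrefl _)) | simp

theorem shortRoots_apply_le {n : ℕ} {r : Fin n → ℤ} (h : r ∈ shortRoots n) (p : Fin n) :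
    r p ≤ 1 := by
  obtain ⟨i, a, rfl⟩ := h
  rw [Pi.single_apply]
  rcases Int.units_eq_one_or a with rfl | rfl <;> split_ifs <;> simp

/-- The vector `(1, 2, …, n)`. -/
def stdRho (n : ℕ) : Fin n → ℤ := fun i => (i : ℤ) + 1

/-- The simple roots of type B. -/
def simpleB (n : ℕ) (i : Fin n) : Fin n → ℤ :=
  if i.val = 0 then Pi.single i 1
  else Pi.single i 1 - Pi.single ⟨i.val - 1, by omega⟩ 1

theorem simpleB_dot_zero {n : ℕ} {i : Fin n} (h : i.val = 0) (x : Fin n → ℤ) :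
    simpleB n i ⬝ᵥ x = x i := by
  simp [simpleB, h]

theorem simpleB_dot {n : ℕ} {i : Fin n} (h : i.val ≠ 0) (x : Fin n → ℤ) :
    simpleB n i ⬝ᵥ x = x i - x ⟨i.val - 1, by omega⟩ := by
  simp [simpleB, h, sub_dotProduct]

/-- The simple roots of type D. -/
def simpleD (m : ℕ) : Option (Fin (m + 1)) → Fin (m + 2) → ℤ
  | none => Pi.single 0 1 + Pi.single 1 1
  | some i => Pi.single i.succ 1 - Pi.single i.castSucc 1

theorem simpleD_none_dot {m : ℕ} (x : Fin (m + 2) → ℤ) :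
    simpleD m none ⬝ᵥ x = x 0 + x 1 := by
  simp [simpleD, add_dotProduct]

theorem simpleD_some_dot {m : ℕ} (i : Fin (m + 1)) (x : Fin (m + 2) → ℤ) :
    simpleD m (some i) ⬝ᵥ x = x i.succ - x i.castSucc := by
  simp [simpleD, sub_dotProduct]

theorem longRoots_pos {n : ℕ} {r : Fin n → ℤ} (h : r ∈ longRoots n) (hp : 0 < r ⬝ᵥ stdRho n) :
    ∃ i j : Fin n, i < j ∧
      (r = Pi.single i 1 + Pi.single j 1 ∨ r = Pi.single j 1 - Pi.single i 1) := by
  obtain ⟨i, j, hij, a, b, rfl⟩ := h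
  refine ⟨i, j, hij, ?_⟩
  have : (i : ℤ) < j := by exact_mod_cast hij
  simp only [add_dotProduct, single_dotProduct, stdRho] at hp
  rcases Int.units_eq_one_or a with rfl | rfl <;> rcases Int.units_eq_one_or b with rfl | rfl
  · left; simp
  · simp at hp; omega
  · right; simp [Pi.single_neg]; abel
  · simp at hp; omega

theorem longRoots_rho_ne {n : ℕ} {r : Fin n → ℤ} (h : r ∈ longRoots n) : r ⬝ᵥ stdRho n ≠ 0 := by
  obtain ⟨i, j, hij, a, b, rfl⟩ := h
  have : (i : ℤ) < j := by exact_mod_cast hij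
  simp only [add_dotProduct, single_dotProduct, stdRho]
  rcases Int.units_eq_one_or a with rfl | rfl <;> rcases Int.units_eq_one_or b with rfl | rfl <;>
    simp <;> omega

theorem shortRoots_rho_ne {n : ℕ} {r : Fin n → ℤ} (h : r ∈ shortRoots n) :
    r ⬝ᵥ stdRho n ≠ 0 := by
  obtain ⟨i, a, rfl⟩ := h
  rw [single_dotProduct, stdRho]
  rcases Int.units_eq_one_or a with rfl | rfl <;> simp <;> omega

/-- If consecutive differences belong to an additive submonoid, so do all differences. -/
theorem sub_mem_of_consecutive {n : ℕ} {C : AddSubmonoid (Fin n → ℤ)}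
    (h : ∀ (k : ℕ) (hk : k + 1 < n),
      (Pi.single ⟨k + 1, hk⟩ 1 - Pi.single ⟨k, by omega⟩ 1 : Fin n → ℤ) ∈ C)
    {i j : Fin n} (hij : i ≤ j) : (Pi.single j 1 - Pi.single i 1 : Fin n → ℤ) ∈ C := by
  obtain ⟨i, hi⟩ := i
  obtain ⟨j, hj⟩ := j
  have hij' : i ≤ j := hij
  clear hij
  induction j, hij' using Nat.le_induction with
  | base => rw [sub_self]; exact C.zero_mem
  | succ k hk ih =>
    have := C.add_mem (h k hj) (ih (by omega))
    rwa [sub_add_sub_cancel] at this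

theorem signedAct_inl {n : ℕ} (e : Fin n → ℤˣ) (x : Fin n → ℤ) (j : Fin n) :
    signedAct n (SemidirectProduct.inl e) x j = (e j : ℤ) * x j := by
  simp [signedAct_apply]

theorem signedAct_inr {n : ℕ} (g : Equiv.Perm (Fin n)) (x : Fin n → ℤ) (j : Fin n) :
    signedAct n (SemidirectProduct.inr g) x j = x (g⁻¹ j) := by
  simp [signedAct_apply]

theorem perm_eq_one_of_lt {n : ℕ} (σ : Equiv.Perm (Fin n))
    (h : ∀ (k : ℕ) (hk : k + 1 < n), σ ⟨k, by omega⟩ < σ ⟨k + 1, hk⟩) : σ = 1 := by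
  have hm : StrictMono σ := by
    rcases n with _ | n
    · exact fun a => a.elim0
    · exact Fin.strictMono_iff_lt_succ.2 fun i => h i (by omega)
  have : (hm.orderIsoOfSurjective σ σ.surjective) = OrderIso.refl _ := Subsingleton.elim _ _
  ext i
  have h2 := DFunLike.congr_fun this i
  simpa using congrArg Fin.val h2

/-- Signed entries of increasing absolute value belong to the identity permutation. -/
theorem right_eq_one_of_abs_lt {n : ℕ} (w : SignedPerm n)
    (h : ∀ (k : ℕ) (hk : k + 1 < n), |signedAct n w⁻¹ (stdRho n) ⟨k, by omega⟩| <
      |signedAct n w⁻¹ (stdRho n) ⟨k + 1, hk⟩|) : w.right = 1 := by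
  refine perm_eq_one_of_lt _ fun k hk => ?_
  have := h k hk
  have h1 : ∀ u : ℤˣ, |(u : ℤ)| = 1 := fun u => by
    rcases Int.units_eq_one_or u with rfl | rfl <;> rfl
  simp only [signedAct_inv_apply, abs_mul, h1, one_mul, stdRho] at this
  rw [abs_of_nonneg (by omega), abs_of_nonneg (by omega)] at this
  rw [Fin.lt_def]
  omega

theorem simpleB_mem_roots {n : ℕ} (i : Fin n) : simpleB n i ∈ longRoots n ∪ shortRoots n := by
  rw [simpleB]
  split_ifs with h
  · exact Or.inr ⟨i, 1, by simp⟩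
  · left
    have := single_add_single_mem_longRoots (i := i) (j := ⟨i.val - 1, by omega⟩)
      (by rw [Ne, Fin.ext_iff]; simp; omega) 1 (-1)
    simpa [Pi.single_neg, sub_eq_add_neg] using this

/-- The simple roots read off the first coordinate and the consecutive differences, so the partial
sums of the indicator of `J` serve as coordinates. -/
theorem exists_weightB (n : ℕ) (J : Set (Fin n)) : ∃ d : Fin n → ℤ, ∀ i,
    (i ∈ J → 0 < simpleB n i ⬝ᵥ d) ∧ (i ∉ J → simpleB n i ⬝ᵥ d = 0) := by
  classical
  let f : ℕ → ℤ := fun k => if h : k < n then (if (⟨k, h⟩ : Fin n) ∈ J then 1 else 0) else 0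
  refine ⟨fun i => ∑ k ∈ range (i.val + 1), f k, fun i => ?_⟩
  have : simpleB n i ⬝ᵥ (fun i : Fin n => ∑ k ∈ range (i.val + 1), f k) = f i := by
    by_cases h : i.val = 0
    · rw [simpleB_dot_zero h]; simp [h]
    · rw [simpleB_dot h]
      simp only [Nat.sub_add_cancel (Nat.one_le_iff_ne_zero.2 h)]
      rw [Finset.sum_range_succ]; ring
  rw [this]
  constructor <;> intro h <;> simp [f, h]

theorem genB_zero {n : ℕ} {i : Fin n} (h : i.val = 0) :
    genB n i = SemidirectProduct.inl (Pi.mulSingle i (-1)) := by simp [genB, h]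

theorem genB_pos {n : ℕ} {i : Fin n} (h : i.val ≠ 0) :
    genB n i = SemidirectProduct.inr (Equiv.swap ⟨i.val - 1, by omega⟩ i) := by simp [genB, h]

/-- The root frame of type B. -/
def frameB (n : ℕ) : RootFrame (genB n) n where
  act := signedAct n
  act_dot := signedAct_dot
  roots := longRoots n ∪ shortRoots n
  finite := (longRoots_finite n).union (shortRoots_finite n)
  simple := simpleB n
  rho := stdRho n
  simple_mem := simpleB_mem_roots
  neg_mem := by
    rintro r (h | h)
    exacts [Or.inl (neg_mem_longRoots h), Or.inr (neg_mem_shortRoots h)]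
  act_mem := by
    rintro w r (h | h)
    exacts [Or.inl (act_mem_longRoots w h), Or.inr (act_mem_shortRoots w h)]
  rho_ne := by
    rintro r (h | h)
    exacts [longRoots_rho_ne h, shortRoots_rho_ne h]
  simple_pos i := by
    by_cases h : i.val = 0
    · rw [simpleB_dot_zero h]; simp [stdRho, h]
    · rw [simpleB_dot h]; simp [stdRho]; omega
  mem_closure := by
    have h1 : ∀ i j : Fin n, i ≤ j → (Pi.single j 1 - Pi.single i 1 : Fin n → ℤ) ∈
        AddSubmonoid.closure (Set.range (simpleB n)) := fun i j hij =>
      sub_mem_of_consecutive (fun k hk => AddSubmonoid.subset_closure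
        (show _ ∈ Set.range (simpleB n) from ⟨⟨k + 1, hk⟩, by simp [simpleB]⟩)) hij
    have h2 : ∀ j : Fin n, (Pi.single j 1 : Fin n → ℤ) ∈
        AddSubmonoid.closure (Set.range (simpleB n)) := fun j => by
      have h3 : (Pi.single ⟨0, j.pos⟩ 1 : Fin n → ℤ) ∈
          AddSubmonoid.closure (Set.range (simpleB n)) :=
        AddSubmonoid.subset_closure
          (show _ ∈ Set.range (simpleB n) from ⟨⟨0, j.pos⟩, by simp [simpleB]⟩)
      have := add_mem (h1 ⟨0, j.pos⟩ j (Nat.zero_le _)) h3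
      rwa [sub_add_cancel] at this
    rintro r (h | ⟨i, a, rfl⟩) hp
    · obtain ⟨i, j, hij, rfl | rfl⟩ := longRoots_pos h hp
      · exact add_mem (h2 i) (h2 j)
      · exact h1 i j hij.le
    · rw [single_dotProduct, stdRho] at hp
      rcases Int.units_eq_one_or a with rfl | rfl
      · simpa using h2 i
      · simp at hp; omega
  reduced i k h := by
    have hk : (k : ℤ) ≤ 1 := by
      have h1 : (k • simpleB n i) i ≤ 1 := h.elim (fun h => longRoots_apply_le h i)
        (fun h => shortRoots_apply_le h i)
      have h2 : simpleB n i i = 1 := by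
        rw [simpleB]
        split_ifs with h0
        · simp
        · rw [Pi.sub_apply, Pi.single_eq_same, Pi.single_eq_of_ne, sub_zero]
          rw [Ne, Fin.ext_iff]; simp; omega
      simpa [h2] using h1
    rcases Nat.eq_zero_or_pos k with rfl | hk0
    · rw [zero_smul] at h
      exact absurd (zero_dotProduct _) (h.elim longRoots_rho_ne shortRoots_rho_ne)
    · omega
  gen_sq i := by
    by_cases h : i.val = 0
    · rw [genB_zero h, ← map_mul, ← Pi.mulSingle_mul]; simp
    · rw [genB_pos h, ← map_mul, Equiv.swap_mul_self, map_one]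
  act_simple i := by
    by_cases h : i.val = 0
    · rw [genB_zero h, simpleB, if_pos h, signedAct_single]
      simp [Pi.single_neg]
    · rw [genB_pos h, simpleB, if_neg h, map_sub, signedAct_single, signedAct_single]
      simp
  act_fix i d hd := by
    ext j
    by_cases h : i.val = 0
    · rw [simpleB_dot_zero h] at hd
      rw [genB_zero h, signedAct_inl]
      by_cases hj : j = i
      · rw [hj, hd, mul_zero]
      · rw [Pi.mulSingle_eq_of_ne hj]; simp
    · rw [simpleB_dot h, sub_eq_zero] at hd
      rw [genB_pos h, signedAct_inr, Equiv.swap_inv, Equiv.swap_apply_def]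
      split_ifs with h1 h2
      · rw [h1, hd]
      · rw [h2, hd]
      · rfl
  eq_one w hw := by
    have hw' : ∀ i, 0 < simpleB n i ⬝ᵥ signedAct n w⁻¹ (stdRho n) := fun i => by
      rw [← signedAct_dot w, signedAct_act_inv]
      exact hw i
    -- The coordinates of `w⁻¹ ρ` are the signed entries of `w`. The hypothesis makes the first one
    -- positive and the sequence increasing.
    have hpos : ∀ (k : ℕ) (hk : k < n), 0 < signedAct n w⁻¹ (stdRho n) ⟨k, hk⟩ := by
      intro k hk
      induction k with
      | zero =>
        have := hw' ⟨0, hk⟩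
        rwa [simpleB_dot_zero rfl] at this
      | succ k ih =>
        have := hw' ⟨k + 1, hk⟩
        rw [simpleB_dot (by simp)] at this
        have := ih (by omega)
        simp at *
        omega
    have hr : w.right = 1 := right_eq_one_of_abs_lt w fun k hk => by
      rw [abs_of_pos (hpos _ _), abs_of_pos (hpos _ _)]
      have := hw' ⟨k + 1, hk⟩
      rw [simpleB_dot (by simp)] at this
      simpa using this
    refine SemidirectProduct.ext ?_ hr
    ext j
    have := hpos j j.2
    rw [signedAct_inv_apply, hr] at this
    rcases Int.units_eq_one_or (w.left j) with h | h
    · simp [h]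
    · simp [h, stdRho] at this; omega
  weight := exists_weightB n

/-- The first two coordinates are `c - f 0` and `c + f 0`, with sum `2 c` and difference `2 f 0`;
the doubling keeps them integral. The later coordinates add the remaining indicators. -/
theorem exists_weightD (m : ℕ) (J : Set (Option (Fin (m + 1)))) : ∃ d : Fin (m + 2) → ℤ, ∀ i,
    (i ∈ J → 0 < simpleD m i ⬝ᵥ d) ∧ (i ∉ J → simpleD m i ⬝ᵥ d = 0) := by
  classical
  let c : ℤ := if none ∈ J then 1 else 0
  let f : ℕ → ℤ := fun k =>
    if h : k < m + 1 then (if some (⟨k, h⟩ : Fin (m + 1)) ∈ J then 1 else 0) else 0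
  let d : Fin (m + 2) → ℤ := fun i =>
    if i.val = 0 then c - f 0 else c + ∑ k ∈ range i.val, f k
  have h0 : simpleD m none ⬝ᵥ d = 2 * c := by
    rw [simpleD_none_dot]; simp [d]; ring
  have h1 : ∀ i : Fin (m + 1), simpleD m (some i) ⬝ᵥ d = if i.val = 0 then 2 * f i else f i := by
    intro i
    rw [simpleD_some_dot]
    by_cases hi : i = 0
    · subst hi; simp [d]; ring
    · simp [d, hi, Finset.sum_range_succ]
  refine ⟨d, fun i => ?_⟩
  rcases i with _ | i
  · rw [h0]
    constructor <;> intro h <;> simp [c, h]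
  · have hf : f i = if some i ∈ J then 1 else 0 := by simp only [f, i.2, dif_pos, Fin.eta]
    rw [h1, hf]
    constructor <;> intro h <;> simp only [h, if_true, if_false] <;> split_ifs <;> simp

theorem genD_none_coe (m : ℕ) : ((genD m none : evenSigned (m + 2)) : SignedPerm (m + 2)) =
    ⟨fun j => if j.val < 2 then -1 else 1, Equiv.swap 0 1⟩ := rfl

theorem genD_some_coe (m : ℕ) (i : Fin (m + 1)) :
    ((genD m (some i) : evenSigned (m + 2)) : SignedPerm (m + 2)) =
      SemidirectProduct.inr (Equiv.swap i.castSucc i.succ) := rfl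

theorem prod_left_eq_one {n : ℕ} (w : evenSigned n) : ∏ j, w.1.left j = 1 :=
  (prod_sign_eq_one_iff _).1 w.2

theorem simpleD_mem_roots {m : ℕ} (i : Option (Fin (m + 1))) :
    simpleD m i ∈ longRoots (m + 2) := by
  rcases i with _ | i
  · exact ⟨0, 1, by simp, 1, 1, by simp [simpleD]⟩
  · refine ⟨i.castSucc, i.succ, Fin.castSucc_lt_succ, -1, 1, ?_⟩
    simp [simpleD, Pi.single_neg]; abel

theorem genD_sq (m : ℕ) (i : Option (Fin (m + 1))) : genD m i * genD m i = 1 := by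
  rcases i with _ | i
  · apply Subtype.ext
    rw [Subgroup.coe_mul, genD_none_coe]
    refine SemidirectProduct.ext ?_ (Equiv.swap_mul_self _ _)
    funext j
    change (if j.val < 2 then (-1 : ℤˣ) else 1) *
      (if ((Equiv.swap 0 1 : Equiv.Perm (Fin (m + 2)))⁻¹ j).val < 2 then -1 else 1) = 1
    rw [Equiv.swap_inv, Equiv.swap_apply_def]
    by_cases h0 : j = 0
    · simp [h0]
    · by_cases h1 : j = 1
      · simp [h1]
      · have h2 : ¬ j.val < 2 := fun h => by
          rw [Fin.ext_iff, Fin.val_zero] at h0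
          rw [Fin.ext_iff, Fin.val_one] at h1
          omega
        simp only [h0, h1, h2, if_false, mul_one]
  · apply Subtype.ext
    rw [Subgroup.coe_mul, genD_some_coe, ← map_mul, Equiv.swap_mul_self, map_one]
    rfl

/-- The signed entries `x` of `w` increase and satisfy `0 < x 0 + x 1`, so all but the first are
positive and `|x 0| < x 1`. The underlying permutation is therefore the identity, and parity forces
the remaining sign. -/
theorem simpleD_dot_act_inv {m : ℕ} {w : evenSigned (m + 2)}
    (hw : ∀ i, 0 < signedAct (m + 2) w (simpleD m i) ⬝ᵥ stdRho (m + 2)) :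
    w = 1 := by
  set x := signedAct (m + 2) (w : SignedPerm (m + 2))⁻¹ (stdRho (m + 2)) with hx
  have hw' : ∀ i, 0 < simpleD m i ⬝ᵥ x := fun i => by
    rw [← signedAct_dot (w : SignedPerm (m + 2)), hx, signedAct_act_inv]
    exact hw i
  have hstep : ∀ (k : ℕ) (hk : k + 1 < m + 2), x ⟨k, by omega⟩ < x ⟨k + 1, hk⟩ := fun k hk => by
    have := hw' (some ⟨k, by omega⟩)
    rw [simpleD_some_dot] at this
    exact sub_pos.1 this
  have hsum : 0 < x 0 + x 1 := by rw [← simpleD_none_dot]; exact hw' none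
  have h01 : x 0 < x 1 := hstep 0 (by omega)
  have hpos : ∀ (k : ℕ) (hk : k + 1 < m + 2), 0 < x ⟨k + 1, hk⟩ := by
    intro k hk
    induction k with
    | zero => exact (by omega : 0 < x 1)
    | succ k ih => exact (ih (by omega)).trans (hstep (k + 1) hk)
  have hr : (w : SignedPerm (m + 2)).right = 1 := right_eq_one_of_abs_lt _ fun k hk => by
    rw [← hx, abs_of_pos (hpos k hk)]
    rcases k with _ | k
    · exact abs_lt.2 ⟨(by omega : -x 1 < x 0), h01⟩
    · rw [abs_of_pos (hpos k _)]; exact hstep _ _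
  have hl : ∀ j : Fin (m + 1), (w : SignedPerm (m + 2)).left j.succ = 1 := fun j => by
    have := hpos j (by omega)
    rw [hx, signedAct_inv_apply, hr] at this
    rcases Int.units_eq_one_or ((w : SignedPerm (m + 2)).left j.succ) with h | h
    · exact h
    · change 0 < (((w : SignedPerm (m + 2)).left j.succ : ℤˣ) : ℤ) * stdRho (m + 2) j.succ at this
      simp [h, stdRho] at this; omega
  have hprod := prod_left_eq_one w
  rw [Fin.prod_univ_succ] at hprod
  simp only [hl, Finset.prod_const_one, mul_one] at hprod
  apply Subtype.ext
  refine SemidirectProduct.ext ?_ hr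
  funext j
  refine Fin.cases ?_ (fun j => ?_) j
  · exact hprod
  · exact hl j

/-- The root frame of type D. -/
def frameD (m : ℕ) : RootFrame (genD m) (m + 2) where
  act := (signedAct (m + 2)).comp (evenSigned (m + 2)).subtype
  act_dot w := signedAct_dot _
  roots := longRoots (m + 2)
  finite := longRoots_finite _
  simple := simpleD m
  rho := stdRho _
  simple_mem := simpleD_mem_roots
  neg_mem _ h := neg_mem_longRoots h
  act_mem w _ h := act_mem_longRoots _ h
  rho_ne _ h := longRoots_rho_ne h
  simple_pos i := by
    rcases i with _ | i
    · rw [simpleD_none_dot]; simp [stdRho]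
    · rw [simpleD_some_dot]; simp [stdRho]
  mem_closure := by
    have h1 : ∀ i j : Fin (m + 2), i ≤ j → (Pi.single j 1 - Pi.single i 1 : Fin (m + 2) → ℤ) ∈
        AddSubmonoid.closure (Set.range (simpleD m)) := fun i j hij =>
      sub_mem_of_consecutive (fun k hk => AddSubmonoid.subset_closure
        (show _ ∈ Set.range (simpleD m) from ⟨some ⟨k, by omega⟩, rfl⟩)) hij
    intro r h hp
    obtain ⟨i, j, hij, rfl | rfl⟩ := longRoots_pos h hp
    · have h2 : (Pi.single 0 1 + Pi.single 1 1 : Fin (m + 2) → ℤ) ∈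
          AddSubmonoid.closure (Set.range (simpleD m)) :=
        AddSubmonoid.subset_closure (show _ ∈ Set.range (simpleD m) from ⟨none, rfl⟩)
      -- The decomposition is `e_i + e_j = (e_i - e_0) + (e_j - e_1) + (e_0 + e_1)`, whose middle
      -- term requires `1 ≤ j`.
      have hj : 1 ≤ j := by
        rw [Fin.le_def]; rw [Fin.lt_def] at hij; simp; omega
      have := add_mem (add_mem (h1 0 i (Fin.zero_le _)) (h1 1 j hj)) h2
      convert this using 1
      abel
    · exact h1 i j hij.le
  reduced i k h := by
    have hk : (k : ℤ) ≤ 1 := by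
      rcases i with _ | i
      · simpa [simpleD] using longRoots_apply_le h 0
      · have := longRoots_apply_le h i.succ
        simpa [simpleD, Pi.single_eq_of_ne (Fin.castSucc_lt_succ (i := i)).ne'] using this
    rcases Nat.eq_zero_or_pos k with rfl | hk0
    · rw [zero_smul] at h
      exact absurd (zero_dotProduct _) (longRoots_rho_ne h)
    · omega
  gen_sq := genD_sq m
  act_simple i := by
    change signedAct (m + 2) (genD m i : SignedPerm (m + 2)) (simpleD m i) = _
    rcases i with _ | i
    · rw [genD_none_coe, simpleD, map_add, signedAct_single, signedAct_single]
      simp [Pi.single_neg]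
    · rw [genD_some_coe, simpleD, map_sub, signedAct_single, signedAct_single]
      simp
  act_fix i d hd := by
    change signedAct (m + 2) (genD m i : SignedPerm (m + 2)) d = _
    ext j
    rcases i with _ | i
    · rw [simpleD_none_dot] at hd
      rw [genD_none_coe, signedAct_apply]
      change (((if j.val < 2 then (-1 : ℤˣ) else 1) : ℤˣ) : ℤ) *
        d ((Equiv.swap 0 1 : Equiv.Perm (Fin (m + 2)))⁻¹ j) = d j
      rw [Equiv.swap_inv, Equiv.swap_apply_def]
      split_ifs with h1 h2 h3 h4 h5
      · subst h2; simp; omega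
      · subst h3; simp; omega
      · exfalso
        rw [Fin.ext_iff, Fin.val_zero] at h2
        rw [Fin.ext_iff, Fin.val_one] at h3
        omega
      · subst h4; simp at h1
      · subst h5; simp at h1
      · simp
    · rw [simpleD_some_dot, sub_eq_zero] at hd
      rw [genD_some_coe, signedAct_inr, Equiv.swap_inv, Equiv.swap_apply_def]
      split_ifs with h1 h2
      · rw [h1, hd]
      · rw [h2, hd]
      · rfl
  eq_one w hw := simpleD_dot_act_inv hw
  weight := exists_weightD m

/-! ### The morphism between the descent algebras -/

/-- Two families of values that both start with `0` agree up to a permutation exactly when they do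
after deleting that `0`. An index matched with position `0` carries the value `0` and can be
rerouted to the position matched with index `0`, which also carries `0`. -/
theorem exists_perm_succ_iff {n : ℕ} {f g : Fin (n + 1) → ℤ} (hf : f 0 = 0) (hg : g 0 = 0) :
    (∃ σ : Equiv.Perm (Fin (n + 1)), ∀ j, f (σ j) = g j) ↔
      ∃ σ : Equiv.Perm (Fin n), ∀ j, f (σ j).succ = g j.succ := by
  constructor
  · rintro ⟨σ, h⟩
    obtain ⟨⟨p, e⟩, rfl⟩ := Equiv.Perm.decomposeFin.symm.surjective σ
    refine ⟨e, fun j => ?_⟩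
    have h0 := h 0
    have hj := h j.succ
    rw [Equiv.Perm.decomposeFin_symm_apply_zero] at h0
    rw [Equiv.Perm.decomposeFin_symm_apply_succ, Equiv.swap_apply_def,
      if_neg (Fin.succ_ne_zero _)] at hj
    split_ifs at hj with hp
    · rw [hp, h0, hg, ← hf, hj]
    · exact hj
  · rintro ⟨e, h⟩
    refine ⟨Equiv.Perm.decomposeFin.symm (0, e), fun j => ?_⟩
    refine Fin.cases ?_ (fun j => ?_) j
    · rw [Equiv.Perm.decomposeFin_symm_apply_zero, hf, hg]
    · rw [Equiv.Perm.decomposeFin_symm_apply_succ, Equiv.swap_self]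
      exact h j

theorem abs_units_mul (u : ℤˣ) (a : ℤ) : |(u : ℤ) * a| = |a| := by
  rcases Int.units_eq_one_or u with rfl | rfl <;> simp

theorem exists_unit_mul_eq {a b : ℤ} (h : |a| = |b|) : ∃ u : ℤˣ, (u : ℤ) * b = a := by
  rcases abs_eq_abs.1 h with h | h
  · exact ⟨1, by simp [h]⟩
  · exact ⟨-1, by simp [h]⟩

theorem abs_signedAct_apply {n : ℕ} (w : SignedPerm n) (x : Fin n → ℤ) (j : Fin n) :
    |signedAct n w x (w.right j)| = |x j| := by
  rw [signedAct_apply, abs_units_mul, Equiv.Perm.inv_def, Equiv.symm_apply_apply]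

theorem exists_signedAct_eq_iff {n : ℕ} {d x : Fin n → ℤ} :
    (∃ w, signedAct n w d = x) ↔ ∃ σ : Equiv.Perm (Fin n), ∀ j, |x (σ j)| = |d j| := by
  constructor
  · rintro ⟨w, rfl⟩
    exact ⟨w.right, abs_signedAct_apply w d⟩
  · rintro ⟨σ, h⟩
    have h' : ∀ k, ∃ u : ℤˣ, (u : ℤ) * d (σ⁻¹ k) = x k := fun k =>
      exists_unit_mul_eq (by rw [← h, Equiv.Perm.inv_def, Equiv.apply_symm_apply])
    choose ε hε using h'
    exact ⟨⟨ε, σ⟩, funext hε⟩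

/-- A vanishing coordinate absorbs a sign change, so the orbits under even signed permutations and
under all signed permutations agree. -/
theorem exists_evenSigned_act_eq_iff {m : ℕ} {d x : Fin (m + 2) → ℤ} (hd : d 0 = 0) :
    (∃ w, (frameD m).act w d = x) ↔
      ∃ σ : Equiv.Perm (Fin (m + 2)), ∀ j, |x (σ j)| = |d j| := by
  rw [← exists_signedAct_eq_iff]
  constructor
  · rintro ⟨w, h⟩
    exact ⟨w, h⟩
  · rintro ⟨w, h⟩
    rcases Int.units_eq_one_or (∏ j, w.left j) with h1 | h1
    · exact ⟨⟨w, (prod_sign_eq_one_iff _).2 h1⟩, h⟩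
    -- An odd element is corrected at the position to which the zero coordinate of `d` is moved.
    · let ε : Fin (m + 2) → ℤˣ := Pi.mulSingle (w.right 0) (-1) * w.left
      have hε : ∏ j, ε j = 1 := by
        simp only [ε, Pi.mul_apply]
        rw [Finset.prod_mul_distrib, h1, Finset.prod_pi_mulSingle']
        simp
      refine ⟨⟨⟨ε, w.right⟩, (prod_sign_eq_one_iff _).2 hε⟩, ?_⟩
      rw [← h]
      funext j
      change ((ε j : ℤˣ) : ℤ) * d (w.right⁻¹ j) = (w.left j : ℤ) * d (w.right⁻¹ j)
      by_cases hj : j = w.right 0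
      · rw [hj, Equiv.Perm.inv_def, Equiv.symm_apply_apply, hd, mul_zero, mul_zero]
      · simp only [ε, Pi.mul_apply]
        rw [Pi.mulSingle_eq_of_ne hj, one_mul]

/-- Prepend two zeros. -/
def consZeros {m : ℕ} (x : Fin m → ℤ) : Fin (m + 2) → ℤ :=
  Fin.cons 0 (Fin.cons 0 x : Fin (m + 1) → ℤ)

theorem consZeros_zero {m : ℕ} (x : Fin m → ℤ) : consZeros x 0 = 0 := rfl

theorem consZeros_one {m : ℕ} (x : Fin m → ℤ) : consZeros x 1 = 0 := rfl

theorem consZeros_succ_succ {m : ℕ} (x : Fin m → ℤ) (j : Fin m) :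
    consZeros x j.succ.succ = x j := rfl

theorem consZeros_injective (m : ℕ) : Function.Injective (consZeros (m := m)) := fun _ _ h =>
  funext fun j => congrFun h j.succ.succ

theorem eq_consZeros {m : ℕ} {x : Fin (m + 2) → ℤ} (h0 : x 0 = 0) (h1 : x 1 = 0) :
    x = consZeros fun j => x j.succ.succ := by
  funext j
  refine Fin.cases h0 (fun j => ?_) j
  exact Fin.cases h1 (fun j => rfl) j

/-- Type D orbits of vectors starting with two zeros are type B orbits of the shortened vectors:
both amount to matching absolute values, and the zeros are deleted one at a time. -/
theorem exists_act_consZeros_iff {m : ℕ} {d x : Fin m → ℤ} :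
    (∃ w, (frameD m).act w (consZeros d) = consZeros x) ↔ ∃ w, (frameB m).act w d = x := by
  rw [exists_evenSigned_act_eq_iff (consZeros_zero d)]
  refine Iff.trans ?_ exists_signedAct_eq_iff.symm
  rw [exists_perm_succ_iff (f := fun j => |consZeros x j|) (g := fun j => |consZeros d j|)
    (by simp [consZeros_zero]) (by simp [consZeros_zero])]
  exact exists_perm_succ_iff (f := fun j => |consZeros x j.succ|)
    (g := fun j => |consZeros d j.succ|) (by simp [consZeros]) (by simp [consZeros])

theorem simpleD_none_dot_consZeros {m : ℕ} (x : Fin m → ℤ) :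
    simpleD m none ⬝ᵥ consZeros x = 0 := by
  rw [simpleD_none_dot]; rfl

theorem simpleD_zero_dot_consZeros {m : ℕ} (x : Fin m → ℤ) :
    simpleD m (some 0) ⬝ᵥ consZeros x = 0 := by
  rw [simpleD_some_dot]; rfl

theorem simpleD_succ_dot_consZeros {m : ℕ} (x : Fin m → ℤ) (k : Fin m) :
    simpleD m (some k.succ) ⬝ᵥ consZeros x = simpleB m k ⬝ᵥ x := by
  rw [simpleD_some_dot, consZeros_succ_succ]
  by_cases hk : k.val = 0
  · rw [simpleB_dot_zero hk]
    have : k.succ.castSucc = (1 : Fin (m + 2)) := Fin.ext (by simp [hk])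
    rw [this, consZeros_one, sub_zero]
  · rw [simpleB_dot hk]
    have : k.succ.castSucc = (⟨k.val - 1, by omega⟩ : Fin m).succ.succ :=
      Fin.ext (by simp; omega)
    rw [this, consZeros_succ_succ]

theorem forall_label {m : ℕ} {p : Option (Fin (m + 1)) → Prop} :
    (∀ i, p i) ↔ p none ∧ p (some 0) ∧ ∀ k : Fin m, p (some k.succ) := by
  constructor
  · exact fun h => ⟨h _, h _, fun k => h _⟩
  · rintro ⟨h1, h2, h3⟩ (_ | i)
    · exact h1
    · exact Fin.cases h2 h3 i

theorem dominant_consZeros {m : ℕ} {x : Fin m → ℤ} (h : (frameB m).Dominant x) :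
    (frameD m).Dominant (consZeros x) :=
  forall_label.2 ⟨(simpleD_none_dot_consZeros x).ge, (simpleD_zero_dot_consZeros x).ge,
    fun k => (h k).trans_eq (simpleD_succ_dot_consZeros x k).symm⟩

theorem none_notMem_supp_consZeros {m : ℕ} (x : Fin m → ℤ) :
    none ∉ (frameD m).supp (consZeros x) := fun h =>
  (frameD m).mem_supp.1 h (simpleD_none_dot_consZeros x)

theorem zero_notMem_supp_consZeros {m : ℕ} (x : Fin m → ℤ) :
    some 0 ∉ (frameD m).supp (consZeros x) := fun h =>
  (frameD m).mem_supp.1 h (simpleD_zero_dot_consZeros x)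

theorem mem_shiftD {m : ℕ} {J : Finset (Option (Fin (m + 1)))} {k : Fin m} :
    k ∈ shiftD J ↔ some k.succ ∈ J := by simp [shiftD]

theorem shiftD_supp_consZeros {m : ℕ} (x : Fin m → ℤ) :
    shiftD ((frameD m).supp (consZeros x)) = (frameB m).supp x := by
  ext k
  rw [mem_shiftD, RootFrame.mem_supp, RootFrame.mem_supp]
  change ¬simpleD m (some k.succ) ⬝ᵥ consZeros x = 0 ↔ ¬simpleB m k ⬝ᵥ x = 0
  rw [simpleD_succ_dot_consZeros]

theorem shiftD_union {m : ℕ} (I J : Finset (Option (Fin (m + 1)))) :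
    shiftD (I ∪ J) = shiftD I ∪ shiftD J := by
  ext k
  simp only [mem_shiftD, mem_union]

theorem eq_of_shiftD_eq {m : ℕ} {I J : Finset (Option (Fin (m + 1)))} (hI : none ∉ I)
    (hI0 : some 0 ∉ I) (hJ : none ∉ J) (hJ0 : some 0 ∉ J) (h : shiftD I = shiftD J) : I = J := by
  rw [Finset.ext_iff] at h ⊢
  exact forall_label.2 ⟨iff_of_false hI hJ, iff_of_false hI0 hJ0, fun k => by
    rw [← mem_shiftD, h, mem_shiftD]⟩

theorem exists_consZeros_supp {m : ℕ} {J : Finset (Option (Fin (m + 1)))}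
    (hJ : ¬(none ∈ J ∨ some 0 ∈ J)) : ∃ d : Fin m → ℤ, (frameB m).Dominant d ∧
      (frameD m).supp (consZeros d) = J ∧ (frameB m).supp d = shiftD J := by
  obtain ⟨d, hd, hs⟩ := (frameB m).exists_dominant_supp_eq (shiftD J)
  rw [not_or] at hJ
  refine ⟨d, hd, eq_of_shiftD_eq (none_notMem_supp_consZeros d) (zero_notMem_supp_consZeros d)
    hJ.1 hJ.2 ?_, hs⟩
  rw [shiftD_supp_consZeros, hs]

theorem eq_zero_of_notMem_supp {m : ℕ} {x : Fin (m + 2) → ℤ}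
    (h : ¬(none ∈ (frameD m).supp x ∨ some 0 ∈ (frameD m).supp x)) : x 0 = 0 ∧ x 1 = 0 := by
  simp only [RootFrame.mem_supp, not_or, not_not] at h
  have h1 : x 0 + x 1 = 0 := by rw [← simpleD_none_dot]; exact h.1
  have h2 : x 1 - x 0 = 0 := by
    have := h.2
    change simpleD m (some 0) ⬝ᵥ x = 0 at this
    rwa [simpleD_some_dot] at this
  omega

/-- A dominant vector not starting with two zeros has at most one zero entry. -/
theorem dominant_ne_zero {m : ℕ} {d : Fin (m + 2) → ℤ} (hd : (frameD m).Dominant d)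
    (h : none ∈ (frameD m).supp d ∨ some 0 ∈ (frameD m).supp d) {j : Fin (m + 2)}
    (hj : d j = 0) : j = 0 := by
  have hd1 : 0 ≤ d 0 + d 1 := by rw [← simpleD_none_dot]; exact hd none
  have hs : ∀ i : Fin (m + 1), d i.castSucc ≤ d i.succ := fun i => by
    have := hd (some i)
    change 0 ≤ simpleD m (some i) ⬝ᵥ d at this
    rw [simpleD_some_dot] at this
    omega
  have h01 : d 0 ≤ d 1 := hs 0
  have h1 : 0 < d 1 := by
    by_contra hn
    have h0 : d 0 = 0 ∧ d 1 = 0 := by omega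
    rw [eq_consZeros h0.1 h0.2] at h
    exact h.elim (none_notMem_supp_consZeros _) (zero_notMem_supp_consZeros _)
  have hpos : ∀ i : Fin (m + 1), 0 < d i.succ := fun i => by
    induction i using Fin.induction with
    | zero => exact h1
    | succ i ih => exact ih.trans_le (hs i.succ)
  refine Fin.cases (fun _ => rfl) (fun i hi => ?_) j hj
  exact absurd hi (hpos i).ne'

theorem gammaValue_of_mem {m : ℕ} {J : Finset (Option (Fin (m + 1)))}
    (h : none ∈ J ∨ some 0 ∈ J) : gammaValue m J = 0 := if_pos h

theorem gammaValue_of_notMem {m : ℕ} {J : Finset (Option (Fin (m + 1)))}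
    (h : ¬(none ∈ J ∨ some 0 ∈ J)) : gammaValue m J = elemX (genB m) (shiftD J) := if_neg h

/-- Solomon's formula is compared on both sides. A term of type D survives `Γ` only if both `e` and
`x` start with two zeros. If `J` contains `1'` or `1`, no term survives because of `e`; if `I` does,
none survives because of `x`; otherwise the surviving terms are those of type B. -/
theorem map_elemX_mul_elemX {m : ℕ}
    {Γ : MonoidAlgebra ℚ (evenSigned (m + 2)) →ₗ[ℚ] MonoidAlgebra ℚ (SignedPerm m)}
    (hΓ : ∀ J, Γ (elemX (genD m) J) = gammaValue m J) (I J : Finset (Option (Fin (m + 1)))) :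
    Γ (elemX (genD m) I * elemX (genD m) J) =
      Γ (elemX (genD m) I) * Γ (elemX (genD m) J) := by
  have key : ∀ x y : Fin (m + 2) → ℤ, none ∈ (frameD m).supp x ∨ some 0 ∈ (frameD m).supp x →
      gammaValue m ((frameD m).supp x ∪ (frameD m).supp y) = 0 ∧
      gammaValue m ((frameD m).supp y ∪ (frameD m).supp x) = 0 := fun x y h => by
    constructor <;> refine gammaValue_of_mem ?_ <;> simp only [mem_union] <;> tauto
  rw [hΓ, hΓ]
  by_cases hI : none ∈ I ∨ some 0 ∈ I
  · obtain ⟨d, hd, rfl⟩ := (frameD m).exists_dominant_supp_eq I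
    obtain ⟨e, -, rfl⟩ := (frameD m).exists_dominant_supp_eq J
    rw [(frameD m).elemX_mul_elemX hd e, map_sum, gammaValue_of_mem hI, zero_mul]
    refine Finset.sum_eq_zero fun x hx => ?_
    rw [hΓ]
    refine (key x e ?_).2
    by_contra hn
    obtain ⟨h0, h1⟩ := eq_zero_of_notMem_supp hn
    obtain ⟨⟨w, rfl⟩, -⟩ := (frameD m).mem_relDominant.1 hx
    -- A zero of the permuted vector comes from a zero of `d`, which can only sit at index `0`.
    -- Hence positions `0` and `1` cannot both vanish.
    have hz : ∀ j, (frameD m).act w d j = 0 → w.1.right⁻¹ j = 0 := fun j hj => by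
      refine dominant_ne_zero hd hI ?_
      change (w.1.left j : ℤ) * d (w.1.right⁻¹ j) = 0 at hj
      exact (mul_eq_zero.1 hj).resolve_left (Units.ne_zero _)
    have := w.1.right⁻¹.injective ((hz 0 h0).trans (hz 1 h1).symm)
    simp at this
  by_cases hJ : none ∈ J ∨ some 0 ∈ J
  · obtain ⟨d, hd, rfl⟩ := (frameD m).exists_dominant_supp_eq I
    obtain ⟨e, -, rfl⟩ := (frameD m).exists_dominant_supp_eq J
    rw [(frameD m).elemX_mul_elemX hd e, map_sum, gammaValue_of_mem hJ, mul_zero]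
    refine Finset.sum_eq_zero fun x _ => ?_
    rw [hΓ, (key e x hJ).1]
  rw [gammaValue_of_notMem hI, gammaValue_of_notMem hJ]
  obtain ⟨d, hd, rfl, hd'⟩ := exists_consZeros_supp hI
  obtain ⟨e, he, rfl, he'⟩ := exists_consZeros_supp hJ
  rw [← hd', ← he', (frameD m).elemX_mul_elemX (dominant_consZeros hd), map_sum,
    (frameB m).elemX_mul_elemX hd]
  symm
  -- The type B vectors embed by prepending two zeros; every type D vector outside the image
  -- contributes zero.
  refine Finset.sum_of_injOn consZeros (consZeros_injective m).injOn ?_ ?_ ?_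
  · intro x hx
    obtain ⟨hx1, hx2⟩ := (frameB m).mem_relDominant.1 hx
    refine (frameD m).mem_relDominant.2 ⟨exists_act_consZeros_iff.2 hx1, forall_label.2
      ⟨fun _ => (simpleD_none_dot_consZeros x).ge, fun _ => (simpleD_zero_dot_consZeros x).ge,
        fun k hk => ?_⟩⟩
    change simpleD m (some k.succ) ⬝ᵥ _ = 0 at hk
    change 0 ≤ simpleD m (some k.succ) ⬝ᵥ _
    rw [simpleD_succ_dot_consZeros] at hk ⊢
    exact hx2 k hk
  · intro x hx hn
    rw [hΓ]
    refine (key x _ ?_).2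
    by_contra h
    obtain ⟨h0, h1⟩ := eq_zero_of_notMem_supp h
    refine hn ⟨fun j => x j.succ.succ, ?_, (eq_consZeros h0 h1).symm⟩
    obtain ⟨hx1, hx2⟩ := (frameD m).mem_relDominant.1 hx
    rw [eq_consZeros h0 h1] at hx1 hx2
    refine (frameB m).mem_relDominant.2 ⟨exists_act_consZeros_iff.1 hx1, fun k hk => ?_⟩
    have := hx2 (some k.succ)
    change simpleD m (some k.succ) ⬝ᵥ _ = 0 → 0 ≤ simpleD m (some k.succ) ⬝ᵥ _ at this
    rw [simpleD_succ_dot_consZeros, simpleD_succ_dot_consZeros] at this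
    exact this hk
  · intro x _
    rw [hΓ, gammaValue_of_notMem, shiftD_union, shiftD_supp_consZeros, shiftD_supp_consZeros]
    simp only [mem_union, none_notMem_supp_consZeros, zero_notMem_supp_consZeros, or_self,
      not_false_eq_true]

/-! ### Descents of signed permutations in terms of entries -/

/-- The entries of a signed permutation. -/
def signedEntry {n : ℕ} (u : SignedPerm n) (p : Fin n) : ℤ :=
  (u.left (u.right p) : ℤ) * ((u.right p : ℤ) + 1)

theorem mem_descentSet_genB_zero {n : ℕ} {u : SignedPerm n} {i : Fin n} (hi : i.val = 0) :
    i ∈ descentSet (genB n) u ↔ signedEntry u i < 0 := by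
  rw [(frameB n).mem_descentSet, RootFrame.act_dot_right]
  change simpleB n i ⬝ᵥ signedAct n u⁻¹ (stdRho n) < 0 ↔ _
  rw [simpleB_dot_zero hi, signedAct_inv_apply]
  rfl

theorem mem_descentSet_genB {n : ℕ} {u : SignedPerm n} {i : Fin n} (hi : i.val ≠ 0) :
    i ∈ descentSet (genB n) u ↔ signedEntry u i < signedEntry u ⟨i.val - 1, by omega⟩ := by
  rw [(frameB n).mem_descentSet, RootFrame.act_dot_right]
  change simpleB n i ⬝ᵥ signedAct n u⁻¹ (stdRho n) < 0 ↔ _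
  rw [simpleB_dot hi, signedAct_inv_apply, signedAct_inv_apply, sub_neg]
  rfl

theorem entry_zero {n : ℕ} (σ : Equiv.Perm (Fin n)) : entry σ 0 = 0 := by simp [entry]

theorem entry_succ {n : ℕ} (σ : Equiv.Perm (Fin n)) {k : ℕ} (hk : k < n) :
    entry σ (k + 1) = (σ ⟨k, hk⟩).val + 1 := by
  simp [entry, hk]

/-- There is an ascent from position `k` to position `k + 1`, or position `k + 1` is beyond the
end. -/
def IsAscent {n : ℕ} (σ : Equiv.Perm (Fin n)) (k : ℕ) : Prop :=
  n ≤ k ∨ entry σ k < entry σ (k + 1)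

theorem isAscent_zero {n : ℕ} (σ : Equiv.Perm (Fin n)) : IsAscent σ 0 := by
  rcases Nat.eq_zero_or_pos n with h | h
  · exact Or.inl h.le
  · right; rw [entry_zero, entry_succ σ h]; omega

theorem isAscent_of_le {n : ℕ} (σ : Equiv.Perm (Fin n)) {k : ℕ} (h : n ≤ k) : IsAscent σ k :=
  Or.inl h

theorem isAscent_succ {n : ℕ} (σ : Equiv.Perm (Fin n)) {k : ℕ} (hk : k + 1 < n) :
    IsAscent σ (k + 1) ↔ σ ⟨k, by omega⟩ < σ ⟨k + 1, hk⟩ := by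
  rw [IsAscent, entry_succ σ hk, entry_succ σ (by omega : k < n), Fin.lt_def]
  omega

theorem not_isAscent_succ {n : ℕ} (σ : Equiv.Perm (Fin n)) {k : ℕ} (hk : k + 1 < n) :
    ¬IsAscent σ (k + 1) ↔ σ ⟨k + 1, hk⟩ < σ ⟨k, by omega⟩ := by
  rw [isAscent_succ σ hk, not_lt]
  refine ⟨fun h => lt_of_le_of_ne h ?_, le_of_lt⟩
  exact σ.injective.ne (by rw [Ne, Fin.mk.injEq]; omega)

theorem lt_of_not_isAscent {n : ℕ} {σ : Equiv.Perm (Fin n)} {k : ℕ} (h : ¬IsAscent σ k) :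
    k < n := by
  by_contra hn
  exact h (Or.inl (not_lt.1 hn))

theorem zero_notMem_peakSet {n : ℕ} (σ : Equiv.Perm (Fin n)) : 0 ∉ peakSet σ := by
  simp [peakSet]

theorem succ_mem_peakSet {n : ℕ} {σ : Equiv.Perm (Fin n)} {k : ℕ} :
    k + 1 ∈ peakSet σ ↔ IsAscent σ k ∧ ¬IsAscent σ (k + 1) := by
  simp only [peakSet, mem_filter, mem_Icc, Nat.add_sub_cancel]
  by_cases hk : k + 1 < n
  · rw [not_isAscent_succ σ hk, IsAscent, entry_succ σ hk, entry_succ σ (by omega : k < n),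
      Fin.lt_def]
    omega
  · refine iff_of_false (by omega) fun h => ?_
    exact hk (lt_of_not_isAscent h.2)

theorem mul_lt_zero_iff_eq_neg_one {u : ℤˣ} {a : ℤ} (ha : 0 < a) : (u : ℤ) * a < 0 ↔ u = -1 := by
  rcases Int.units_eq_one_or u with rfl | rfl
  · simp [ha.le]
  · simp [ha]

/-- The summand of larger absolute value decides every comparison, through its sign alone. -/
theorem unit_mul_lt_iff_of_lt {u v : ℤˣ} {a b : ℤ} (ha : 0 < a) (h : a < b) :
    ((v : ℤ) * b < (u : ℤ) * a ↔ v = -1) ∧ ((u : ℤ) * a < (v : ℤ) * b ↔ v = 1) ∧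
      ((u : ℤ) * a + (v : ℤ) * b < 0 ↔ v = -1) := by
  have h1 : (1 : ℤˣ) ≠ -1 := by decide
  have h2 : (-1 : ℤˣ) ≠ 1 := by decide
  rcases Int.units_eq_one_or u with rfl | rfl <;> rcases Int.units_eq_one_or v with rfl | rfl <;>
    simp [h1, h2] <;> omega

theorem mem_descentSet_genB_of_isAscent {n : ℕ} {u : SignedPerm n} {p : Fin n}
    (h : IsAscent u.right p) :
    p ∈ descentSet (genB n) u ↔ u.left (u.right p) = -1 := by
  obtain ⟨k, hk⟩ := p
  rcases k with _ | k
  · rw [mem_descentSet_genB_zero rfl, signedEntry, mul_lt_zero_iff_eq_neg_one (by omega)]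
  · rw [mem_descentSet_genB (by simp)]
    rw [isAscent_succ _ hk] at h
    exact (unit_mul_lt_iff_of_lt (by omega) (by rw [Fin.lt_def] at h; simpa using h)).1

theorem mem_descentSet_genB_of_not_isAscent {n : ℕ} {u : SignedPerm n} {k : ℕ} (hk : k + 1 < n)
    (h : ¬IsAscent u.right (k + 1)) : (⟨k + 1, hk⟩ : Fin n) ∈ descentSet (genB n) u ↔
      u.left (u.right ⟨k, by omega⟩) = 1 := by
  rw [mem_descentSet_genB (by simp)]
  rw [not_isAscent_succ _ hk] at h
  exact (unit_mul_lt_iff_of_lt (by omega) (by rw [Fin.lt_def] at h; simpa using h)).2.1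

/-- The number of signs satisfying the constraints imposed by the two edges at a vertex. -/
theorem card_filter_sign (a d x y : Prop) [Decidable a] [Decidable d] [Decidable x]
    [Decidable y] :
    (univ.filter fun s : ℤˣ => (a → (s = -1 ↔ x)) ∧ (d → (s = 1 ↔ y))).card =
      (if (a ∧ d → (x ↔ ¬y)) then 1 else 0) * (if ¬a ∧ ¬d then 2 else 1) := by
  have hu : (univ : Finset ℤˣ) = {1, -1} := rfl
  have h1 : (1 : ℤˣ) ≠ -1 := by decide
  have h2 : (-1 : ℤˣ) ≠ 1 := by decide
  rw [hu, Finset.filter_insert, Finset.filter_singleton]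
  by_cases ha : a <;> by_cases hd : d <;> by_cases hx : x <;> by_cases hy : y <;>
    simp [ha, hd, hx, hy, h1, h2]

open Classical in
-- Switches from ascents to descents alternate with switches back, and the first switch leaves the
-- ascents because `A 0` holds.
theorem card_peaks_eq_card_valleys {A : ℕ → Prop} (h0 : A 0) (n : ℕ) :
    ((range n).filter fun k => A k ∧ ¬A (k + 1)).card =
      ((range n).filter fun k => ¬A k ∧ A (k + 1)).card + if A n then 0 else 1 := by
  induction n with
  | zero => simp [h0]
  | succ n ih =>
    rw [Finset.range_add_one, Finset.filter_insert, Finset.filter_insert]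
    by_cases hn : A n <;> by_cases hn1 : A (n + 1) <;> simp [hn, hn1] at ih ⊢ <;> omega

open Classical in
-- By convention both `0` and everything from `n` on are ascents, so the sequence starts and ends
-- with ascents. A final descent thus produces a valley at the last position, and valleys balance
-- peaks exactly.
theorem card_filter_valley {n : ℕ} (σ : Equiv.Perm (Fin n)) :
    (univ.filter fun p : Fin n => ¬IsAscent σ p ∧ ¬¬IsAscent σ (p + 1)).card =
      (peakSet σ).card := by
  have h := card_peaks_eq_card_valleys (isAscent_zero σ) n
  rw [if_pos (isAscent_of_le σ le_rfl), add_zero] at h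
  have h1 : (univ.filter fun p : Fin n => ¬IsAscent σ p ∧ ¬¬IsAscent σ (p + 1)).card =
      ((range n).filter fun k => ¬IsAscent σ k ∧ IsAscent σ (k + 1)).card := by
    refine Finset.card_bij (fun p _ => p.val) ?_ (fun _ _ _ _ h => Fin.ext h) ?_
    · intro p hp
      simpa using hp
    · intro k hk
      simp only [mem_filter, mem_range] at hk
      exact ⟨⟨k, hk.1⟩, by simpa using hk.2, rfl⟩
  rw [h1, ← h]
  refine Finset.card_bij (fun k _ => k + 1) ?_ (fun _ _ _ _ h => Nat.succ_injective h) ?_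
  · intro k hk
    simp only [mem_filter, mem_range] at hk
    exact succ_mem_peakSet.2 hk.2
  · rintro (_ | k) hk
    · exact absurd hk (zero_notMem_peakSet σ)
    · have := succ_mem_peakSet.1 hk
      have := lt_of_not_isAscent this.2
      exact ⟨k, by simp only [mem_filter, mem_range]; exact ⟨by omega, succ_mem_peakSet.1 hk⟩, rfl⟩

open Classical in
/-- The signings of a permutation with prescribed type B descents. -/
noncomputable def signings {n : ℕ} (σ : Equiv.Perm (Fin n)) (j : ℕ → Prop) :
    Finset (SignedPerm n) :=
  univ.filter fun u => u.right = σ ∧ ∀ p : Fin n, p ∈ descentSet (genB n) u ↔ j p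

theorem mem_signings {n : ℕ} {σ : Equiv.Perm (Fin n)} {j : ℕ → Prop} {u : SignedPerm n} :
    u ∈ signings σ j ↔ u.right = σ ∧ ∀ p : Fin n, p ∈ descentSet (genB n) u ↔ j p := by
  simp [signings]

open Classical in
/-- The number of signings of a permutation with prescribed type B descents. -/
theorem card_signings {n : ℕ} (σ : Equiv.Perm (Fin n)) (j : ℕ → Prop) :
    (signings σ j).card =
      if (∀ k, k + 1 ∈ peakSet σ → (j k ↔ ¬j (k + 1))) then 2 ^ (peakSet σ).card else 0 := by
  -- A signing is a choice of sign at each position, and the descent conditions split by position: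
  -- an ascent constrains the sign at its right end, a descent the sign at its left end.
  have h1 : (signings σ j).card =
      (Fintype.piFinset fun p : Fin n => univ.filter fun s : ℤˣ =>
        (IsAscent σ p → (s = -1 ↔ j p)) ∧ (¬IsAscent σ (p + 1) → (s = 1 ↔ j (p + 1)))).card := by
    refine Finset.card_bij (fun u _ p => u.left (u.right p)) ?_ ?_ ?_
    · intro u hu
      rw [mem_signings] at hu
      obtain ⟨rfl, hu⟩ := hu
      simp only [Fintype.mem_piFinset, mem_filter, mem_univ, true_and]
      refine fun p => ⟨fun ha => ?_, fun hd => ?_⟩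
      · rw [← mem_descentSet_genB_of_isAscent ha, hu]
      · have hp := lt_of_not_isAscent hd
        rw [← mem_descentSet_genB_of_not_isAscent hp hd, hu]
    · intro u hu v hv h
      rw [mem_signings] at hu hv
      refine SemidirectProduct.ext ?_ (hu.1.trans hv.1.symm)
      funext i
      have := congrFun h (σ⁻¹ i)
      simpa [hu.1, hv.1] using this
    · intro η hη
      simp only [Fintype.mem_piFinset, mem_filter, mem_univ, true_and] at hη
      refine ⟨⟨fun i => η (σ⁻¹ i), σ⟩, ?_, by funext p; simp⟩
      refine mem_signings.2 ⟨rfl, ?_⟩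
      rintro ⟨k, hk⟩
      by_cases ha : IsAscent σ k
      · rw [mem_descentSet_genB_of_isAscent ha]
        simpa using (hη ⟨k, hk⟩).1 ha
      · rcases k with _ | k
        · exact absurd (isAscent_zero σ) ha
        · rw [mem_descentSet_genB_of_not_isAscent hk ha]
          simpa using (hη ⟨k, by omega⟩).2 ha
  rw [h1, Fintype.card_piFinset]
  simp only [card_filter_sign]
  rw [Finset.prod_mul_distrib, Finset.prod_ite (f := fun _ => 2), Finset.prod_const_one,
    Finset.prod_const, mul_one, card_filter_valley]
  split_ifs with h
  · rw [Finset.prod_eq_one, one_mul]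
    exact fun p _ => if_pos fun hp => h p (succ_mem_peakSet.2 hp)
  · push Not at h
    obtain ⟨k, hk, hj⟩ := h
    have hk' := succ_mem_peakSet.1 hk
    have := lt_of_not_isAscent hk'.2
    rw [Finset.prod_eq_zero (i := ⟨k, by omega⟩) (mem_univ _), zero_mul]
    refine if_neg fun hn => ?_
    have := hn hk'
    tauto

/-! ### Peak sums -/

/-- The sum of `2 ^ |F| P_F` over all subsets `F` of `D`. -/
noncomputable def elemQ (n : ℕ) (D : Finset ℕ) : MonoidAlgebra ℚ (Equiv.Perm (Fin n)) :=
  ∑ F ∈ D.powerset, (2 : ℚ) ^ F.card • elemP n F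

/-- A weighted sum of peak class sums as a sum over permutations. -/
theorem sum_smul_elemP (n : ℕ) (S : Finset (Finset ℕ)) (c : Finset ℕ → ℚ) :
    ∑ F ∈ S, c F • elemP n F = ∑ σ : Equiv.Perm (Fin n),
      (if peakSet σ ∈ S then c (peakSet σ) else 0) • MonoidAlgebra.of ℚ _ σ := by
  simp only [elemP, Finset.smul_sum, Finset.sum_filter]
  rw [Finset.sum_comm]
  refine Finset.sum_congr rfl fun σ _ => ?_
  simp

/-- The positions where exactly one of two consecutive labels belongs to a set of labels. -/
def altSet (n : ℕ) (j : ℕ → Prop) [DecidablePred j] : Finset ℕ :=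
  (Icc 1 (n - 1)).filter fun i => j (i - 1) ↔ ¬j i

theorem peakSet_subset_altSet_iff {n : ℕ} (σ : Equiv.Perm (Fin n)) (j : ℕ → Prop)
    [DecidablePred j] :
    peakSet σ ⊆ altSet n j ↔ ∀ k, k + 1 ∈ peakSet σ → (j k ↔ ¬j (k + 1)) := by
  constructor
  · intro h k hk
    simpa using (mem_filter.1 (h hk)).2
  · rintro h (_ | k) hk
    · exact absurd hk (zero_notMem_peakSet σ)
    · exact mem_filter.2 ⟨(mem_filter.1 hk).1, by simpa using h k hk⟩

theorem sum_filter_map_of {G H : Type*} [Monoid G] [Monoid H] [Fintype G] [Fintype H]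
    [DecidableEq H] (f : G → H) (p : G → Prop) [DecidablePred p] :
    ∑ w ∈ univ.filter p, MonoidAlgebra.of ℚ H (f w) =
      ∑ h, ((univ.filter fun w => f w = h ∧ p w).card : ℚ) • MonoidAlgebra.of ℚ H h := by
  rw [← Finset.sum_fiberwise_of_maps_to (g := f) (t := univ) (fun _ _ => mem_univ _)]
  refine Finset.sum_congr rfl fun h _ => ?_
  rw [Finset.filter_filter, Finset.sum_congr rfl (g := fun _ => MonoidAlgebra.of ℚ H h),
    Finset.sum_const, Nat.cast_smul_eq_nsmul]
  · simp only [and_comm]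
  · intro w hw
    rw [(mem_filter.1 hw).2.2]

/-- A set of labels of type B as a predicate on natural numbers. -/
def natLabel {n : ℕ} (J : Finset (Fin n)) (k : ℕ) : Prop := ∃ h : k < n, (⟨k, h⟩ : Fin n) ∈ J

instance {n : ℕ} (J : Finset (Fin n)) : DecidablePred (natLabel J) := fun _ => by
  unfold natLabel; infer_instance

theorem natLabel_val {n : ℕ} (J : Finset (Fin n)) (p : Fin n) : natLabel J p ↔ p ∈ J :=
  ⟨fun ⟨_, h⟩ => h, fun h => ⟨p.2, h⟩⟩

/-- The coefficient of `σ` is the number of its signings with descent set `J`, given by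
`card_signings`. -/
theorem phiHom_elemY (n : ℕ) (J : Finset (Fin n)) :
    phiHom n (elemY (genB n) J) = elemQ n (altSet n (natLabel J)) := by
  classical
  rw [elemY, map_sum, elemQ, sum_smul_elemP]
  have h1 : ∀ w : SignedPerm n, phiHom n (MonoidAlgebra.of ℚ _ w) =
      MonoidAlgebra.of ℚ _ w.right := fun w => by
    simp [phiHom, MonoidAlgebra.of_apply, forgetSigns]
  simp only [h1]
  rw [sum_filter_map_of (fun w : SignedPerm n => w.right)]
  refine Finset.sum_congr rfl fun σ _ => ?_
  congr 1
  have h2 : (univ.filter fun u : SignedPerm n => u.right = σ ∧ descentSet (genB n) u = J).card =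
      if (∀ k, k + 1 ∈ peakSet σ → (natLabel J k ↔ ¬natLabel J (k + 1)))
        then 2 ^ (peakSet σ).card else 0 := by
    rw [← card_signings]
    refine congrArg Finset.card (Finset.ext fun u => ?_)
    simp only [mem_filter, mem_univ, true_and, mem_signings, natLabel_val, Finset.ext_iff]
  rw [h2]
  simp only [mem_powerset, peakSet_subset_altSet_iff]
  split_ifs <;> simp

/-! ### Type D descents -/

/-- The type D descents of a signed permutation with any number of bars. -/
def desD {m : ℕ} (u : SignedPerm (m + 2)) : Finset (Option (Fin (m + 1))) :=
  univ.filter fun i => simpleD m i ⬝ᵥ signedEntry u < 0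

theorem descentSet_genD {m : ℕ} (w : evenSigned (m + 2)) :
    descentSet (genD m) w = desD (w : SignedPerm (m + 2)) := by
  ext i
  rw [(frameD m).mem_descentSet, RootFrame.act_dot_right]
  change simpleD m i ⬝ᵥ signedAct (m + 2) (w : SignedPerm (m + 2))⁻¹ (stdRho (m + 2)) < 0 ↔ _
  have : signedAct (m + 2) (w : SignedPerm (m + 2))⁻¹ (stdRho (m + 2)) = signedEntry w.1 :=
    funext fun p => signedAct_inv_apply _ _ _
  rw [this, desD, mem_filter]
  simp

theorem none_mem_desD {m : ℕ} {u : SignedPerm (m + 2)} :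
    none ∈ desD u ↔ signedEntry u 0 + signedEntry u 1 < 0 := by
  rw [desD, mem_filter, simpleD_none_dot]
  simp

theorem some_mem_desD {m : ℕ} {u : SignedPerm (m + 2)} {i : Fin (m + 1)} :
    some i ∈ desD u ↔ signedEntry u i.succ < signedEntry u i.castSucc := by
  rw [desD, mem_filter, simpleD_some_dot, sub_neg]
  simp

theorem some_mem_desD_iff {m : ℕ} {u : SignedPerm (m + 2)} {i : Fin (m + 1)} :
    some i ∈ desD u ↔ i.succ ∈ descentSet (genB (m + 2)) u := by
  rw [some_mem_desD, mem_descentSet_genB (by simp)]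
  rfl

/-- Change the sign of the smallest symbol. -/
def flipFirst {m : ℕ} (u : SignedPerm (m + 2)) : SignedPerm (m + 2) :=
  ⟨Pi.mulSingle 0 (-1) * u.left, u.right⟩

theorem flipFirst_flipFirst {m : ℕ} (u : SignedPerm (m + 2)) : flipFirst (flipFirst u) = u := by
  refine SemidirectProduct.ext ?_ rfl
  change Pi.mulSingle 0 (-1) * (Pi.mulSingle 0 (-1) * u.left) = u.left
  rw [← mul_assoc, ← Pi.mulSingle_mul]
  simp

theorem prod_flipFirst {m : ℕ} (u : SignedPerm (m + 2)) :
    ∏ j, (flipFirst u).left j = -∏ j, u.left j := by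
  simp only [flipFirst, Pi.mul_apply]
  rw [Finset.prod_mul_distrib, Finset.prod_pi_mulSingle']
  simp

theorem signedEntry_flipFirst {m : ℕ} (u : SignedPerm (m + 2)) (p : Fin (m + 2)) :
    signedEntry (flipFirst u) p = signedEntry u p ∨
      (signedEntry (flipFirst u) p = -signedEntry u p ∧ |signedEntry u p| = 1) := by
  simp only [signedEntry, flipFirst, Pi.mul_apply]
  by_cases h : u.right p = 0
  · right
    rw [abs_units_mul, h]
    simp
  · left
    rw [Pi.mulSingle_eq_of_ne h, one_mul]

theorem abs_signedEntry {n : ℕ} (u : SignedPerm n) (p : Fin n) :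
    |signedEntry u p| = (u.right p : ℤ) + 1 := by
  rw [signedEntry, abs_units_mul, abs_of_nonneg (by omega)]

theorem signedEntry_ne {n : ℕ} (u : SignedPerm n) {p q : Fin n} (h : p ≠ q) :
    signedEntry u p ≠ signedEntry u q ∧ signedEntry u p ≠ -signedEntry u q := by
  have h1 : (u.right p : ℤ) ≠ u.right q := by
    exact_mod_cast Fin.val_ne_of_ne (u.right.injective.ne h)
  have h2 : |signedEntry u p| ≠ |signedEntry u q| := by
    rw [abs_signedEntry, abs_signedEntry]; omega
  exact ⟨fun h => h2 (by rw [h]), fun h => h2 (by rw [h, abs_neg])⟩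

theorem signedEntry_ne_zero {n : ℕ} (u : SignedPerm n) (p : Fin n) : signedEntry u p ≠ 0 := by
  rw [← abs_pos, abs_signedEntry]; omega

/-- Type D descents compare two entries of distinct absolute values, up to signs. The entry `±1` is
always the smaller one, so its sign is irrelevant. -/
theorem desD_flipFirst {m : ℕ} (u : SignedPerm (m + 2)) : desD (flipFirst u) = desD u := by
  have key : ∀ p q : Fin (m + 2), p ≠ q →
      (signedEntry (flipFirst u) q < signedEntry (flipFirst u) p ↔
        signedEntry u q < signedEntry u p) ∧
      (signedEntry (flipFirst u) p + signedEntry (flipFirst u) q < 0 ↔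
        signedEntry u p + signedEntry u q < 0) := by
    intro p q h
    have h1 := signedEntry_flipFirst u p
    have h2 := signedEntry_flipFirst u q
    have h3 := signedEntry_ne u h
    have h4 := signedEntry_ne_zero u p
    have h5 := signedEntry_ne_zero u q
    simp only [abs_eq (zero_le_one' ℤ)] at h1 h2
    omega
  ext i
  rcases i with _ | i
  · rw [none_mem_desD, none_mem_desD]
    exact (key 0 1 (by simp)).2
  · rw [some_mem_desD, some_mem_desD]
    exact (key _ _ (Fin.castSucc_lt_succ (i := i)).ne).1

/-- The involution `flipFirst` preserves the descents and exchanges even and odd signings. -/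
theorem card_evenSigned_mul_two {m : ℕ} (σ : Equiv.Perm (Fin (m + 2)))
    (J : Finset (Option (Fin (m + 1)))) :
    2 * (univ.filter fun w : evenSigned (m + 2) => w.1.right = σ ∧ descentSet (genD m) w = J).card =
      (univ.filter fun u : SignedPerm (m + 2) => u.right = σ ∧ desD u = J).card := by
  set T := univ.filter fun u : SignedPerm (m + 2) => u.right = σ ∧ desD u = J with hT
  have h1 : (univ.filter fun w : evenSigned (m + 2) =>
      w.1.right = σ ∧ descentSet (genD m) w = J).card =
      (T.filter fun u => ∏ j, u.left j = 1).card := by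
    refine Finset.card_bij (fun w _ => w.1) ?_ (fun _ _ _ _ h => Subtype.ext h) ?_
    · intro w hw
      simp only [mem_filter, mem_univ, true_and, descentSet_genD, T] at hw ⊢
      exact ⟨hw, prod_left_eq_one w⟩
    · intro u hu
      simp only [mem_filter, mem_univ, true_and, T] at hu
      exact ⟨⟨u, (prod_sign_eq_one_iff _).2 hu.2⟩, by simpa [descentSet_genD] using hu.1, rfl⟩
  have h2 : (T.filter fun u => ¬∏ j, u.left j = 1).card =
      (T.filter fun u => ∏ j, u.left j = 1).card := by
    have hmem : ∀ u ∈ T, flipFirst u ∈ T := fun u hu => by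
      simp only [T, mem_filter, mem_univ, true_and, desD_flipFirst] at hu ⊢
      exact hu
    have hne : (1 : ℤˣ) ≠ -1 := by decide
    refine Finset.card_nbij' flipFirst flipFirst ?_ ?_ (fun u _ => flipFirst_flipFirst u)
      (fun u _ => flipFirst_flipFirst u)
    · intro u hu
      rw [mem_coe, mem_filter] at hu ⊢
      refine ⟨hmem u hu.1, ?_⟩
      rw [prod_flipFirst, (Int.units_eq_one_or _).resolve_left hu.2, neg_neg]
    · intro u hu
      rw [mem_coe, mem_filter] at hu ⊢
      refine ⟨hmem u hu.1, ?_⟩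
      rw [prod_flipFirst, hu.2]
      exact hne.symm
  rw [h1, ← Finset.card_filter_add_card_filter_not (s := T) (fun u => ∏ j, u.left j = 1), h2,
    two_mul]

/-- The nonzero labels of type D as a predicate on natural numbers. -/
def labelD {m : ℕ} (J : Finset (Option (Fin (m + 1)))) (k : ℕ) : Prop :=
  ∃ i : Fin (m + 1), i.val + 1 = k ∧ some i ∈ J

instance {m : ℕ} (J : Finset (Option (Fin (m + 1)))) : DecidablePred (labelD J) := fun _ => by
  unfold labelD; infer_instance

theorem labelD_succ {m : ℕ} {J : Finset (Option (Fin (m + 1)))} (i : Fin (m + 1)) :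
    labelD J (i.val + 1) ↔ some i ∈ J :=
  ⟨fun ⟨k, hk, h⟩ => by rwa [Fin.ext (Nat.succ_injective hk)] at h, fun h => ⟨i, rfl, h⟩⟩

theorem not_labelD_zero {m : ℕ} (J : Finset (Option (Fin (m + 1)))) : ¬labelD J 0 :=
  fun ⟨_, hk, _⟩ => Nat.succ_ne_zero _ hk

theorem labelD_one {m : ℕ} (J : Finset (Option (Fin (m + 1)))) : labelD J 1 ↔ some 0 ∈ J :=
  labelD_succ 0

theorem zero_mem_descentSet_genB {m : ℕ} {u : SignedPerm (m + 2)} :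
    0 ∈ descentSet (genB (m + 2)) u ↔ u.left (u.right 0) = -1 :=
  mem_descentSet_genB_of_isAscent (isAscent_zero _)

/-- Both conditions say that the second entry, the larger in absolute value, is negative. -/
theorem none_mem_desD_of_lt {m : ℕ} {u : SignedPerm (m + 2)} (h : u.right 0 < u.right 1) :
    none ∈ desD u ↔ some 0 ∈ desD u := by
  have h1 := unit_mul_lt_iff_of_lt (u := u.left (u.right 0)) (v := u.left (u.right 1))
    (a := (u.right 0 : ℤ) + 1) (b := (u.right 1 : ℤ) + 1) (by omega)
    (by rw [Fin.lt_def] at h; omega)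
  rw [none_mem_desD, some_mem_desD]
  exact h1.2.2.trans h1.1.symm

/-- Here the first entry is the larger in absolute value: label `1'` says that it is negative, label
`1` that it is positive. -/
theorem none_mem_desD_of_gt {m : ℕ} {u : SignedPerm (m + 2)} (h : u.right 1 < u.right 0) :
    (none ∈ desD u ↔ 0 ∈ descentSet (genB (m + 2)) u) ∧ (none ∈ desD u ↔ some 0 ∉ desD u) := by
  have h1 := unit_mul_lt_iff_of_lt (u := u.left (u.right 1)) (v := u.left (u.right 0))
    (a := (u.right 1 : ℤ) + 1) (b := (u.right 0 : ℤ) + 1) (by omega)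
    (by rw [Fin.lt_def] at h; omega)
  have h2 : none ∈ desD u ↔ u.left (u.right 0) = -1 := by
    rw [none_mem_desD, add_comm]
    exact h1.2.2
  have h3 : some 0 ∈ desD u ↔ u.left (u.right 0) = 1 := by
    rw [some_mem_desD]
    exact h1.2.1
  rw [h2, h3, zero_mem_descentSet_genB]
  refine ⟨Iff.rfl, ?_⟩
  rcases Int.units_eq_one_or (u.left (u.right 0)) with h | h <;> rw [h] <;> decide

theorem forall_mem_descentSet_genB {m : ℕ} {u : SignedPerm (m + 2)} {b : Prop}
    {J : Finset (Option (Fin (m + 1)))} :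
    (∀ p : Fin (m + 2), p ∈ descentSet (genB (m + 2)) u ↔ p.val = 0 ∧ b ∨ labelD J p) ↔
      (0 ∈ descentSet (genB (m + 2)) u ↔ b) ∧ ∀ i, some i ∈ desD u ↔ some i ∈ J := by
  rw [Fin.forall_fin_succ]
  refine and_congr ?_ (forall_congr' fun i => ?_)
  · simp [not_labelD_zero]
  · rw [some_mem_desD_iff, Fin.val_succ, labelD_succ]
    simp

/-- The set of positions at least two where exactly one of two consecutive labels belongs
to `J`. -/
def altSetD {m : ℕ} (J : Finset (Option (Fin (m + 1)))) : Finset ℕ :=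
  (Icc 2 (m + 1)).filter fun i => labelD J (i - 1) ↔ ¬labelD J i

/-- Splits the condition of `card_signings` into its part at the peak `1`, the only one involving
the type B label `0`, and its part at the interior peaks. -/
theorem forall_peak_iff {m : ℕ} (σ : Equiv.Perm (Fin (m + 2))) (b : Prop)
    (J : Finset (Option (Fin (m + 1)))) :
    (∀ k, k + 1 ∈ peakSet σ → ((k = 0 ∧ b ∨ labelD J k) ↔ ¬(k + 1 = 0 ∧ b ∨ labelD J (k + 1)))) ↔
      (1 ∈ peakSet σ → (b ↔ some 0 ∉ J)) ∧ (peakSet σ).erase 1 ⊆ altSetD J := by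
  constructor
  · intro h
    refine ⟨fun h1 => ?_, fun i hi => ?_⟩
    · have := h 0 h1
      simpa [not_labelD_zero, labelD_one] using this
    · obtain ⟨hi1, hi⟩ := mem_erase.1 hi
      have hr := mem_Icc.1 (mem_filter.1 hi).1
      obtain ⟨k, rfl⟩ : ∃ k, i = k + 1 := ⟨i - 1, by omega⟩
      have := h k hi
      have hk : k ≠ 0 := by omega
      refine mem_filter.2 ⟨mem_Icc.2 (by omega), ?_⟩
      simpa [hk] using this
  · rintro ⟨h1, h2⟩ k hk
    rcases k with _ | k
    · simpa [not_labelD_zero, labelD_one] using h1 hk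
    · have := (mem_filter.1 (h2 (mem_erase.2 ⟨by omega, hk⟩))).2
      simpa using this

theorem one_mem_peakSet {m : ℕ} {σ : Equiv.Perm (Fin (m + 2))} :
    1 ∈ peakSet σ ↔ σ 1 < σ 0 := by
  refine (succ_mem_peakSet (k := 0)).trans ?_
  rw [not_isAscent_succ σ (by omega : 0 + 1 < m + 2)]
  exact and_iff_right (isAscent_zero σ)

theorem one_notMem_peakSet {m : ℕ} {σ : Equiv.Perm (Fin (m + 2))} :
    1 ∉ peakSet σ ↔ σ 0 < σ 1 := by
  rw [one_mem_peakSet, not_lt]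
  exact ⟨fun h => lt_of_le_of_ne h (σ.injective.ne (by simp)), le_of_lt⟩

theorem desD_eq_iff {m : ℕ} {u : SignedPerm (m + 2)} {J : Finset (Option (Fin (m + 1)))} :
    desD u = J ↔ (none ∈ desD u ↔ none ∈ J) ∧ ∀ i, some i ∈ desD u ↔ some i ∈ J := by
  rw [Finset.ext_iff, Option.forall]

open Classical in
-- The type D descents leave the type B label `0` free, which doubles the number of signings;
-- restricting to even ones halves it again.
theorem card_evenSigned_of_notMem {m : ℕ} {σ : Equiv.Perm (Fin (m + 2))}
    (J : Finset (Option (Fin (m + 1)))) (h : 1 ∉ peakSet σ) :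
    (univ.filter fun w : evenSigned (m + 2) => w.1.right = σ ∧ descentSet (genD m) w = J).card =
      if (none ∈ J ↔ some 0 ∈ J) ∧ peakSet σ ⊆ altSetD J then 2 ^ (peakSet σ).card else 0 := by
  have h2 := card_evenSigned_mul_two σ J
  have hlt := one_notMem_peakSet.1 h
  have hc : ∀ b : Prop, (signings σ fun k => k = 0 ∧ b ∨ labelD J k).card =
      if peakSet σ ⊆ altSetD J then 2 ^ (peakSet σ).card else 0 := fun b => by
    rw [card_signings σ fun k => k = 0 ∧ b ∨ labelD J k]
    refine if_congr ?_ rfl rfl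
    rw [forall_peak_iff, erase_eq_of_notMem h]
    simp [h]
  by_cases hJ : none ∈ J ↔ some 0 ∈ J
  · have h3 : (univ.filter fun u : SignedPerm (m + 2) => u.right = σ ∧ desD u = J) =
        (signings σ fun k => k = 0 ∧ True ∨ labelD J k) ∪
        (signings σ fun k => k = 0 ∧ False ∨ labelD J k) := by
      ext u
      simp only [mem_union, mem_filter, mem_univ, true_and, mem_signings, forall_mem_descentSet_genB,
        desD_eq_iff]
      constructor
      · rintro ⟨hu, -, h5⟩
        by_cases h0 : 0 ∈ descentSet (genB (m + 2)) u
        · exact Or.inl ⟨hu, iff_of_true h0 trivial, h5⟩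
        · exact Or.inr ⟨hu, iff_of_false h0 id, h5⟩
      · rintro (⟨hu, -, h5⟩ | ⟨hu, -, h5⟩) <;>
          exact ⟨hu, by rw [none_mem_desD_of_lt (by rwa [hu]), h5, hJ], h5⟩
    have h4 : Disjoint (signings σ fun k => k = 0 ∧ True ∨ labelD J k)
        (signings σ fun k => k = 0 ∧ False ∨ labelD J k) := by
      rw [Finset.disjoint_left]
      intro u hu hv
      simp only [mem_signings, forall_mem_descentSet_genB] at hu hv
      exact hv.2.1.1 (hu.2.1.2 trivial)
    rw [h3, card_union_of_disjoint h4, hc, hc] at h2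
    simp only [hJ, true_and]
    omega
  · rw [if_neg fun hn => hJ hn.1]
    rw [(Finset.card_eq_zero (s := univ.filter fun u : SignedPerm (m + 2) =>
      u.right = σ ∧ desD u = J)).2] at h2
    · omega
    · rw [Finset.filter_eq_empty_iff]
      rintro u - ⟨rfl, rfl⟩
      exact hJ (none_mem_desD_of_lt hlt)

open Classical in
-- Label `1'` now plays the role of the type B label `0`, so the type B count applies directly.
-- Restricting to even signings removes the factor `2` contributed by the peak `1`.
theorem card_evenSigned_of_mem {m : ℕ} {σ : Equiv.Perm (Fin (m + 2))}
    (J : Finset (Option (Fin (m + 1)))) (h : 1 ∈ peakSet σ) :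
    (univ.filter fun w : evenSigned (m + 2) => w.1.right = σ ∧ descentSet (genD m) w = J).card =
      if (none ∈ J ↔ some 0 ∉ J) ∧ (peakSet σ).erase 1 ⊆ altSetD J
        then 2 ^ ((peakSet σ).erase 1).card else 0 := by
  have h2 := card_evenSigned_mul_two σ J
  have hlt := one_mem_peakSet.1 h
  have hc := card_signings σ fun k => k = 0 ∧ none ∈ J ∨ labelD J k
  simp only [forall_peak_iff, h, true_imp_iff] at hc
  by_cases hJ : none ∈ J ↔ some 0 ∉ J
  · have h3 : (univ.filter fun u : SignedPerm (m + 2) => u.right = σ ∧ desD u = J) =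
        (signings σ fun k => k = 0 ∧ none ∈ J ∨ labelD J k) := by
      ext u
      simp only [mem_filter, mem_univ, true_and, mem_signings, forall_mem_descentSet_genB, desD_eq_iff]
      refine and_congr_right fun hu => and_congr_left fun _ => ?_
      rw [(none_mem_desD_of_gt (by rwa [hu])).1]
    rw [h3, hc, ← Finset.card_erase_add_one h, pow_succ'] at h2
    split_ifs at h2 ⊢ <;> omega
  · rw [if_neg fun hn => hJ hn.1]
    rw [(Finset.card_eq_zero (s := univ.filter fun u : SignedPerm (m + 2) =>
      u.right = σ ∧ desD u = J)).2] at h2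
    · omega
    · rw [Finset.filter_eq_empty_iff]
      rintro u - ⟨rfl, rfl⟩
      exact hJ (none_mem_desD_of_gt hlt).2

/-- The sum of `2 ^ |F| P_{F ∪ {1}}` over all subsets `F` of `D`. -/
noncomputable def elemQ' (n : ℕ) (D : Finset ℕ) : MonoidAlgebra ℚ (Equiv.Perm (Fin n)) :=
  ∑ F ∈ D.powerset, (2 : ℚ) ^ F.card • elemP n (insert 1 F)

theorem elemQ'_eq {n : ℕ} {D : Finset ℕ} (hD : 1 ∉ D) :
    elemQ' n D = ∑ σ : Equiv.Perm (Fin n),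
      (if 1 ∈ peakSet σ ∧ (peakSet σ).erase 1 ⊆ D then (2 : ℚ) ^ ((peakSet σ).erase 1).card
        else 0) • MonoidAlgebra.of ℚ _ σ := by
  have hF : ∀ F ∈ D.powerset, 1 ∉ F := fun F hF h1 => hD (mem_powerset.1 hF h1)
  have h1 : elemQ' n D = ∑ F ∈ D.powerset.image (insert 1),
      (2 : ℚ) ^ (F.erase 1).card • elemP n F := by
    rw [Finset.sum_image]
    · exact Finset.sum_congr rfl fun F h => by rw [erase_insert (hF F h)]
    · intro F h G h' heq
      have := congrArg (fun S => S.erase 1) heq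
      simpa [erase_insert (hF F h), erase_insert (hF G h')] using this
  rw [h1, sum_smul_elemP n _ fun F => (2 : ℚ) ^ (F.erase 1).card]
  refine Finset.sum_congr rfl fun σ _ => ?_
  congr 1
  refine if_congr ?_ rfl rfl
  simp only [mem_image, mem_powerset]
  constructor
  · rintro ⟨F, h, hs⟩
    rw [← hs, erase_insert (hF F (mem_powerset.2 h))]
    exact ⟨mem_insert_self _ _, h⟩
  · rintro ⟨h, hs⟩
    exact ⟨_, hs, insert_erase h⟩

theorem psiHom_elemY_eq_sum {m : ℕ} (J : Finset (Option (Fin (m + 1)))) :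
    psiHom (m + 2) (elemY (genD m) J) = ∑ σ, ((univ.filter fun w : evenSigned (m + 2) =>
      w.1.right = σ ∧ descentSet (genD m) w = J).card : ℚ) • MonoidAlgebra.of ℚ _ σ := by
  have h1 : ∀ w : evenSigned (m + 2), psiHom (m + 2) (MonoidAlgebra.of ℚ _ w) =
      MonoidAlgebra.of ℚ _ w.1.right := fun w => by
    simp [psiHom, MonoidAlgebra.of_apply, forgetSigns]
  rw [elemY, map_sum]
  simp only [h1]
  exact sum_filter_map_of (fun w : evenSigned (m + 2) => w.1.right) _

theorem one_notMem_altSetD {m : ℕ} (J : Finset (Option (Fin (m + 1)))) : 1 ∉ altSetD J := by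
  simp [altSetD]

theorem psiHom_elemY_of_iff {m : ℕ} {J : Finset (Option (Fin (m + 1)))}
    (hJ : none ∈ J ↔ some 0 ∈ J) :
    psiHom (m + 2) (elemY (genD m) J) = elemQ (m + 2) (altSetD J) := by
  rw [psiHom_elemY_eq_sum, elemQ, sum_smul_elemP _ _ fun F => (2 : ℚ) ^ F.card]
  refine Finset.sum_congr rfl fun σ _ => ?_
  congr 1
  by_cases h : 1 ∈ peakSet σ
  · rw [card_evenSigned_of_mem J h, if_neg (by tauto), if_neg, Nat.cast_zero]
    exact fun hn => one_notMem_altSetD J (mem_powerset.1 hn h)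
  · rw [card_evenSigned_of_notMem J h]
    simp only [hJ, true_and, mem_powerset]
    split_ifs <;> simp

theorem psiHom_elemY_of_not_iff {m : ℕ} {J : Finset (Option (Fin (m + 1)))}
    (hJ : ¬(none ∈ J ↔ some 0 ∈ J)) :
    psiHom (m + 2) (elemY (genD m) J) = elemQ' (m + 2) (altSetD J) := by
  have hJ' : none ∈ J ↔ some 0 ∉ J := by tauto
  rw [psiHom_elemY_eq_sum, elemQ'_eq (one_notMem_altSetD J)]
  refine Finset.sum_congr rfl fun σ _ => ?_
  congr 1
  by_cases h : 1 ∈ peakSet σ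
  · rw [card_evenSigned_of_mem J h]
    simp only [hJ', h, true_and]
    split_ifs <;> simp
  · rw [card_evenSigned_of_notMem J h, if_neg (by tauto), if_neg (by tauto), Nat.cast_zero]

/-! ### The peak space -/

theorem isPeakIndex_peakSet {n : ℕ} (σ : Equiv.Perm (Fin n)) : IsPeakIndex n (peakSet σ) := by
  refine ⟨filter_subset _ _, ?_⟩
  rintro (_ | k) hk hk1
  · exact zero_notMem_peakSet σ hk
  · exact (succ_mem_peakSet.1 hk).2 (succ_mem_peakSet.1 hk1).1

/-- This allows sums over all subsets of a set of positions, without excluding those with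
consecutive elements. -/
theorem elemP_eq_zero {n : ℕ} {F : Finset ℕ} (h : ¬IsPeakIndex n F) : elemP n F = 0 := by
  rw [elemP, Finset.filter_false_of_mem, Finset.sum_empty]
  rintro σ - rfl
  exact h (isPeakIndex_peakSet σ)

theorem elemP_mem_peakSpace (n : ℕ) (F : Finset ℕ) : elemP n F ∈ peakSpace n := by
  by_cases h : IsPeakIndex n F
  · exact Submodule.subset_span ⟨F, h, rfl⟩
  · rw [elemP_eq_zero h]; exact zero_mem _

/-- The product of the transpositions `(i, i + 1)` for `i ∈ F`. -/
def swapFun {n : ℕ} {F : Finset ℕ} (hF : IsPeakIndex n F) (p : Fin n) : Fin n :=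
  if h : p.val + 1 ∈ F then ⟨p.val + 1, by have := mem_Icc.1 (hF.1 h); omega⟩
  else if p.val ∈ F then ⟨p.val - 1, by omega⟩ else p

theorem swapFun_val {n : ℕ} {F : Finset ℕ} (hF : IsPeakIndex n F) (p : Fin n) :
    (swapFun hF p).val = if p.val + 1 ∈ F then p.val + 1 else if p.val ∈ F then p.val - 1 else p := by
  unfold swapFun
  split_ifs <;> rfl

theorem swapFun_involutive {n : ℕ} {F : Finset ℕ} (hF : IsPeakIndex n F) :
    Function.Involutive (swapFun hF) := by
  intro p
  apply Fin.ext
  rw [swapFun_val, swapFun_val]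
  by_cases h1 : p.val + 1 ∈ F
  · simp [h1, hF.2 _ h1]
  · by_cases h2 : p.val ∈ F
    · have := mem_Icc.1 (hF.1 h2)
      simp [h1, h2, Nat.sub_add_cancel this.1]
    · simp [h1, h2]

/-- Swapping the disjoint pairs of positions ending each at an element of `F` and its successor
gives descents exactly at `F`. As no two are consecutive, each of them is a peak. -/
theorem exists_peakSet_eq {n : ℕ} {F : Finset ℕ} (hF : IsPeakIndex n F) :
    ∃ σ : Equiv.Perm (Fin n), peakSet σ = F := by
  refine ⟨(swapFun_involutive hF).toPerm, ?_⟩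
  have key : ∀ k, ¬IsAscent (swapFun_involutive hF).toPerm (k + 1) ↔ k + 1 ∈ F := by
    intro k
    by_cases hk : k + 1 < n
    · rw [not_isAscent_succ _ hk, Fin.lt_def, Function.Involutive.coe_toPerm, swapFun_val,
        swapFun_val]
      by_cases h1 : k + 1 ∈ F
      · simp [h1, hF.2 _ h1]
      · simp only [h1, if_false, iff_false]
        split_ifs <;> simp only [not_lt] <;> omega
    · refine iff_of_false (fun h => hk (lt_of_not_isAscent h)) fun h => ?_
      have := mem_Icc.1 (hF.1 h)
      omega
  ext i
  rcases i with _ | k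
  · refine iff_of_false (zero_notMem_peakSet _) fun h => ?_
    have := mem_Icc.1 (hF.1 h)
    omega
  · rw [succ_mem_peakSet, key, and_iff_right_iff_imp]
    intro h
    rcases k with _ | k
    · exact isAscent_zero _
    · by_contra hn
      exact hF.2 _ ((key k).1 hn) h

theorem exists_linearMap_elemP {n : ℕ} {M : Type*} [AddCommGroup M] [Module ℚ M]
    (v : Finset ℕ → M) : ∃ f : MonoidAlgebra ℚ (Equiv.Perm (Fin n)) →ₗ[ℚ] M,
      ∀ F, IsPeakIndex n F → f (elemP n F) = v F := by
  obtain ⟨f, hf⟩ := exists_linearMap_classSum (G := Equiv.Perm (Fin n)) peakSet v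
  exact ⟨f, fun F hF => hf F (exists_peakSet_eq hF)⟩

/-- Triangularity of the sums of `2 ^ |F| p F` over the subsets of a set. -/
theorem mem_of_sum_powerset_mem {M : Type*} [AddCommGroup M] [Module ℚ M] {N : Submodule ℚ M}
    {p : Finset ℕ → M} {U : Finset ℕ}
    (h : ∀ D ⊆ U, ∑ F ∈ D.powerset, (2 : ℚ) ^ F.card • p F ∈ N) {F : Finset ℕ} (hF : F ⊆ U) :
    p F ∈ N := by
  induction F using Finset.strongInduction with
  | H F ih =>
    have h1 := h F hF
    rw [← Finset.insert_erase (Finset.mem_powerset_self F),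
      Finset.sum_insert (Finset.notMem_erase _ _)] at h1
    have h2 : ∑ G ∈ F.powerset.erase F, (2 : ℚ) ^ G.card • p G ∈ N :=
      Submodule.sum_mem _ fun G hG => by
        have hG' := Finset.mem_ssubsets.1 hG
        exact Submodule.smul_mem _ _ (ih G hG' (hG'.1.trans hF))
    have h3 := (Submodule.add_mem_iff_left N h2).1 h1
    exact (Submodule.smul_mem_iff N (by positivity)).1 h3

/-- Start outside and toggle membership at each element of `D`. -/
theorem exists_alternating (D : Finset ℕ) : ∃ j : ℕ → Prop, ¬j 0 ∧
    ∀ k, (j k ↔ ¬j (k + 1)) ↔ k + 1 ∈ D := by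
  refine ⟨fun k => Nat.rec False (fun i b => (b ∧ i + 1 ∉ D) ∨ (¬b ∧ i + 1 ∈ D)) k, id, ?_⟩
  intro k
  simp only
  tauto

theorem exists_altSet_eq {n : ℕ} {D : Finset ℕ} (hD : D ⊆ Icc 1 (n - 1)) :
    ∃ J : Finset (Fin n), altSet n (natLabel J) = D := by
  classical
  obtain ⟨j, -, hj⟩ := exists_alternating D
  refine ⟨univ.filter fun p => j p, ?_⟩
  have hJ : ∀ k, natLabel (univ.filter fun p : Fin n => j p) k ↔ k < n ∧ j k := fun k => by
    simp [natLabel]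
  ext i
  simp only [altSet, mem_filter, hJ]
  constructor
  · rintro ⟨hi, h⟩
    rw [mem_Icc] at hi
    obtain ⟨k, rfl⟩ : ∃ k, i = k + 1 := ⟨i - 1, by omega⟩
    rw [← hj]
    simpa [(by omega : k < n), (by omega : k + 1 < n)] using h
  · intro hi
    have h1 := mem_Icc.1 (hD hi)
    obtain ⟨k, rfl⟩ : ∃ k, i = k + 1 := ⟨i - 1, by omega⟩
    refine ⟨hD hi, ?_⟩
    simpa [(by omega : k < n), (by omega : k + 1 < n)] using (hj k).2 hi

/-- Since `D` starts at `2` or later, no toggle has happened at label `1`, so both `1` and `1'` can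
be avoided. -/
theorem exists_altSetD_eq {m : ℕ} {D : Finset ℕ} (hD : D ⊆ Icc 2 (m + 1)) :
    ∃ J : Finset (Option (Fin (m + 1))), none ∉ J ∧ some 0 ∉ J ∧ altSetD J = D := by
  classical
  obtain ⟨j, h0, hj⟩ := exists_alternating D
  have h1 : ¬j 1 := fun h => by
    have := (hj 0).1 (by tauto)
    have := mem_Icc.1 (hD this)
    omega
  refine ⟨univ.filter fun o => ∃ i : Fin (m + 1), o = some i ∧ j (i + 1), by simp, by simpa, ?_⟩
  have hJ : ∀ k, labelD (univ.filter fun o => ∃ i : Fin (m + 1), o = some i ∧ j (i + 1)) k ↔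
      0 < k ∧ k < m + 2 ∧ j k := fun k => by
    constructor
    · rintro ⟨i, rfl, hi⟩
      exact ⟨by omega, by omega, by simpa using hi⟩
    · rintro ⟨hk, hk1, hk2⟩
      obtain ⟨l, rfl⟩ : ∃ l, k = l + 1 := ⟨k - 1, by omega⟩
      exact ⟨⟨l, by omega⟩, rfl, by simpa using hk2⟩
  ext i
  simp only [altSetD, mem_filter, hJ]
  constructor
  · rintro ⟨hi, h⟩
    rw [mem_Icc] at hi
    obtain ⟨k, rfl⟩ : ∃ k, i = k + 1 := ⟨i - 1, by omega⟩
    rw [← hj]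
    simpa [(by omega : 0 < k), (by omega : k < m + 2), (by omega : k + 1 < m + 2)] using h
  · intro hi
    have h1 := mem_Icc.1 (hD hi)
    obtain ⟨k, rfl⟩ : ∃ k, i = k + 1 := ⟨i - 1, by omega⟩
    refine ⟨hD hi, ?_⟩
    simpa [(by omega : 0 < k), (by omega : k < m + 2), (by omega : k + 1 < m + 2)] using (hj k).2 hi

theorem altSetD_insert_none {m : ℕ} (J : Finset (Option (Fin (m + 1)))) :
    altSetD (insert none J) = altSetD J := by
  simp [altSetD, labelD]

/-- Every `D` arises as an alternation set, so the images contain all sums of `2 ^ |F| P_F` over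
subsets of `D`; triangularity recovers each `P_F`. -/
theorem map_phiHom_descentSpace (n : ℕ) :
    (descentSpace (genB n)).map (phiHom n).toLinearMap = peakSpace n := by
  apply le_antisymm
  · rw [descentSpace, Submodule.map_span_le]
    rintro _ ⟨J, rfl⟩
    rw [AlgHom.toLinearMap_apply, phiHom_elemY]
    exact Submodule.sum_mem _ fun F _ => Submodule.smul_mem _ _ (elemP_mem_peakSpace n F)
  · rw [peakSpace, Submodule.span_le]
    rintro _ ⟨F, hF, rfl⟩
    refine mem_of_sum_powerset_mem (p := elemP n) (fun D hD => ?_) hF.1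
    obtain ⟨J, rfl⟩ := exists_altSet_eq hD
    exact ⟨_, Submodule.subset_span ⟨J, rfl⟩, phiHom_elemY n J⟩

theorem map_psiHom_descentSpace (m : ℕ) :
    (descentSpace (genD m)).map (psiHom (m + 2)).toLinearMap = peakSpace (m + 2) := by
  apply le_antisymm
  · rw [descentSpace, Submodule.map_span_le]
    rintro _ ⟨J, rfl⟩
    rw [AlgHom.toLinearMap_apply]
    by_cases hJ : none ∈ J ↔ some 0 ∈ J
    · rw [psiHom_elemY_of_iff hJ]
      exact Submodule.sum_mem _ fun F _ => Submodule.smul_mem _ _ (elemP_mem_peakSpace _ F)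
    · rw [psiHom_elemY_of_not_iff hJ]
      exact Submodule.sum_mem _ fun F _ => Submodule.smul_mem _ _ (elemP_mem_peakSpace _ _)
  · rw [peakSpace, Submodule.span_le]
    rintro _ ⟨F, hF, rfl⟩
    have hF1 : F.erase 1 ⊆ Icc 2 (m + 1) := fun i hi => by
      obtain ⟨hi1, hi⟩ := mem_erase.1 hi
      have := mem_Icc.1 (hF.1 hi)
      exact mem_Icc.2 (by omega)
    -- Peak sets containing `1` come from label sets with `1'` but not `1`, the others from label
    -- sets with neither.
    by_cases h1 : 1 ∈ F
    · rw [← insert_erase h1]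
      refine mem_of_sum_powerset_mem (p := fun F => elemP (m + 2) (insert 1 F))
        (fun D hD => ?_) hF1
      obtain ⟨J, hJ, hJ0, rfl⟩ := exists_altSetD_eq hD
      refine ⟨_, Submodule.subset_span ⟨insert none J, rfl⟩, ?_⟩
      refine (psiHom_elemY_of_not_iff (J := insert none J) (by simp [hJ0])).trans ?_
      rw [altSetD_insert_none]
      rfl
    · rw [← erase_eq_of_notMem h1]
      refine mem_of_sum_powerset_mem (p := elemP (m + 2)) (fun D hD => ?_) hF1
      obtain ⟨J, hJ, hJ0, rfl⟩ := exists_altSetD_eq hD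
      exact ⟨_, Submodule.subset_span ⟨J, rfl⟩, psiHom_elemY_of_iff (by simp [hJ, hJ0])⟩

/-! ### The peak ideal -/

theorem interiorPeakSet_eq {n : ℕ} (σ : Equiv.Perm (Fin n)) :
    interiorPeakSet σ = (peakSet σ).erase 1 := by
  ext i
  simp only [interiorPeakSet, peakSet, mem_erase, mem_filter, mem_Icc]
  have : i ≠ 1 ∧ 1 ≤ i ↔ 2 ≤ i := by omega
  rw [← this]
  tauto

/-- The interior peaks determine the peak set up to the element `1`. -/
theorem elemPInt_eq {n : ℕ} {F : Finset ℕ} (h : 1 ∉ F) :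
    elemPInt n F = elemP n F + elemP n (insert 1 F) := by
  rw [elemPInt, elemP, elemP, ← Finset.sum_union]
  · refine Finset.sum_congr ?_ fun _ _ => rfl
    ext σ
    simp only [mem_union, mem_filter, mem_univ, true_and, interiorPeakSet_eq]
    constructor
    · rintro rfl
      by_cases h1 : 1 ∈ peakSet σ
      · exact Or.inr (insert_erase h1).symm
      · exact Or.inl (erase_eq_of_notMem h1).symm
    · rintro (h2 | h2) <;> rw [h2]
      · exact erase_eq_of_notMem h
      · exact erase_insert h
  · rw [Finset.disjoint_left]
    intro σ h1 h2
    simp only [mem_filter, mem_univ, true_and] at h1 h2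
    rw [h1] at h2
    exact h (h2 ▸ mem_insert_self 1 F)

/-- `X_{K ∪ {1'}}` is the sum of `Y_I + Y_{I ∪ {1'}}` over `I ⊆ K`; by induction every term with `I
≠ K` already lies in the ideal. -/
theorem elemY_add_elemY_mem_canonicalIdealD {m : ℕ} {K : Finset (Option (Fin (m + 1)))}
    (hK : none ∉ K) :
    elemY (genD m) K + elemY (genD m) (insert none K) ∈ canonicalIdealD m := by
  induction K using Finset.strongInduction with
  | H K ih =>
    have h1 : elemX (genD m) (insert none K) ∈ canonicalIdealD m :=
      Submodule.subset_span ⟨_, Or.inl (mem_insert_self _ _), rfl⟩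
    rw [elemX, Finset.sum_powerset_insert hK, ← Finset.sum_add_distrib,
      ← Finset.insert_erase (Finset.mem_powerset_self K),
      Finset.sum_insert (Finset.notMem_erase _ _)] at h1
    refine (Submodule.add_mem_iff_left _ (Submodule.sum_mem _ fun I hI => ?_)).1 h1
    have hI' := Finset.mem_ssubsets.1 hI
    exact ih I hI' fun h => hK (hI'.1 h)

/-- For `J` without `1, 1'`, the images of `Y_J` and `Y_{J ∪ {1'}}` add `P_G` to `P_{G ∪ {1}}`,
which is an interior peak sum. Triangularity then reaches each generator. -/
theorem peakIdeal_le_map_psiHom (m : ℕ) :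
    peakIdeal (m + 2) ≤ (canonicalIdealD m).map (psiHom (m + 2)).toLinearMap := by
  rw [peakIdeal, Submodule.span_le]
  rintro _ ⟨F, hF, h1, rfl⟩
  have hF1 : F ⊆ Icc 2 (m + 1) := fun i hi => by
    have := mem_Icc.1 (hF.1 hi)
    have : i ≠ 1 := by rintro rfl; exact h1 hi
    exact mem_Icc.2 (by omega)
  refine mem_of_sum_powerset_mem (p := elemPInt (m + 2)) (fun D hD => ?_) hF1
  obtain ⟨J, hJ, hJ0, rfl⟩ := exists_altSetD_eq hD
  refine ⟨_, elemY_add_elemY_mem_canonicalIdealD hJ, ?_⟩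
  rw [AlgHom.toLinearMap_apply, map_add, psiHom_elemY_of_iff (by simp [hJ, hJ0]),
    psiHom_elemY_of_not_iff (by simp [hJ0]), altSetD_insert_none, elemQ, elemQ',
    ← Finset.sum_add_distrib]
  refine Finset.sum_congr rfl fun G hG => ?_
  rw [elemPInt_eq, smul_add]
  exact fun h => one_notMem_altSetD J (mem_powerset.1 hG h)

/-- The shift `G + 2` of a set of natural numbers. -/
def addTwo (G : Finset ℕ) : Finset ℕ := G.map (addRightEmbedding 2)

theorem mem_addTwo {G : Finset ℕ} {i : ℕ} : i + 2 ∈ addTwo G ↔ i ∈ G := by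
  simp [addTwo]

theorem two_lt_of_mem_addTwo {n : ℕ} {G : Finset ℕ} (hG : G ⊆ Icc 1 n) {i : ℕ}
    (hi : i ∈ addTwo G) : 2 < i := by
  obtain ⟨k, hk, rfl⟩ := Finset.mem_map.1 hi
  have := mem_Icc.1 (hG hk)
  simp only [addRightEmbedding_apply]
  omega

theorem image_sub_addTwo (G : Finset ℕ) : (addTwo G).image (· - 2) = G := by
  ext i
  simp [addTwo]

theorem card_addTwo (G : Finset ℕ) : (addTwo G).card = G.card := Finset.card_map _

theorem exists_eq_addTwo {m : ℕ} {F : Finset ℕ} (hF : F ⊆ Icc 2 (m + 1)) (h2 : 2 ∉ F) :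
    ∃ G ⊆ Icc 1 (m - 1), F = addTwo G := by
  refine ⟨F.image (· - 2), fun i hi => ?_, ?_⟩
  · obtain ⟨k, hk, rfl⟩ := Finset.mem_image.1 hi
    have := mem_Icc.1 (hF hk)
    have : k ≠ 2 := by rintro rfl; exact h2 hk
    exact mem_Icc.2 (by omega)
  · ext i
    simp only [addTwo, Finset.mem_map, Finset.mem_image, addRightEmbedding_apply]
    constructor
    · intro hi
      have := mem_Icc.1 (hF hi)
      exact ⟨i - 2, ⟨i, hi, rfl⟩, by omega⟩
    · rintro ⟨_, ⟨k, hk, rfl⟩, rfl⟩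
      have := mem_Icc.1 (hF hk)
      rwa [Nat.sub_add_cancel this.1]

theorem isPeakIndex_addTwo {m : ℕ} {G : Finset ℕ} (hG : G ⊆ Icc 1 (m - 1)) :
    IsPeakIndex (m + 2) (addTwo G) ↔ IsPeakIndex m G := by
  constructor
  · rintro ⟨_, h⟩
    refine ⟨hG, fun i hi hi1 => h (i + 2) (mem_addTwo.2 hi) ?_⟩
    rw [add_right_comm]
    exact mem_addTwo.2 hi1
  · rintro ⟨_, h⟩
    refine ⟨fun i hi => ?_, fun i hi hi1 => ?_⟩
    · obtain ⟨k, hk, rfl⟩ := Finset.mem_map.1 hi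
      have := mem_Icc.1 (hG hk)
      exact mem_Icc.2 (by simp only [addRightEmbedding_apply]; omega)
    · obtain ⟨k, hk, rfl⟩ := Finset.mem_map.1 hi
      rw [addRightEmbedding_apply, add_right_comm] at hi1
      exact h k hk (mem_addTwo.1 hi1)

theorem isPeakIndex_insert_one_addTwo {m : ℕ} {G : Finset ℕ} (hG : G ⊆ Icc 1 (m - 1)) :
    IsPeakIndex (m + 2) (insert 1 (addTwo G)) ↔ IsPeakIndex m G := by
  rw [← isPeakIndex_addTwo hG]
  constructor
  · rintro ⟨h1, h2⟩
    exact ⟨(subset_insert _ _).trans h1, fun i hi h =>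
      h2 i (mem_insert_of_mem hi) (mem_insert_of_mem h)⟩
  · rintro ⟨h1, h2⟩
    refine ⟨insert_subset (mem_Icc.2 (by omega)) h1, fun i hi h => ?_⟩
    rcases mem_insert.1 hi with rfl | hi <;> rcases mem_insert.1 h with h | h
    · omega
    · exact absurd (two_lt_of_mem_addTwo hG h) (by omega)
    · exact absurd (two_lt_of_mem_addTwo hG hi) (by omega)
    · exact h2 i hi h

/-! ### Values of `π` on peak sums with shifted peak sets. -/

section

variable {m : ℕ} {q : MonoidAlgebra ℚ (Equiv.Perm (Fin (m + 2))) →ₗ[ℚ]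
  MonoidAlgebra ℚ (Equiv.Perm (Fin m))}

theorem map_elemP_addTwo (hq : ∀ F, IsPeakIndex (m + 2) F → q (elemP (m + 2) F) = piValue m F)
    {G : Finset ℕ} (hG : G ⊆ Icc 1 (m - 1)) :
    q (elemP (m + 2) (addTwo G)) = elemP m G := by
  by_cases h : IsPeakIndex m G
  · have h1 : 1 ∉ addTwo G := fun h => absurd (two_lt_of_mem_addTwo hG h) (by omega)
    have h2 : 2 ∉ addTwo G := fun h => absurd (two_lt_of_mem_addTwo hG h) (by omega)
    rw [hq _ ((isPeakIndex_addTwo hG).2 h), piValue, if_neg h1, if_neg h2, image_sub_addTwo]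
  · rw [elemP_eq_zero h, elemP_eq_zero fun hn => h ((isPeakIndex_addTwo hG).1 hn), map_zero]

theorem map_elemP_insert_one_addTwo
    (hq : ∀ F, IsPeakIndex (m + 2) F → q (elemP (m + 2) F) = piValue m F)
    {G : Finset ℕ} (hG : G ⊆ Icc 1 (m - 1)) :
    q (elemP (m + 2) (insert 1 (addTwo G))) = -elemP m G := by
  by_cases h : IsPeakIndex m G
  · have h1 : 1 ∉ addTwo G := fun h => absurd (two_lt_of_mem_addTwo hG h) (by omega)
    rw [hq _ ((isPeakIndex_insert_one_addTwo hG).2 h), piValue, if_pos (mem_insert_self _ _),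
      erase_insert h1, image_sub_addTwo]
  · rw [elemP_eq_zero h, elemP_eq_zero fun hn => h ((isPeakIndex_insert_one_addTwo hG).1 hn),
      map_zero, neg_zero]

theorem map_elemP_of_two_mem
    (hq : ∀ F, IsPeakIndex (m + 2) F → q (elemP (m + 2) F) = piValue m F)
    {F : Finset ℕ} (h1 : 1 ∉ F) (h2 : 2 ∈ F) : q (elemP (m + 2) F) = 0 := by
  by_cases h : IsPeakIndex (m + 2) F
  · rw [hq F h, piValue, if_neg h1, if_pos h2]
  · rw [elemP_eq_zero h, map_zero]

end

theorem elemP_insert_one_of_two_mem {n : ℕ} {F : Finset ℕ} (h2 : 2 ∈ F) :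
    elemP n (insert 1 F) = 0 :=
  elemP_eq_zero fun h => h.2 1 (mem_insert_self _ _) (mem_insert_of_mem h2)

/-- Only the subsets avoiding `2` contribute, and these are the shifts of the subsets of `B`. -/
theorem sum_powerset_eq_sum_addTwo {M : Type*} [AddCommGroup M] [Module ℚ M] {f : Finset ℕ → M}
    {A B : Finset ℕ} (hf : ∀ F ⊆ A, 2 ∈ F → f F = 0) (hAB : A.erase 2 = addTwo B) :
    ∑ F ∈ A.powerset, (2 : ℚ) ^ F.card • f F =
      ∑ G ∈ B.powerset, (2 : ℚ) ^ G.card • f (addTwo G) := by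
  have hB : ∀ G, addTwo G ⊆ addTwo B ↔ G ⊆ B := fun G => Finset.map_subset_map
  symm
  refine Finset.sum_of_injOn addTwo (Finset.map_injective _).injOn ?_ ?_ ?_
  · intro G hG
    rw [mem_coe, mem_powerset] at hG ⊢
    exact ((hB G).2 hG).trans (hAB ▸ erase_subset _ _)
  · intro F hF hn
    by_cases h2 : 2 ∈ F
    · rw [hf F (mem_powerset.1 hF) h2, smul_zero]
    · refine absurd ?_ hn
      have h3 : F ⊆ addTwo B := by
        rw [← hAB]
        exact subset_erase.2 ⟨mem_powerset.1 hF, h2⟩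
      obtain ⟨G, hG, rfl⟩ := Finset.subset_map_iff.1 h3
      exact ⟨G, by simpa using hG, rfl⟩
  · intro G _
    rw [card_addTwo]

theorem labelD_add_two {m : ℕ} (J : Finset (Option (Fin (m + 1)))) (k : ℕ) :
    labelD J (k + 2) ↔ natLabel (shiftD J) k := by
  constructor
  · rintro ⟨i, hi, h⟩
    have hk : k < m := by omega
    have : (⟨k, hk⟩ : Fin m).succ = i := Fin.ext (by rw [Fin.val_succ]; simp only; omega)
    exact ⟨hk, mem_shiftD.2 (by rwa [this])⟩
  · rintro ⟨hk, h⟩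
    exact ⟨⟨k + 1, by omega⟩, rfl, mem_shiftD.1 h⟩

/-- Position `i` compares labels `i - 1` and `i`. From position `3` on these are labels at least
`2`, which survive in `J - 2`; position `2` involves the lost label `1`. -/
theorem altSetD_erase_two {m : ℕ} (J : Finset (Option (Fin (m + 1)))) :
    (altSetD J).erase 2 = addTwo (altSet m (natLabel (shiftD J))) := by
  ext i
  constructor
  · intro hi
    obtain ⟨hi2, hi⟩ := mem_erase.1 hi
    obtain ⟨hi1, h⟩ := mem_filter.1 hi
    rw [mem_Icc] at hi1
    obtain ⟨k, rfl⟩ : ∃ k, i = k + 1 + 2 := ⟨i - 3, by omega⟩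
    rw [mem_addTwo]
    refine mem_filter.2 ⟨mem_Icc.2 (by omega), ?_⟩
    rw [← labelD_add_two, ← labelD_add_two]
    exact h
  · intro hi
    obtain ⟨k, hk, rfl⟩ := Finset.mem_map.1 hi
    obtain ⟨hk1, h⟩ := mem_filter.1 hk
    rw [mem_Icc] at hk1
    obtain ⟨k, rfl⟩ : ∃ l, k = l + 1 := ⟨k - 1, by omega⟩
    rw [← labelD_add_two, ← labelD_add_two] at h
    rw [addRightEmbedding_apply]
    exact mem_erase.2 ⟨by omega, mem_filter.2 ⟨mem_Icc.2 (by omega), h⟩⟩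

/-! ### The morphisms and the diagram -/

/-- The sign `(-1) ^ |J ∩ {1', 1}|`. -/
def labelSign {m : ℕ} (J : Finset (Option (Fin (m + 1)))) : ℚ :=
  (if none ∈ J then -1 else 1) * (if some 0 ∈ J then -1 else 1)

theorem shiftD_insert {m : ℕ} {J : Finset (Option (Fin (m + 1)))} {a : Option (Fin (m + 1))}
    (ha : a = none ∨ a = some 0) : shiftD (insert a J) = shiftD J := by
  ext k
  rcases ha with rfl | rfl <;> simp [mem_shiftD, Fin.succ_ne_zero]

theorem labelSign_insert {m : ℕ} {J : Finset (Option (Fin (m + 1)))} {a : Option (Fin (m + 1))}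
    (ha : a = none ∨ a = some 0) (h : a ∉ J) : labelSign (insert a J) = -labelSign J := by
  rcases ha with rfl | rfl
  · simp only [labelSign, mem_insert_self, if_true, h, if_false, mem_insert, reduceCtorEq, false_or,
      neg_mul]
  · simp only [labelSign, mem_insert_self, if_true, h, if_false, mem_insert, reduceCtorEq, false_or,
      mul_neg]

/-- If `1'` or `1` is in `J`, toggling it in `I` reverses the sign and keeps `I - 2`, so the sum
cancels. -/
theorem sum_powerset_labelSign {m : ℕ} (J : Finset (Option (Fin (m + 1)))) :
    ∑ I ∈ J.powerset, labelSign I • elemY (genB m) (shiftD I) = gammaValue m J := by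
  have key : ∀ a : Option (Fin (m + 1)), (a = none ∨ a = some 0) → a ∈ J →
      ∑ I ∈ J.powerset, labelSign I • elemY (genB m) (shiftD I) = 0 := by
    intro a ha haJ
    rw [← insert_erase haJ, Finset.sum_powerset_insert (notMem_erase _ _),
      ← Finset.sum_add_distrib]
    refine Finset.sum_eq_zero fun I hI => ?_
    have : a ∉ I := fun h => notMem_erase a J (mem_powerset.1 hI h)
    rw [labelSign_insert ha this, shiftD_insert ha, neg_smul, add_neg_cancel]
  by_cases hJ : none ∈ J ∨ some 0 ∈ J
  · rw [gammaValue_of_mem hJ]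
    rcases hJ with h | h
    · exact key none (Or.inl rfl) h
    · exact key (some 0) (Or.inr rfl) h
  · rw [gammaValue_of_notMem hJ, elemX]
    rw [not_or] at hJ
    refine Finset.sum_bij (fun I _ => shiftD I) ?_ ?_ ?_ ?_
    · intro I hI
      rw [mem_powerset] at hI ⊢
      exact fun k hk => mem_shiftD.2 (hI (mem_shiftD.1 hk))
    · intro I hI K hK h
      rw [mem_powerset] at hI hK
      exact eq_of_shiftD_eq (fun h => hJ.1 (hI h)) (fun h => hJ.2 (hI h))
        (fun h => hJ.1 (hK h)) (fun h => hJ.2 (hK h)) h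
    · intro K hK
      rw [mem_powerset] at hK
      refine ⟨K.image fun k => some k.succ, ?_, ?_⟩
      · rw [mem_powerset]
        intro i hi
        obtain ⟨k, hk, rfl⟩ := Finset.mem_image.1 hi
        exact mem_shiftD.1 (hK hk)
      · ext k
        simp [mem_shiftD]
    · intro I hI
      rw [mem_powerset] at hI
      have h1 : none ∉ I := fun h => hJ.1 (hI h)
      have h2 : some 0 ∉ I := fun h => hJ.2 (hI h)
      simp [labelSign, h1, h2]

/-- Both descriptions are needed: the values on the `X_J` give multiplicativity and the kernel,
those on the `Y_J` give compatibility with forgetting signs. -/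
theorem exists_gamma (m : ℕ) :
    ∃ Γ : MonoidAlgebra ℚ (evenSigned (m + 2)) →ₗ[ℚ] MonoidAlgebra ℚ (SignedPerm m),
      (∀ J, Γ (elemX (genD m) J) = gammaValue m J) ∧
      ∀ J, Γ (elemY (genD m) J) = labelSign J • elemY (genB m) (shiftD J) := by
  obtain ⟨Γ, hΓ⟩ := exists_linearMap_classSum (descentSet (genD m))
    fun J => labelSign J • elemY (genB m) (shiftD J)
  have hY : ∀ J, Γ (elemY (genD m) J) = labelSign J • elemY (genB m) (shiftD J) := fun J =>
    hΓ J ((frameD m).exists_descentSet_eq J)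
  refine ⟨Γ, fun J => ?_, hY⟩
  rw [elemX, map_sum, ← sum_powerset_labelSign]
  exact Finset.sum_congr rfl fun I _ => hY I

/-! ### Compatibility with forgetting signs, multiplicativity of `γ`, and kernels of `γ` and `π`. -/

section

variable {m : ℕ} {Γ : MonoidAlgebra ℚ (evenSigned (m + 2)) →ₗ[ℚ] MonoidAlgebra ℚ (SignedPerm m)}
  {q : MonoidAlgebra ℚ (Equiv.Perm (Fin (m + 2))) →ₗ[ℚ] MonoidAlgebra ℚ (Equiv.Perm (Fin m))}

theorem map_elemQ_altSetD
    (hq : ∀ F, IsPeakIndex (m + 2) F → q (elemP (m + 2) F) = piValue m F)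
    (J : Finset (Option (Fin (m + 1)))) :
    q (elemQ (m + 2) (altSetD J)) = elemQ m (altSet m (natLabel (shiftD J))) := by
  rw [elemQ, map_sum]
  simp only [map_smul]
  rw [sum_powerset_eq_sum_addTwo (f := fun F => q (elemP (m + 2) F)) _ (altSetD_erase_two J)]
  · refine Finset.sum_congr rfl fun G hG => ?_
    rw [map_elemP_addTwo hq ((mem_powerset.1 hG).trans (filter_subset _ _))]
  · exact fun F hF h2 => map_elemP_of_two_mem hq (fun h => one_notMem_altSetD J (hF h)) h2

theorem map_elemQ'_altSetD
    (hq : ∀ F, IsPeakIndex (m + 2) F → q (elemP (m + 2) F) = piValue m F)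
    (J : Finset (Option (Fin (m + 1)))) :
    q (elemQ' (m + 2) (altSetD J)) = -elemQ m (altSet m (natLabel (shiftD J))) := by
  rw [elemQ', map_sum]
  simp only [map_smul]
  rw [sum_powerset_eq_sum_addTwo (f := fun F => q (elemP (m + 2) (insert 1 F))) _
    (altSetD_erase_two J), elemQ, ← Finset.sum_neg_distrib]
  · refine Finset.sum_congr rfl fun G hG => ?_
    rw [map_elemP_insert_one_addTwo hq ((mem_powerset.1 hG).trans (filter_subset _ _)), smul_neg]
  · intro F _ h2
    rw [elemP_insert_one_of_two_mem h2, map_zero]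

/-- It suffices to compare on `Y_J`: the sign of `γ(Y_J)` is `-1` exactly when one of `1, 1'` is in
`J`, which is when `ψ(Y_J)` involves the `P_{F ∪ {1}}` that `π` negates. -/
theorem phiHom_gamma_eq
    (hΓ : ∀ J, Γ (elemY (genD m) J) = labelSign J • elemY (genB m) (shiftD J))
    (hq : ∀ F, IsPeakIndex (m + 2) F → q (elemP (m + 2) F) = piValue m F)
    {a : MonoidAlgebra ℚ (evenSigned (m + 2))} (ha : a ∈ descentSpace (genD m)) :
    phiHom m (Γ a) = q (psiHom (m + 2) a) := by
  induction ha using Submodule.span_induction with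
  | mem x hx =>
    obtain ⟨J, rfl⟩ := hx
    rw [hΓ, map_smul, phiHom_elemY]
    by_cases hJ : none ∈ J ↔ some 0 ∈ J
    · have : labelSign J = 1 := by
        by_cases h : some 0 ∈ J <;> simp [labelSign, hJ, h]
      rw [psiHom_elemY_of_iff hJ, map_elemQ_altSetD hq, this, one_smul]
    · have : labelSign J = -1 := by
        by_cases h : some 0 ∈ J <;> by_cases h' : none ∈ J <;> simp [labelSign, h, h'] at hJ ⊢
      rw [psiHom_elemY_of_not_iff hJ, map_elemQ'_altSetD hq, this, neg_one_smul]
  | zero => simp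
  | add x y _ _ hx hy => simp only [map_add, hx, hy]
  | smul c x _ hx => simp only [map_smul, hx]

theorem gamma_mul (hΓ : ∀ J, Γ (elemX (genD m) J) = gammaValue m J)
    {a b : MonoidAlgebra ℚ (evenSigned (m + 2))} (ha : a ∈ descentSpace (genD m))
    (hb : b ∈ descentSpace (genD m)) : Γ (a * b) = Γ a * Γ b := by
  rw [descentSpace_eq_span_elemX] at ha hb
  induction ha, hb using Submodule.span_induction₂ with
  | mem_mem x y hx hy =>
    obtain ⟨I, rfl⟩ := hx
    obtain ⟨J, rfl⟩ := hy
    exact map_elemX_mul_elemX hΓ I J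
  | zero_left => simp
  | zero_right => simp
  | add_left x y z _ _ _ h1 h2 => simp only [add_mul, map_add, h1, h2]
  | add_right x y z _ _ _ h1 h2 => simp only [mul_add, map_add, h1, h2]
  | smul_left r x y _ _ h => simp only [smul_mul_assoc, map_smul, h]
  | smul_right r x y _ _ h => simp only [mul_smul_comm, map_smul, h]

theorem gammaValue_mem_descentSpace (J : Finset (Option (Fin (m + 1)))) :
    gammaValue m J ∈ descentSpace (genB m) := by
  unfold gammaValue
  split_ifs
  · exact zero_mem _
  · exact elemX_mem_descentSpace _ _

theorem gamma_mem (hΓ : ∀ J, Γ (elemX (genD m) J) = gammaValue m J)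
    {a : MonoidAlgebra ℚ (evenSigned (m + 2))} (ha : a ∈ descentSpace (genD m)) :
    Γ a ∈ descentSpace (genB m) := by
  rw [descentSpace_eq_span_elemX (genD m)] at ha
  induction ha using Submodule.span_induction with
  | mem x hx =>
    obtain ⟨J, rfl⟩ := hx
    rw [hΓ]
    exact gammaValue_mem_descentSpace J
  | zero => rw [map_zero]; exact zero_mem _
  | add x y _ _ hx hy => rw [map_add]; exact add_mem hx hy
  | smul c x _ hx => rw [map_smul]; exact Submodule.smul_mem _ c hx

theorem gammaValue_empty (m : ℕ) : gammaValue m ∅ = 1 := by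
  rw [gammaValue_of_notMem (by simp), ← (frameB m).elemX_empty]
  congr 1
  simp [shiftD]

theorem gamma_one (hΓ : ∀ J, Γ (elemX (genD m) J) = gammaValue m J) : Γ 1 = 1 := by
  rw [← (frameD m).elemX_empty, hΓ, gammaValue_empty]

theorem canonicalIdealD_le (m : ℕ) : canonicalIdealD m ≤ descentSpace (genD m) := by
  rw [canonicalIdealD, Submodule.span_le]
  rintro _ ⟨J, -, rfl⟩
  exact elemX_mem_descentSpace _ J

/-- The shift `K + 2` of a set of labels. -/
def unshiftD (K : Finset (Fin m)) : Finset (Option (Fin (m + 1))) :=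
  K.image fun k => some k.succ

theorem none_notMem_unshiftD (K : Finset (Fin m)) : none ∉ unshiftD K := by simp [unshiftD]

theorem zero_notMem_unshiftD (K : Finset (Fin m)) : some 0 ∉ unshiftD K := by
  simp [unshiftD, Fin.succ_ne_zero]

theorem shiftD_unshiftD (K : Finset (Fin m)) : shiftD (unshiftD K) = K := by
  ext k
  simp [mem_shiftD, unshiftD]

theorem gammaValue_unshiftD (K : Finset (Fin m)) :
    gammaValue m (unshiftD K) = elemX (genB m) K := by
  rw [gammaValue_of_notMem (by simp [none_notMem_unshiftD, zero_notMem_unshiftD]),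
    shiftD_unshiftD]

theorem mem_canonicalIdealD_iff (hΓ : ∀ J, Γ (elemX (genD m) J) = gammaValue m J)
    {a : MonoidAlgebra ℚ (evenSigned (m + 2))} (ha : a ∈ descentSpace (genD m)) :
    a ∈ canonicalIdealD m ↔ Γ a = 0 := by
  constructor
  · intro h
    induction h using Submodule.span_induction with
    | mem x hx =>
      obtain ⟨J, hJ, rfl⟩ := hx
      rw [hΓ, gammaValue_of_mem hJ]
    | zero => exact map_zero _
    | add x y hx hy ihx ihy =>
      rw [map_add, ihx (canonicalIdealD_le m hx), ihy (canonicalIdealD_le m hy), add_zero]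
    | smul c x hx ihx => rw [map_smul, ihx (canonicalIdealD_le m hx), smul_zero]
  · intro h
    -- A linear section `X_K ↦ X_{K+2}` of `Γ`. The difference `a - δ (Γ a)` is `X_J` or `0` on a
    -- generator `X_J`, according to whether `J` meets `{1', 1}`.
    obtain ⟨δ, hδ⟩ := (frameB m).exists_linearMap_elemX fun K => elemX (genD m) (unshiftD K)
    suffices a - δ (Γ a) ∈ canonicalIdealD m by rwa [h, map_zero, sub_zero] at this
    clear h
    rw [descentSpace_eq_span_elemX (genD m)] at ha
    induction ha using Submodule.span_induction with
    | mem x hx =>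
      obtain ⟨J, rfl⟩ := hx
      rw [hΓ]
      by_cases hJ : none ∈ J ∨ some 0 ∈ J
      · rw [gammaValue_of_mem hJ, map_zero, sub_zero]
        exact Submodule.subset_span ⟨J, hJ, rfl⟩
      · rw [gammaValue_of_notMem hJ, hδ]
        rw [not_or] at hJ
        rw [eq_of_shiftD_eq (none_notMem_unshiftD _) (zero_notMem_unshiftD _) hJ.1 hJ.2
          (shiftD_unshiftD (shiftD J)), sub_self]
        exact zero_mem _
    | zero => simp
    | add x y _ _ hx hy =>
      rw [map_add, map_add, add_sub_add_comm]
      exact add_mem hx hy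
    | smul c x _ hx =>
      rw [map_smul, map_smul, ← smul_sub]
      exact Submodule.smul_mem _ c hx

theorem exists_gamma_eq (hΓ : ∀ J, Γ (elemX (genD m) J) = gammaValue m J)
    {b : MonoidAlgebra ℚ (SignedPerm m)} (hb : b ∈ descentSpace (genB m)) :
    ∃ a ∈ descentSpace (genD m), Γ a = b := by
  suffices h : descentSpace (genB m) ≤ (descentSpace (genD m)).map Γ from h hb
  rw [descentSpace_eq_span_elemX (genB m), Submodule.span_le]
  rintro _ ⟨K, rfl⟩
  exact ⟨_, elemX_mem_descentSpace _ (unshiftD K), by rw [hΓ, gammaValue_unshiftD]⟩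

theorem peakIdeal_le (n : ℕ) : peakIdeal n ≤ peakSpace n := by
  rw [peakIdeal, Submodule.span_le]
  rintro _ ⟨F, -, h1, rfl⟩
  rw [elemPInt_eq h1]
  exact add_mem (elemP_mem_peakSpace n _) (elemP_mem_peakSpace n _)

theorem subset_Icc_two {F : Finset ℕ} (hF : IsPeakIndex (m + 2) F) (h1 : 1 ∉ F) :
    F ⊆ Icc 2 (m + 1) := fun i hi => by
  have := mem_Icc.1 (hF.1 hi)
  have : i ≠ 1 := by rintro rfl; exact h1 hi
  exact mem_Icc.2 (by omega)

theorem mem_peakIdeal_iff (hq : ∀ F, IsPeakIndex (m + 2) F → q (elemP (m + 2) F) = piValue m F)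
    {a : MonoidAlgebra ℚ (Equiv.Perm (Fin (m + 2)))} (ha : a ∈ peakSpace (m + 2)) :
    a ∈ peakIdeal (m + 2) ↔ q a = 0 := by
  constructor
  · intro h
    induction h using Submodule.span_induction with
    | mem x hx =>
      obtain ⟨F, hF, h1, rfl⟩ := hx
      rw [elemPInt_eq h1, map_add]
      by_cases h2 : 2 ∈ F
      · rw [map_elemP_of_two_mem hq h1 h2, elemP_insert_one_of_two_mem h2, map_zero, add_zero]
      · obtain ⟨G, hG, rfl⟩ := exists_eq_addTwo (subset_Icc_two hF h1) h2
        rw [map_elemP_addTwo hq hG, map_elemP_insert_one_addTwo hq hG, add_neg_cancel]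
    | zero => exact map_zero _
    | add x y hx hy ihx ihy =>
      rw [map_add, ihx (peakIdeal_le _ hx), ihy (peakIdeal_le _ hy), add_zero]
    | smul c x hx ihx => rw [map_smul, ihx (peakIdeal_le _ hx), smul_zero]
  · intro h
    -- A linear section `P_G ↦ P_{G+2}` of `q`. On a generator `P_F` the difference `a - δ (q a)` is
    -- an interior peak sum: `P_F + P_{F ∖ {1}}` if `1 ∈ F`, `P_F` itself if `2 ∈ F`, and `0`
    -- otherwise.
    obtain ⟨δ, hδ⟩ := exists_linearMap_elemP (n := m) fun G => elemP (m + 2) (addTwo G)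
    suffices a - δ (q a) ∈ peakIdeal (m + 2) by rwa [h, map_zero, sub_zero] at this
    clear h
    induction ha using Submodule.span_induction with
    | mem x hx =>
      obtain ⟨F, hF, rfl⟩ := hx
      by_cases h1 : 1 ∈ F
      · have hF' : IsPeakIndex (m + 2) (F.erase 1) :=
          ⟨(erase_subset _ _).trans hF.1, fun i hi h =>
            hF.2 i (mem_of_mem_erase hi) (mem_of_mem_erase h)⟩
        have h2 : 2 ∉ F.erase 1 := fun h => hF.2 1 h1 (mem_of_mem_erase h)
        obtain ⟨G, hG, hFG⟩ := exists_eq_addTwo (subset_Icc_two hF' (notMem_erase _ _)) h2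
        have hG' := (isPeakIndex_addTwo hG).1 (hFG ▸ hF')
        have hG1 : 1 ∉ addTwo G := hFG ▸ notMem_erase 1 F
        rw [← insert_erase h1, hFG, map_elemP_insert_one_addTwo hq hG, map_neg, hδ G hG',
          sub_neg_eq_add, add_comm (elemP _ _), ← elemPInt_eq hG1]
        exact Submodule.subset_span ⟨_, hFG ▸ hF', hG1, rfl⟩
      · by_cases h2 : 2 ∈ F
        · rw [map_elemP_of_two_mem hq h1 h2, map_zero, sub_zero]
          refine Submodule.subset_span ⟨F, hF, h1, ?_⟩
          rw [elemPInt_eq h1, elemP_insert_one_of_two_mem h2, add_zero]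
        · obtain ⟨G, hG, rfl⟩ := exists_eq_addTwo (subset_Icc_two hF h1) h2
          rw [map_elemP_addTwo hq hG, hδ G ((isPeakIndex_addTwo hG).1 hF), sub_self]
          exact zero_mem _
    | zero => simp
    | add x y _ _ hx hy =>
      rw [map_add, map_add, add_sub_add_comm]
      exact add_mem hx hy
    | smul c x _ hx =>
      rw [map_smul, map_smul, ← smul_sub]
      exact Submodule.smul_mem _ c hx

end

/-- Restriction of a linear map to an algebra morphism between subalgebras. -/
noncomputable def restrictAlgHom {A B : Type*} [Ring A] [Ring B] [Algebra ℚ A] [Algebra ℚ B]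
    (S : Subalgebra ℚ A) (T : Subalgebra ℚ B) (f : A →ₗ[ℚ] B) (hmem : ∀ a ∈ S, f a ∈ T)
    (hone : f 1 = 1) (hmul : ∀ a ∈ S, ∀ b ∈ S, f (a * b) = f a * f b) : S →ₐ[ℚ] T :=
  AlgHom.ofLinearMap
    (f.restrict (p := Subalgebra.toSubmodule S) (q := Subalgebra.toSubmodule T) hmem)
    (Subtype.ext hone) fun a b => Subtype.ext (hmul a a.2 b b.2)

end PeakDescent

/-! ### The commutative diagram with exact rows. -/

theorem mainTheorem5 (m : ℕ) :
    ∃ (SolD : Subalgebra ℚ (MonoidAlgebra ℚ (PeakDescent.evenSigned (m + 2))))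
      (SolB : Subalgebra ℚ (MonoidAlgebra ℚ (PeakDescent.SignedPerm m)))
      (P : Subalgebra ℚ (MonoidAlgebra ℚ (Equiv.Perm (Fin (m + 2)))))
      (P' : Subalgebra ℚ (MonoidAlgebra ℚ (Equiv.Perm (Fin m)))),
      -- the descent algebras and the peak algebras
      Subalgebra.toSubmodule SolD = PeakDescent.descentSpace (PeakDescent.genD m) ∧
      Subalgebra.toSubmodule SolB = PeakDescent.descentSpace (PeakDescent.genB m) ∧
      Subalgebra.toSubmodule P = PeakDescent.peakSpace (m + 2) ∧
      Subalgebra.toSubmodule P' = PeakDescent.peakSpace m ∧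
      ∃ (incD : PeakDescent.canonicalIdealD m →ₗ[ℚ] SolD)
        (γ : SolD →ₐ[ℚ] SolB)
        (incP : PeakDescent.peakIdeal (m + 2) →ₗ[ℚ] P)
        (π : P →ₐ[ℚ] P')
        (ψI : PeakDescent.canonicalIdealD m →ₗ[ℚ] PeakDescent.peakIdeal (m + 2))
        (ψ : SolD →ₐ[ℚ] P)
        (φ : SolB →ₐ[ℚ] P'),
        -- `incD` and `incP` are the inclusions
        (∀ x, (incD x : MonoidAlgebra ℚ (PeakDescent.evenSigned (m + 2))) = x) ∧
        (∀ x, (incP x : MonoidAlgebra ℚ (Equiv.Perm (Fin (m + 2)))) = x) ∧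
        -- `γ` and `π` have the prescribed values on the `X_J` and on the `P_F`
        (∀ J : Finset (Option (Fin (m + 1))), ∃ x : SolD,
          (x : MonoidAlgebra ℚ (PeakDescent.evenSigned (m + 2))) =
              PeakDescent.elemX (PeakDescent.genD m) J ∧
            (γ x : MonoidAlgebra ℚ (PeakDescent.SignedPerm m)) = PeakDescent.gammaValue m J) ∧
        (∀ F : Finset ℕ, PeakDescent.IsPeakIndex (m + 2) F → ∃ x : P,
          (x : MonoidAlgebra ℚ (Equiv.Perm (Fin (m + 2)))) = PeakDescent.elemP (m + 2) F ∧
            (π x : MonoidAlgebra ℚ (Equiv.Perm (Fin m))) = PeakDescent.piValue m F) ∧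
        -- the vertical maps forget the signs
        (∀ x, (ψI x : MonoidAlgebra ℚ (Equiv.Perm (Fin (m + 2)))) =
          PeakDescent.psiHom (m + 2) x) ∧
        (∀ x, (ψ x : MonoidAlgebra ℚ (Equiv.Perm (Fin (m + 2)))) =
          PeakDescent.psiHom (m + 2) x) ∧
        (∀ x, (φ x : MonoidAlgebra ℚ (Equiv.Perm (Fin m))) = PeakDescent.phiHom m x) ∧
        -- the two subspaces are two-sided ideals
        (∀ (a : SolD) (x : PeakDescent.canonicalIdealD m),
          (a : MonoidAlgebra ℚ (PeakDescent.evenSigned (m + 2))) * x ∈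
              PeakDescent.canonicalIdealD m ∧
            (x : MonoidAlgebra ℚ (PeakDescent.evenSigned (m + 2))) * a ∈
              PeakDescent.canonicalIdealD m) ∧
        (∀ (a : P) (x : PeakDescent.peakIdeal (m + 2)),
          (a : MonoidAlgebra ℚ (Equiv.Perm (Fin (m + 2)))) * x ∈
              PeakDescent.peakIdeal (m + 2) ∧
            (x : MonoidAlgebra ℚ (Equiv.Perm (Fin (m + 2)))) * a ∈
              PeakDescent.peakIdeal (m + 2)) ∧
        -- the two squares commute
        (∀ x, ψ (incD x) = incP (ψI x)) ∧
        (∀ x, φ (γ x) = π (ψ x)) ∧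
        -- the rows are exact
        Function.Injective incD ∧ Function.Exact incD γ ∧ Function.Surjective γ ∧
        Function.Injective incP ∧ Function.Exact incP π ∧ Function.Surjective π ∧
        -- the vertical maps are surjective
        Function.Surjective ψI ∧ Function.Surjective ψ ∧ Function.Surjective φ := by

  obtain ⟨Γ, hX, hY⟩ := PeakDescent.exists_gamma m
  obtain ⟨q, hq⟩ := PeakDescent.exists_linearMap_elemP (n := m + 2) (PeakDescent.piValue m)
  set SolD := (PeakDescent.frameD m).descentAlgebra with hSolD
  set SolB := (PeakDescent.frameB m).descentAlgebra with hSolB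
  -- Taking the peak algebras as images of the descent algebras makes them subalgebras for free.
  set P := SolD.map (PeakDescent.psiHom (m + 2)) with hPdef
  set P' := SolB.map (PeakDescent.phiHom m) with hPdef'
  have hD : Subalgebra.toSubmodule SolD = PeakDescent.descentSpace (PeakDescent.genD m) :=
    (PeakDescent.frameD m).toSubmodule_descentAlgebra
  have hB : Subalgebra.toSubmodule SolB = PeakDescent.descentSpace (PeakDescent.genB m) :=
    (PeakDescent.frameB m).toSubmodule_descentAlgebra
  have hP : Subalgebra.toSubmodule P = PeakDescent.peakSpace (m + 2) := by
    rw [hPdef, Subalgebra.map_toSubmodule, hD, PeakDescent.map_psiHom_descentSpace]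
  have hP' : Subalgebra.toSubmodule P' = PeakDescent.peakSpace m := by
    rw [hPdef', Subalgebra.map_toSubmodule, hB, PeakDescent.map_phiHom_descentSpace]
  have mD : ∀ {x}, x ∈ SolD ↔ x ∈ PeakDescent.descentSpace (PeakDescent.genD m) := by
    intro x; rw [← hD]; rfl
  have mB : ∀ {x}, x ∈ SolB ↔ x ∈ PeakDescent.descentSpace (PeakDescent.genB m) := by
    intro x; rw [← hB]; rfl
  have mP : ∀ {x}, x ∈ P ↔ x ∈ PeakDescent.peakSpace (m + 2) := by
    intro x; rw [← hP]; rfl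
  have mP' : ∀ {x}, x ∈ P' ↔ x ∈ PeakDescent.peakSpace m := by
    intro x; rw [← hP']; rfl
  have hcomm : ∀ a ∈ SolD, PeakDescent.phiHom m (Γ a) = q (PeakDescent.psiHom (m + 2) a) :=
    fun a ha => PeakDescent.phiHom_gamma_eq hY hq (mD.1 ha)
  have hψ : ∀ b ∈ P, ∃ a ∈ SolD, PeakDescent.psiHom (m + 2) a = b := fun b hb => hb
  have hΓmem : ∀ a ∈ SolD, Γ a ∈ SolB := fun a ha => mB.2 (PeakDescent.gamma_mem hX (mD.1 ha))
  have hΓmul : ∀ a ∈ SolD, ∀ b ∈ SolD, Γ (a * b) = Γ a * Γ b := fun a ha b hb =>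
    PeakDescent.gamma_mul hX (mD.1 ha) (mD.1 hb)
  have hΓone := PeakDescent.gamma_one hX
  have hqmem : ∀ b ∈ P, q b ∈ P' := by
    intro b hb
    obtain ⟨a, ha, rfl⟩ := hψ b hb
    rw [← hcomm a ha]
    exact ⟨_, hΓmem a ha, rfl⟩
  have hqone : q 1 = 1 := by
    rw [← map_one (PeakDescent.psiHom (m + 2)), ← hcomm 1 SolD.one_mem, hΓone, map_one]
  -- Multiplicativity descends along the surjection `ψ`: products are lifted, multiplied by `Γ`, and
  -- compared through `hcomm`.
  have hqmul : ∀ b ∈ P, ∀ c ∈ P, q (b * c) = q b * q c := by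
    intro b hb c hc
    obtain ⟨a, ha, rfl⟩ := hψ b hb
    obtain ⟨d, hd, rfl⟩ := hψ c hc
    rw [← map_mul, ← hcomm _ (SolD.mul_mem ha hd), hΓmul a ha d hd, map_mul, hcomm a ha,
      hcomm d hd]
  have kerΓ : ∀ {a}, a ∈ SolD → (a ∈ PeakDescent.canonicalIdealD m ↔ Γ a = 0) := fun ha =>
    PeakDescent.mem_canonicalIdealD_iff hX (mD.1 ha)
  have kerq : ∀ {a}, a ∈ P → (a ∈ PeakDescent.peakIdeal (m + 2) ↔ q a = 0) := fun ha =>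
    PeakDescent.mem_peakIdeal_iff hq (mP.1 ha)
  have leD : ∀ x ∈ PeakDescent.canonicalIdealD m, x ∈ SolD := fun x hx =>
    mD.2 (PeakDescent.canonicalIdealD_le m hx)
  have leP : ∀ x ∈ PeakDescent.peakIdeal (m + 2), x ∈ P := fun x hx =>
    mP.2 (PeakDescent.peakIdeal_le _ hx)
  have hψmem : ∀ a ∈ SolD, PeakDescent.psiHom (m + 2) a ∈ P := fun a ha => ⟨a, ha, rfl⟩
  -- By the right-hand square, `ψ` carries the kernel of `γ` into the kernel of `π`.
  have hψI : ∀ x ∈ PeakDescent.canonicalIdealD m,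
      (PeakDescent.psiHom (m + 2)).toLinearMap x ∈ PeakDescent.peakIdeal (m + 2) := fun x hx => by
    have hx' := leD x hx
    rw [AlgHom.toLinearMap_apply, kerq (hψmem x hx'), ← hcomm x hx', (kerΓ hx').1 hx, map_zero]
  refine ⟨SolD, SolB, P, P', hD, hB, hP, hP',
    LinearMap.restrict (q := Subalgebra.toSubmodule SolD) LinearMap.id leD,
    PeakDescent.restrictAlgHom SolD SolB Γ hΓmem hΓone hΓmul,
    LinearMap.restrict (q := Subalgebra.toSubmodule P) LinearMap.id leP,
    PeakDescent.restrictAlgHom P P' q hqmem hqone hqmul,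
    LinearMap.restrict (PeakDescent.psiHom (m + 2)).toLinearMap hψI,
    PeakDescent.restrictAlgHom SolD P (PeakDescent.psiHom (m + 2)).toLinearMap hψmem
      (map_one (PeakDescent.psiHom (m + 2)))
      (fun a _ b _ => map_mul (PeakDescent.psiHom (m + 2)) a b),
    PeakDescent.restrictAlgHom SolB P' (PeakDescent.phiHom m).toLinearMap
      (fun a ha => ⟨a, ha, rfl⟩) (map_one (PeakDescent.phiHom m))
      (fun a _ b _ => map_mul (PeakDescent.phiHom m) a b),
    fun _ => rfl, fun _ => rfl, ?_, ?_, fun _ => rfl, fun _ => rfl, fun _ => rfl, ?_, ?_,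
    fun _ => rfl, ?_, ?_, ?_, ?_, ?_, ?_, ?_, ?_, ?_, ?_⟩
  · exact fun J => ⟨⟨_, mD.2 (PeakDescent.elemX_mem_descentSpace _ J)⟩, rfl, hX J⟩
  · exact fun F hF => ⟨⟨_, mP.2 (PeakDescent.elemP_mem_peakSpace _ F)⟩, rfl, hq F hF⟩
  · rintro ⟨a, ha⟩ ⟨x, hx⟩
    have hx' := leD x hx
    have h0 := (kerΓ hx').1 hx
    exact ⟨(kerΓ (SolD.mul_mem ha hx')).2 (by rw [hΓmul a ha x hx', h0, mul_zero]),
      (kerΓ (SolD.mul_mem hx' ha)).2 (by rw [hΓmul x hx' a ha, h0, zero_mul])⟩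
  · rintro ⟨a, ha⟩ ⟨x, hx⟩
    have hx' := leP x hx
    have h0 := (kerq hx').1 hx
    exact ⟨(kerq (P.mul_mem ha hx')).2 (by rw [hqmul a ha x hx', h0, mul_zero]),
      (kerq (P.mul_mem hx' ha)).2 (by rw [hqmul x hx' a ha, h0, zero_mul])⟩
  · exact fun x => Subtype.ext (hcomm x x.2)
  · intro x y h
    have := congrArg Subtype.val h
    exact Subtype.ext this
  · rintro ⟨a, ha⟩
    refine ⟨fun h => ?_, ?_⟩
    · exact ⟨⟨a, (kerΓ ha).2 (congrArg Subtype.val h)⟩, rfl⟩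
    · rintro ⟨⟨x, hx⟩, h⟩
      obtain rfl : x = a := congrArg Subtype.val h
      exact Subtype.ext ((kerΓ ha).1 hx)
  · rintro ⟨b, hb⟩
    obtain ⟨a, ha, h⟩ := PeakDescent.exists_gamma_eq hX (mB.1 hb)
    exact ⟨⟨a, mD.2 ha⟩, Subtype.ext h⟩
  · intro x y h
    have := congrArg Subtype.val h
    exact Subtype.ext this
  · rintro ⟨a, ha⟩
    refine ⟨fun h => ?_, ?_⟩
    · exact ⟨⟨a, (kerq ha).2 (congrArg Subtype.val h)⟩, rfl⟩
    · rintro ⟨⟨x, hx⟩, h⟩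
      obtain rfl : x = a := congrArg Subtype.val h
      exact Subtype.ext ((kerq ha).1 hx)
  · rintro ⟨c, b, hb, rfl⟩
    obtain ⟨a, ha, rfl⟩ := PeakDescent.exists_gamma_eq hX (mB.1 hb)
    exact ⟨⟨_, hψmem a (mD.2 ha)⟩, Subtype.ext (hcomm a (mD.2 ha)).symm⟩
  · rintro ⟨y, hy⟩
    obtain ⟨x, hx, h⟩ := PeakDescent.peakIdeal_le_map_psiHom m hy
    exact ⟨⟨x, hx⟩, Subtype.ext h⟩
  · rintro ⟨b, a, ha, rfl⟩
    exact ⟨⟨a, ha⟩, rfl⟩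
  · rintro ⟨b, a, ha, rfl⟩
    exact ⟨⟨a, ha⟩, rfl⟩
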